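/- Let $\{0,1\}^k$ be the set of bit vectors $\mathbf b=(b_1,\dots,b_k)$ and put $$\gamma_k(\mathbf b)=\sum_{1\le j<i\le k}1_{[b_i\ne b_j]}\,2^{k-i+j-1},\qquad \widehat\gamma_k(\mathbf b)=k\cdot 2^k+\gamma_k(\mathbf b)+1 .$$ Multigraphs are finite and loopless, and a plane multigraph is given by its combinatorial embedding (the clockwise cyclic order of the edges around each vertex, together with the outer face). Two pairs of edges $(e_1,f_1)$, $(e_2,f_2)$ at a vertex $v$ cross if $e_1,e_2,f_1,f_2$ appear in this or the opposite order in the cyclic order around $v$; two edge-disjoint walks are non-crossing if no pair of consecutive edges of the first crosses a pair of consecutive edges of the second. For a multiset $\mathcal T$ of requests $(s,t,d)\in V(G)\times V(G)\times\mathbb N$, a $\mathcal T$-flow is a family $\mathcal P$ of pairwise edge-disjoint walks with pairwise disjoint subfamilies $\mathcal P_i\subseteq\mathcal P$, one for each request $(s_i,t_i,d_i)\in\mathcal T$, such that $\mathcal P_i$ consists of $d_i$ many $(s_i,t_i)$-walks. It is non-crossing if (a) its walks are pairwise non-crossing, and (b) for every request, the concatenation (at a common endpoint) of any two walks of $\mathcal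 P_i$ is non-crossing with every walk of $\mathcal P\setminus\mathcal P_i$. When the outer face is bounded by a simple cycle, a vertex $v$ on the outer face sees $u_1,\dots,u_r$ in this order (with respect to $\mathcal P$) if, in the clockwise order of the edges at $v$ that starts at the outer face, the walks of $\mathcal P$ joining $v$ to $u_a$ precede those joining $v$ to $u_{a'}$ whenever $a<a'$. For $\gamma\colon\{0,1\}^k\to\mathbb N$ and $Z\subseteq\{0,1\}^k$, a $(k,\gamma,Z)$-Vector Containment Gadget is a plane multigraph $G$ with distinct distinguished vertices $z_1,\dots,z_k,w_0,w_1$, where $w_0,w_1$ lie on the outer face (which, if $k\ge1$, is bounded by a simple cycle), such that for all $\mathbf b\in\{0,1\}^k$ and $d\in\mathbb N$, if $\mathcal T_{\mathbf b,d}$ consists of the requests $(w_{b_i},z_i,2^k)$ for $i=1,\dots,k$ and of $d$ copies of the request $(w_0,w_1,1)$, then the following are equivalent: 1. $d\le\gamma(\mathbf b)+1_{[\mathbf b\in Z]}$; 2. there is a $\mathcal T_{\mathbf b,d}$-flow in $G$; 3. there is a non-crossing $\mathcal T_{\mathbf b,d}$-flow in $G$ in which $w_0$ sees $\{z_i : b_i=0\}$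 in the order of decreasing $i$ and $w_1$ sees $\{z_i : b_i=1\}$ in the order of increasing $i$. **Proposition.** For every $k\in\mathbb N$ and every $Z\subseteq\{0,1\}^k$ there is a (connected) $(k,\widehat\gamma_k,Z)$-Vector Containment Gadget with $2^{\mathcal O(k)}$ vertices and edges. Moreover, there is an algorithm (a program for a random access machine with addition and subtraction at unit cost) that, given $k$ and the characteristic vector of $Z$, constructs such a gadget in time $2^{\mathcal O(k)}$. -/

import Mathlib

namespace VCG

/-! ### Plane multigraphs

A connected plane multigraph is given by its combinatorial embedding: the clockwise rotation at
every vertex, with Euler characteristic two, and a distinguished outer face. -/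

/-- A dart is an edge with a direction: every edge `e` has the two darts `(e, false)` and
`(e, true)`. -/
abbrev Dart (E : Type) : Type := E × Bool

/-- The same edge in the opposite direction. -/
def rev {E : Type} (d : Dart E) : Dart E := (d.1, !d.2)

theorem rev_rev {E : Type} (d : Dart E) : rev (rev d) = d := by
  simp [rev]

/-- Reversal of darts as a permutation. -/
def revPerm (E : Type) : Equiv.Perm (Dart E) := ⟨rev, rev, rev_rev, rev_rev⟩

/-- A loopless multigraph with vertex set `V` and edge set `E`, together with a rotation system. -/
structure RotationSystem (V E : Type) where
  /-- The vertex at which a dart starts. -/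
  src : Dart E → V
  /-- The next dart in the clockwise order around the vertex at which a dart starts. -/
  next : Equiv.Perm (Dart E)
  /-- The darts starting at a common vertex form one cycle of the rotation. -/
  src_eq_iff : ∀ d d', src d = src d' ↔ next.SameCycle d d'
  /-- There are no loops. -/
  loopless : ∀ d, src d ≠ src (rev d)

namespace RotationSystem

variable {V E : Type} (G : RotationSystem V E)

/-- The vertex at which a dart ends. -/
def dst (d : Dart E) : V := G.src (rev d)

/-- Face tracing: after traversing `d`, continue with the dart that follows `rev d` clockwise around
the end of `d`. The cycles of this permutation are the faces. The face of a dart `y` lies to the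
left of `y`, so it contains the corner between the predecessor `G.next.symm y` and `y`. -/
def facePerm : Equiv.Perm (Dart E) := (revPerm E).trans G.next

/-- The faces. -/
def Face : Type := Quotient (Equiv.Perm.SameCycle.setoid G.facePerm)

/-- The darts of the list, traversed in this order, form a walk from `u` to `v`. -/
def IsWalk (u v : V) : List (Dart E) → Prop
  | [] => u = v
  | d :: l => G.src d = u ∧ IsWalk (G.dst d) v l

end RotationSystem

/-- A finite connected plane multigraph (with at least one edge). -/
structure PlaneMultigraph (V E : Type) [Finite V] [Finite E] extends RotationSystem V E where
  connected : ∀ u v, ∃ l, toRotationSystem.IsWalk u v l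
  euler : Nat.card V + Nat.card toRotationSystem.Face = Nat.card E + 2
  /-- A dart having the outer face to its left. -/
  outer : Dart E

namespace PlaneMultigraph

variable {V E : Type} [Finite V] [Finite E] (G : PlaneMultigraph V E)

/-- The dart `d` has the outer face to its left. -/
def OnOuter (d : Dart E) : Prop := G.facePerm.SameCycle G.outer d

/-- The vertex `v` lies on the outer face. -/
def VertexOnOuter (v : V) : Prop := ∃ d, G.src d = v ∧ G.OnOuter d

/-- The outer face is confined by a simple cycle: its boundary walk repeats neither a vertex nor
an edge. -/
def OuterSimpleCycle : Prop :=
  (∀ d d', G.OnOuter d → G.OnOuter d' → G.src d = G.src d' → d = d') ∧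
    ∀ d, G.OnOuter d → ¬ G.OnOuter (rev d)

/-! ### Walks and crossings -/

/-- The darts `a, b, c, d` start at the same vertex, are pairwise distinct and appear there in this
clockwise cyclic order. -/
def CyclicOrder (a b c d : Dart E) : Prop :=
  ∃ i j l : ℕ, 0 < i ∧ i < j ∧ j < l ∧
    (G.next ^ i) a = b ∧ (G.next ^ j) a = c ∧ (G.next ^ l) a = d ∧
    ∀ m, 0 < m → m ≤ l → (G.next ^ m) a ≠ a

/-- The pairs `(e₁, f₁)` and `(e₂, f₂)` of darts at a common vertex cross. -/
def Cross (e₁ f₁ e₂ f₂ : Dart E) : Prop :=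
  G.CyclicOrder e₁ e₂ f₁ f₂ ∨ G.CyclicOrder f₂ f₁ e₂ e₁

/-- A walk. -/
structure Walk where
  start : V
  finish : V
  darts : List (Dart E)
  isWalk : G.IsWalk start finish darts

/-- The list of darts of a walk traversed backwards. -/
def revDarts (l : List (Dart E)) : List (Dart E) := (l.map rev).reverse

/-- No two consecutive edges of the first walk cross two consecutive edges of the second one.
Consecutive darts `d₁, d₂` of a walk leave their common vertex as `rev d₁` and `d₂`. -/
def NonCrossing (l l' : List (Dart E)) : Prop :=
  ∀ d₁ d₂ d₁' d₂', [d₁, d₂] <:+: l → [d₁', d₂'] <:+: l' →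
    ¬ G.Cross (rev d₁) d₂ (rev d₁') d₂'

/-- No common edge, in whatever direction it is traversed. -/
def EdgeDisjoint (l l' : List (Dart E)) : Prop :=
  ∀ d ∈ l, ∀ d' ∈ l', d.1 ≠ d'.1

/-! ### Flows -/

/-- A request. -/
structure Request (V : Type) where
  s : V
  t : V
  demand : ℕ

/-- `P` is a flow for the family of requests `T`, where the walks in `S r` satisfy `T r`. -/
structure IsFlow {R ι : Type} (T : R → Request V) (P : ι → G.Walk) (S : R → Finset ι) :
    Prop where
  edgeDisjoint : ∀ i j, i ≠ j → EdgeDisjoint (P i).darts (P j).darts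
  card : ∀ r, (S r).card = (T r).demand
  start : ∀ r, ∀ i ∈ S r, (P i).start = (T r).s
  finish : ∀ r, ∀ i ∈ S r, (P i).finish = (T r).t
  disjoint : ∀ r r', r ≠ r' → Disjoint (S r) (S r')

/-- All the concatenations of two walks, each of them taken in either direction, as lists of
darts. -/
def IsConcat (W W' : G.Walk) (l : List (Dart E)) : Prop :=
  (W.finish = W'.start ∧ l = W.darts ++ W'.darts) ∨
  (W.finish = W'.finish ∧ l = W.darts ++ revDarts W'.darts) ∨
  (W.start = W'.start ∧ l = revDarts W.darts ++ W'.darts) ∨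
  (W.start = W'.finish ∧ l = revDarts W.darts ++ revDarts W'.darts)

/-- `P` is non-crossing: (a) the walks are pairwise non-crossing, and (b) a concatenation of two
walks for the same request does not cross any walk outside this request. -/
structure IsNonCrossingFlow {R ι : Type} (P : ι → G.Walk) (S : R → Finset ι) : Prop where
  pairwise : ∀ i j, i ≠ j → G.NonCrossing (P i).darts (P j).darts
  concat : ∀ r, ∀ i ∈ S r, ∀ j ∈ S r, i ≠ j → ∀ m ∉ S r,
    ∀ l, G.IsConcat (P i) (P j) l → G.NonCrossing l (P m).darts

/-- There is a flow for the family of requests `T`. -/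
def HasFlow {R : Type} (T : R → Request V) : Prop :=
  ∃ (n : ℕ) (P : Fin n → G.Walk) (S : R → Finset (Fin n)), G.IsFlow T P S

/-- In the clockwise order of the darts at a vertex that starts with `y`, the dart `d` precedes
the dart `d'`. -/
def Precedes (y d d' : Dart E) : Prop :=
  ∃ i j : ℕ, i < j ∧ (G.next ^ i) y = d ∧ (G.next ^ j) y = d' ∧
    ∀ m, 0 < m → m ≤ j → (G.next ^ m) y ≠ y

/-- The walk `W` joins `v` to `u`, in either direction, and uses the dart `d` at its end `v`. -/
def JoinsVia (W : G.Walk) (v u : V) (d : Dart E) : Prop :=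
  (W.start = v ∧ W.finish = u ∧ W.darts.head? = some d) ∨
    (W.finish = v ∧ W.start = u ∧ (revDarts W.darts).head? = some d)

/-- With respect to `P`, the vertex `v` sees the vertices of the list `us` in the order of the
list: in the clockwise order of the edges at `v` that starts next to the outer face, the walks of
`P` joining `v` to an earlier vertex of the list come before those joining `v` to a later one.
(So, among all the walks joining `v` to the vertices of the list, the walks for one vertex form an
interval, and the intervals are ordered as in the list.) -/
def Sees {ι : Type} (P : ι → G.Walk) (v : V) (us : List V) : Prop :=
  v ∉ us ∧ ∃ y, G.src y = v ∧ G.OnOuter y ∧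
    us.Pairwise fun u u' => ∀ i j d d', G.JoinsVia (P i) v u d → G.JoinsVia (P j) v u' d' →
      G.Precedes y d d'

end PlaneMultigraph

open PlaneMultigraph

/-! ### The gadget -/

/-- Bit vectors of length `k`; the coordinates are numbered from `0` to `k - 1`. -/
abbrev BitVector (k : ℕ) : Type := Fin k → Bool

/-- The requests for the vector `b`: `(w_{b i}, z i, 2 ^ k)` for each `i`, and `d` copies of
`(w₀, w₁, 1)`. Here `w false` is `w₀` and `w true` is `w₁`. -/
def gadgetRequests {V : Type} {k : ℕ} (z : Fin k → V) (w : Bool → V) (b : BitVector k) (d : ℕ) :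
    Fin k ⊕ Fin d → Request V
  | Sum.inl i => ⟨w (b i), z i, 2 ^ k⟩
  | Sum.inr _ => ⟨w false, w true, 1⟩

/-- `G` with the distinguished vertices `z i` and `w₀, w₁` is a `(k, γ, Z)`-vector containment
gadget. -/
structure IsVectorContainmentGadget {V E : Type} [Finite V] [Finite E] (k : ℕ)
    (γ : BitVector k → ℕ) (Z : Finset (BitVector k))
    (G : PlaneMultigraph V E) (z : Fin k → V) (w : Bool → V) : Prop where
  distinct : Function.Injective (Sum.elim z w)
  outer : ∀ c, G.VertexOnOuter (w c)
  /-- The order in which a vertex sees others presupposes that the outer face is confined by a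
  simple cycle; for `k = 0` there is nothing to be seen. -/
  outerCycle : 0 < k → G.OuterSimpleCycle
  equiv : ∀ (b : BitVector k) (d : ℕ), List.TFAE [
    d ≤ γ b + (if b ∈ Z then 1 else 0),
    G.HasFlow (gadgetRequests z w b d),
    ∃ (n : ℕ) (P : Fin n → G.Walk) (S : Fin k ⊕ Fin d → Finset (Fin n)),
      G.IsFlow (gadgetRequests z w b d) P S ∧ G.IsNonCrossingFlow P S ∧
      G.Sees P (w false) (((List.finRange k).filter fun i => b i = false).reverse.map z) ∧
      G.Sees P (w true) (((List.finRange k).filter fun i => b i = true).map z)]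

/-- `γ_k(b) = ∑_{j < i} [b_i ≠ b_j] 2 ^ (k - i + j - 1)`. -/
def gamma (k : ℕ) (b : BitVector k) : ℕ :=
  ∑ i : Fin k, ∑ j : Fin k,
    if j < i ∧ b i ≠ b j then 2 ^ (k - (i : ℕ) + (j : ℕ) - 1) else 0

/-- `γ̂_k(b) = k 2 ^ k + γ_k(b) + 1`. -/
def gammaHat (k : ℕ) (b : BitVector k) : ℕ := k * 2 ^ k + gamma k b + 1

/-! ### Random access machines

Structured programs for a random access machine with finitely many registers and arrays of natural
numbers. Every elementary operation (constant, register access, array access, addition, truncated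
subtraction, assignment, test) costs one step. -/

/-- Expressions. -/
inductive Expr
  | lit (n : ℕ)
  | reg (r : ℕ)
  | get (a : ℕ) (i : Expr)
  | add (x y : Expr)
  | sub (x y : Expr)

/-- Programs. -/
inductive Prog
  | skip
  | set (r : ℕ) (x : Expr)
  | put (a : ℕ) (i x : Expr)
  | seq (p q : Prog)
  | ite (x : Expr) (p q : Prog)
  | loop (x : Expr) (p : Prog)

/-- The contents of the registers and of the arrays. -/
@[ext]
structure State where
  reg : ℕ → ℕ
  arr : ℕ → ℕ → ℕ

/-- Write `v` into register `r`. -/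
def State.setReg (s : State) (r v : ℕ) : State :=
  ⟨Function.update s.reg r v, s.arr⟩

/-- Write `v` into entry `i` of array `a`. -/
def State.setArr (s : State) (a i v : ℕ) : State :=
  ⟨s.reg, Function.update s.arr a (Function.update (s.arr a) i v)⟩

/-- The value of an expression. -/
def Expr.eval (s : State) : Expr → ℕ
  | .lit n => n
  | .reg r => s.reg r
  | .get a i => s.arr a (i.eval s)
  | .add x y => x.eval s + y.eval s
  | .sub x y => x.eval s - y.eval s

/-- The number of steps for evaluating an expression. -/
def Expr.cost : Expr → ℕ
  | .lit _ => 1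
  | .reg _ => 1
  | .get _ i => i.cost + 1
  | .add x y => x.cost + y.cost + 1
  | .sub x y => x.cost + y.cost + 1

/-- `Exec p s s' t`: started in state `s`, the program `p` halts in state `s'` after `t` steps.
A test succeeds if the value is not zero, and `loop x p` repeats `p` while this is the case. -/
inductive Exec : Prog → State → State → ℕ → Prop
  | skip (s : State) : Exec .skip s s 1
  | set (s : State) (r : ℕ) (x : Expr) :
      Exec (.set r x) s (s.setReg r (x.eval s)) (x.cost + 1)
  | put (s : State) (a : ℕ) (i x : Expr) :
      Exec (.put a i x) s (s.setArr a (i.eval s) (x.eval s)) (i.cost + x.cost + 1)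
  | seq {p q : Prog} {s s' s'' : State} {t t' : ℕ} :
      Exec p s s' t → Exec q s' s'' t' → Exec (.seq p q) s s'' (t + t')
  | iteTrue {x : Expr} {p q : Prog} {s s' : State} {t : ℕ} :
      x.eval s ≠ 0 → Exec p s s' t → Exec (.ite x p q) s s' (x.cost + 1 + t)
  | iteFalse {x : Expr} {p q : Prog} {s s' : State} {t : ℕ} :
      x.eval s = 0 → Exec q s s' t → Exec (.ite x p q) s s' (x.cost + 1 + t)
  | loopDone {x : Expr} {p : Prog} {s : State} :
      x.eval s = 0 → Exec (.loop x p) s s (x.cost + 1)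
  | loopStep {x : Expr} {p : Prog} {s s' s'' : State} {t t' : ℕ} :
      x.eval s ≠ 0 → Exec p s s' t → Exec (.loop x p) s' s'' t' →
      Exec (.loop x p) s s'' (x.cost + 1 + t + t')

/-! ### Input and output -/

/-- The big-endian value of a bit vector. -/
def value {k : ℕ} (b : BitVector k) : ℕ :=
  ∑ i : Fin k, if b i then 2 ^ (k - 1 - (i : ℕ)) else 0

/-- The input `(k, Z)`: register `0` contains `k`, array `0` contains the characteristic vector of
`Z`, and everything else is zero. -/
def inputState (k : ℕ) (Z : Finset (BitVector k)) : State where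
  reg r := if r = 0 then k else 0
  arr a j := if a = 0 ∧ ∃ b ∈ Z, value b = j then 1 else 0

/-- The number of a dart: `2 e` and `2 e + 1` are the two darts of the edge `e`. -/
def dartCode {m : ℕ} (d : Dart (Fin m)) : ℕ := 2 * (d.1 : ℕ) + d.2.toNat

/-- The state describes `G` with its distinguished vertices: registers `1` to `5` contain the
number of vertices, the number of edges, `w₀`, `w₁` and the outer dart; arrays `1`, `2` and `3`
contain the start of each dart, the clockwise successor of each dart and the vertices `z i`. -/
structure Describes {n m k : ℕ} (s : State) (G : PlaneMultigraph (Fin n) (Fin m))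
    (z : Fin k → Fin n) (w : Bool → Fin n) : Prop where
  vertices : s.reg 1 = n
  edges : s.reg 2 = m
  w_zero : s.reg 3 = w false
  w_one : s.reg 4 = w true
  outer : s.reg 5 = dartCode G.outer
  src : ∀ d, s.arr 1 (dartCode d) = G.src d
  next : ∀ d, s.arr 2 (dartCode d) = dartCode (G.next d)
  z : ∀ i : Fin k, s.arr 3 i = z i

end VCG

/-! ### Rotation systems: cycles, renaming, connectedness, parallel edges -/

namespace VCG

/-! ### Cycles of permutations -/

/-! The graph stacks rows 0, …, k of paths from w₀ to w₁. Row r has 2^r bundles of parallel edges,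
and a triangular grid of thinner bundles joins row r, as its diagonal, to the two halves of row r +
1. With coordinates counted from 0, the coordinate i has level r = k - 1 - i, and z_i is the middle
vertex of row r + 1. A bit vector b gives the bits e r = b_i; read in binary, the bits below r form
a position `idx e r` in row r.

Upper bound: a cut. The curve that passes every row r at `idx e r` separates w₀ from w₁, and it
separates every z_i from the terminal that is to be joined to it. It meets one bundle of each row: 1
edge in row 0, 2^(k+1) edges in every other row, and one additional edge in row k exactly if the
position encodes an element of Z. In triangle r it meets `idx e r` or 2^r - 1 - `idx e r` bundles of
2^(k-1-r) edges, depending on e r; this is the weighted number of lower bits that differ from e r,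
and the sum over r is γ_k(b). Altogether the cut has k 2^k + γ̂_k(b) + 1_[b ∈ Z] edges. Each of the
k 2^k + d walks needs an edge of its own (`card_cutEdges_le`, `mem_cutEdges`, `le_of_hasFlow`).

Existence: planar duality. The faces receive heights (`cellHeight`), from 0 above row 0 to the size
of the cut below row k. Heights on the two sides of a bundle differ at most by the number of its
edges, with an exception explained below, so they can be interpolated inside the bundles
(`unitHeight`). Every label l below the size of the cut then has a level line that separates heights
at most l from larger ones. Lines with different labels share no edge (`Used.ne`) and do not cross
(`Arc.unseparated`), and a line can end only at w₀ or w₁ (`exists_levelWalk`).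

For row r + 1 there is an interval of 2^k labels, the zone, above all heights of triangle r and
below those of the next triangle. Its lines run inside row r + 1. On the half of the row opposite to
the terminal of z_i, the heights leap over the zone; this is the exception, and it is needed because
the capacity of that half falls short by up to 2^k. So these lines stop at z_i and become its 2^k
walks. They enter z_i through one bundle, on consecutive labels, which gives condition (b); the
order of the rows around w₀ and w₁ gives the order in which the z_i are seen.

Algorithm. Edges and vertices have codes with at most five digits in base 2^(k+2). The program runs
through all 2^(5k+10) codes, recognises the valid ones and numbers them by counting. Since only
addition and subtraction are available, powers of two and multiplication and division by the base
are tabulated beforehand. -/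

theorem sameCycle_root {α : Type} (f : Equiv.Perm α) (root : α → α) (μ : α → ℕ)
    (h : ∀ x, x = root x ∨ (root (f x) = root x ∧ μ (f x) < μ x)) (x : α) :
    f.SameCycle x (root x) := by
  -- The measure decreases along the orbit until the representative is met.
  induction hn : μ x using Nat.strong_induction_on generalizing x with
  | _ n ih =>
    rcases h x with h1 | ⟨h1, h2⟩
    · rw [← h1]
    · have := ih _ (hn ▸ h2) (f x) rfl
      rw [h1] at this
      exact Equiv.Perm.sameCycle_apply_left.1 this

theorem SameCycle.map_eq {α β : Type} {f : Equiv.Perm α} {g : α → β} (h : ∀ x, g (f x) = g x)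
    {x y : α} (hxy : f.SameCycle x y) : g x = g y := by
  obtain ⟨i, rfl⟩ := hxy
  induction i using Int.induction_on with
  | zero => simp
  | succ i ih => rw [add_comm, zpow_add, zpow_one, Equiv.Perm.mul_apply, h, ih]
  | pred i ih =>
    rw [ih, ← h ((f ^ (-(i : ℤ) - 1)) x), ← Equiv.Perm.mul_apply, ← zpow_one_add]
    congr 3; ring

/-- An invariant that selects a member of every cycle has one fixed point per cycle. Faces are
counted in this way, without handling the quotient. -/
theorem card_cycles {α : Type} (f : Equiv.Perm α) (root : α → α) (h : ∀ x, root (f x) = root x)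
    (hr : ∀ x, f.SameCycle x (root x)) :
    Nat.card (Quotient (Equiv.Perm.SameCycle.setoid f)) = Nat.card {x // root x = x} := by
  have hi : ∀ x, root (root x) = root x := fun x => (SameCycle.map_eq h (hr x)).symm
  refine Nat.card_congr
    { toFun := Quotient.lift (fun x => (⟨root x, hi x⟩ : {x // root x = x}))
        fun x y hxy => Subtype.ext (SameCycle.map_eq h hxy)
      invFun := fun x => Quotient.mk _ x.1
      left_inv := ?_
      right_inv := fun x => Subtype.ext x.2 }
  rintro ⟨x⟩
  exact Quotient.sound (s := Equiv.Perm.SameCycle.setoid f) (hr x).symm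

theorem sameCycle_permCongr {α β : Type} (e : α ≃ β) (f : Equiv.Perm α) (x y : α) :
    (e.permCongr f).SameCycle (e x) (e y) ↔ f.SameCycle x y := by
  have : ∀ i : ℤ, (e.permCongr f) ^ i = e.permCongr (f ^ i) := fun i =>
    (map_zpow e.permCongrHom f i).symm
  simp [Equiv.Perm.SameCycle, this, Equiv.permCongr_apply]

namespace RotationSystem

/-! ### Renaming -/

section Renaming

variable {V E V' E' : Type} (Γ : RotationSystem V E) (eV : V ≃ V') (eE : E ≃ E')

def dartEquiv : Dart E ≃ Dart E' := eE.prodCongr (Equiv.refl Bool)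

theorem dartEquiv_rev (d : Dart E) : rev (dartEquiv eE d) = dartEquiv eE (rev d) := rfl

/-- The same rotation system with other names for the vertices and edges. -/
def renamed : RotationSystem V' E' where
  src d := eV (Γ.src ((dartEquiv eE).symm d))
  next := (dartEquiv eE).permCongr Γ.next
  src_eq_iff d d' := by
    rw [eV.apply_eq_iff_eq, Γ.src_eq_iff, ← sameCycle_permCongr (dartEquiv eE)]
    simp
  loopless d h := Γ.loopless _ (eV.injective h)

theorem renamed_src (d : Dart E) : (Γ.renamed eV eE).src (dartEquiv eE d) = eV (Γ.src d) := by
  simp [renamed]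

theorem renamed_next (d : Dart E) :
    (Γ.renamed eV eE).next (dartEquiv eE d) = dartEquiv eE (Γ.next d) := by
  simp [renamed, Equiv.permCongr_apply]

theorem renamed_facePerm : (Γ.renamed eV eE).facePerm = (dartEquiv eE).permCongr Γ.facePerm := by
  ext1 d
  obtain ⟨d, rfl⟩ := (dartEquiv eE).surjective d
  simp only [facePerm, Equiv.trans_apply, Equiv.permCongr_apply, Equiv.symm_apply_apply]
  exact Γ.renamed_next eV eE (rev d)

theorem renamed_card_face : Nat.card (Γ.renamed eV eE).Face = Nat.card Γ.Face := by
  symm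
  refine Nat.card_congr (Quotient.congr (dartEquiv eE) fun x y => ?_)
  change Γ.facePerm.SameCycle x y ↔ (Γ.renamed eV eE).facePerm.SameCycle _ _
  rw [renamed_facePerm, sameCycle_permCongr]

end Renaming

/-! ### Connectedness -/

section Connected

variable {V E : Type} (Γ : RotationSystem V E)

/-- Two vertices are joined by a walk. -/
def Joined (u v : V) : Prop := ∃ l, Γ.IsWalk u v l

variable {Γ}

theorem Joined.refl (u : V) : Γ.Joined u u := ⟨[], rfl⟩

theorem IsWalk.append {u v w : V} {l l' : List (Dart E)} (h : Γ.IsWalk u v l)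
    (h' : Γ.IsWalk v w l') : Γ.IsWalk u w (l ++ l') := by
  induction l generalizing u with
  | nil => rw [show u = v from h]; exact h'
  | cons d l ih => exact ⟨h.1, ih h.2⟩

theorem IsWalk.reverse {u v : V} {l : List (Dart E)} (h : Γ.IsWalk u v l) :
    Γ.IsWalk v u (PlaneMultigraph.revDarts l) := by
  induction l generalizing u with
  | nil => exact Eq.symm h
  | cons d l ih =>
    have := ih h.2
    simp only [PlaneMultigraph.revDarts, List.map_cons, List.reverse_cons] at this ⊢
    refine this.append ⟨rfl, ?_⟩
    change Γ.src (rev (rev d)) = u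
    rw [rev_rev, h.1]

theorem Joined.symm {u v : V} (h : Γ.Joined u v) : Γ.Joined v u := by
  obtain ⟨l, hl⟩ := h
  exact ⟨_, hl.reverse⟩

theorem Joined.trans {u v w : V} (h : Γ.Joined u v) (h' : Γ.Joined v w) : Γ.Joined u w := by
  obtain ⟨l, hl⟩ := h
  obtain ⟨l', hl'⟩ := h'
  exact ⟨_, hl.append hl'⟩

theorem Joined.dart (d : Dart E) : Γ.Joined (Γ.src d) (Γ.dst d) := ⟨[d], rfl, rfl⟩

theorem renamed_joined {V' E' : Type} (eV : V ≃ V') (eE : E ≃ E') {u v : V} (h : Γ.Joined u v) :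
    (Γ.renamed eV eE).Joined (eV u) (eV v) := by
  obtain ⟨l, hl⟩ := h
  induction l generalizing u with
  | nil => rw [show u = v from hl]; exact Joined.refl _
  | cons d l ih =>
    have h1 := Joined.dart (Γ := Γ.renamed eV eE) (dartEquiv eE d)
    rw [dst, dartEquiv_rev, renamed_src, renamed_src, hl.1] at h1
    exact h1.trans (ih hl.2)

end Connected

/-! ### Parallel edges -/

section BlowUp

variable {V B : Type} (Γ : RotationSystem V B) (m : B → ℕ)

/-- The edges after every edge `b` has been replaced by `m b` parallel ones. -/
abbrev Copies : Type := Σ b, Fin (m b)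

variable {m} (hm : ∀ b, 0 < m b)

/-- The first copy of a dart in the clockwise order around its start. -/
def firstCopy : Dart B → Dart (Copies m)
  | (b, false) => (⟨b, ⟨0, hm b⟩⟩, false)
  | (b, true) => (⟨b, ⟨m b - 1, Nat.sub_lt (hm b) one_pos⟩⟩, true)

/-- The last copy of a dart in the clockwise order around its start. -/
def lastCopy : Dart B → Dart (Copies m)
  | (b, true) => (⟨b, ⟨0, hm b⟩⟩, true)
  | (b, false) => (⟨b, ⟨m b - 1, Nat.sub_lt (hm b) one_pos⟩⟩, false)

/-- The rotation after edges have been replaced by parallel ones. -/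
def copyNext : Dart (Copies m) → Dart (Copies m)
  | (⟨b, c⟩, false) =>
    if h : c.1 + 1 < m b then (⟨b, ⟨c.1 + 1, h⟩⟩, false) else firstCopy hm (Γ.next (b, false))
  | (⟨b, c⟩, true) =>
    if 0 < c.1 then (⟨b, ⟨c.1 - 1, (Nat.sub_le _ _).trans_lt c.2⟩⟩, true)
    else firstCopy hm (Γ.next (b, true))

/-- The inverse of `copyNext`. -/
def copyPrev : Dart (Copies m) → Dart (Copies m)
  | (⟨b, c⟩, true) =>
    if h : c.1 + 1 < m b then (⟨b, ⟨c.1 + 1, h⟩⟩, true) else lastCopy hm (Γ.next.symm (b, true))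
  | (⟨b, c⟩, false) =>
    if 0 < c.1 then (⟨b, ⟨c.1 - 1, (Nat.sub_le _ _).trans_lt c.2⟩⟩, false)
    else lastCopy hm (Γ.next.symm (b, false))

theorem copyPrev_firstCopy (x : Dart B) :
    copyPrev Γ hm (firstCopy hm x) = lastCopy hm (Γ.next.symm x) := by
  obtain ⟨b, _ | _⟩ := x
  · simp [firstCopy, copyPrev]
  · have := hm b
    simp only [firstCopy, copyPrev]
    rw [dif_neg (by omega)]

theorem copyNext_lastCopy (x : Dart B) :
    copyNext Γ hm (lastCopy hm x) = firstCopy hm (Γ.next x) := by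
  obtain ⟨b, _ | _⟩ := x
  · have := hm b
    simp only [lastCopy, copyNext]
    rw [dif_neg (by omega)]
  · simp [lastCopy, copyNext]

theorem eq_lastCopy_false {b : B} {c : Fin (m b)} (h : ¬ c.1 + 1 < m b) :
    ((⟨b, c⟩, false) : Dart (Copies m)) = lastCopy hm (b, false) := by
  have : c = ⟨m b - 1, Nat.sub_lt (hm b) one_pos⟩ := Fin.ext (by simp only; omega)
  rw [lastCopy, ← this]

theorem eq_lastCopy_true {b : B} {c : Fin (m b)} (h : ¬ 0 < c.1) :
    ((⟨b, c⟩, true) : Dart (Copies m)) = lastCopy hm (b, true) := by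
  have : c = ⟨0, hm b⟩ := Fin.ext (by simp only; omega)
  rw [lastCopy, ← this]

theorem eq_firstCopy_true {b : B} {c : Fin (m b)} (h : ¬ c.1 + 1 < m b) :
    ((⟨b, c⟩, true) : Dart (Copies m)) = firstCopy hm (b, true) := by
  have : c = ⟨m b - 1, Nat.sub_lt (hm b) one_pos⟩ := Fin.ext (by simp only; omega)
  rw [firstCopy, ← this]

theorem eq_firstCopy_false {b : B} {c : Fin (m b)} (h : ¬ 0 < c.1) :
    ((⟨b, c⟩, false) : Dart (Copies m)) = firstCopy hm (b, false) := by
  have : c = ⟨0, hm b⟩ := Fin.ext (by simp only; omega)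
  rw [firstCopy, ← this]

theorem copyPrev_copyNext (d : Dart (Copies m)) : copyPrev Γ hm (copyNext Γ hm d) = d := by
  obtain ⟨⟨b, c⟩, _ | _⟩ := d
  · by_cases h : c.1 + 1 < m b
    · simp [copyNext, copyPrev, h]
    · rw [copyNext, dif_neg h, copyPrev_firstCopy, Equiv.symm_apply_apply,
        eq_lastCopy_false hm h]
  · by_cases h : 0 < c.1
    · have h2 : c.1 - 1 + 1 = c.1 := by omega
      simp [copyNext, copyPrev, h, h2]
    · rw [copyNext, if_neg h, copyPrev_firstCopy, Equiv.symm_apply_apply, eq_lastCopy_true hm h]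

theorem copyNext_copyPrev (d : Dart (Copies m)) : copyNext Γ hm (copyPrev Γ hm d) = d := by
  obtain ⟨⟨b, c⟩, _ | _⟩ := d
  · by_cases h : 0 < c.1
    · have h2 : c.1 - 1 + 1 = c.1 := by omega
      simp [copyNext, copyPrev, h, h2]
    · rw [copyPrev, if_neg h, copyNext_lastCopy, Equiv.apply_symm_apply, eq_firstCopy_false hm h]
  · by_cases h : c.1 + 1 < m b
    · simp [copyNext, copyPrev, h]
    · rw [copyPrev, dif_neg h, copyNext_lastCopy, Equiv.apply_symm_apply,
        eq_firstCopy_true hm h]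

/-- `copyNext` as a permutation. -/
def copyPerm : Equiv.Perm (Dart (Copies m)) :=
  ⟨copyNext Γ hm, copyPrev Γ hm, copyPrev_copyNext Γ hm, copyNext_copyPrev Γ hm⟩

/-- The dart of which a dart is a copy. -/
def ofCopy (d : Dart (Copies m)) : Dart B := (d.1.1, d.2)

theorem ofCopy_firstCopy (x : Dart B) : ofCopy (firstCopy hm x) = x := by
  obtain ⟨b, _ | _⟩ := x <;> rfl

/-- The copies of an edge appear in opposite orders at its two ends: numbers increase for `false`
and decrease for `true`. Hence the second induction is on the distance from the last number. -/
theorem sameCycle_firstCopy (d : Dart (Copies m)) :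
    (copyPerm Γ hm).SameCycle d (firstCopy hm (ofCopy d)) := by
  obtain ⟨⟨b, c, hc⟩, _ | _⟩ := d
  · induction c with
    | zero => rfl
    | succ c ih =>
      have := ih (by omega)
      rw [← Equiv.Perm.sameCycle_apply_left] at this
      simpa [copyPerm, copyNext, hc, ofCopy] using this
  · obtain ⟨j, hj⟩ : ∃ j, j + c + 1 = m b := ⟨m b - c - 1, by omega⟩
    induction j generalizing c with
    | zero =>
      have h : ¬ c + 1 < m b := by omega
      rw [eq_firstCopy_true hm (c := ⟨c, hc⟩) h]; rfl
    | succ j ih =>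
      have := ih (c + 1) (by omega) (by omega)
      rw [← Equiv.Perm.sameCycle_apply_left] at this
      simpa [copyPerm, copyNext, hc, ofCopy] using this

theorem sameCycle_lastCopy (x : Dart B) :
    (copyPerm Γ hm).SameCycle (lastCopy hm x) (firstCopy hm x) := by
  have := sameCycle_firstCopy Γ hm (lastCopy hm x)
  obtain ⟨b, _ | _⟩ := x <;> exact this

theorem sameCycle_copy [Finite B] {x y : Dart B} (h : Γ.next.SameCycle x y) :
    (copyPerm Γ hm).SameCycle (firstCopy hm x) (firstCopy hm y) := by
  obtain ⟨i, rfl⟩ := h.exists_nat_pow_eq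
  clear h
  induction i with
  | zero => rfl
  | succ i ih =>
    refine ih.trans ?_
    rw [pow_succ', Equiv.Perm.mul_apply, ← copyNext_lastCopy]
    exact (sameCycle_lastCopy Γ hm _).symm.trans
      (Equiv.Perm.sameCycle_apply_right.2 (Equiv.Perm.SameCycle.refl _ _))

theorem src_next (d : Dart B) : Γ.src (Γ.next d) = Γ.src d :=
  (Γ.src_eq_iff _ _).2 (Equiv.Perm.sameCycle_apply_left.2 (Equiv.Perm.SameCycle.refl _ _))

/-- Every edge `b` is replaced by `m b` parallel edges. -/
def blowUp [Finite B] : RotationSystem V (Copies m) where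
  src d := Γ.src (ofCopy d)
  next := copyPerm Γ hm
  src_eq_iff d d' := by
    constructor
    · intro h
      exact (sameCycle_firstCopy Γ hm d).trans
        ((sameCycle_copy Γ hm ((Γ.src_eq_iff _ _).1 h)).trans (sameCycle_firstCopy Γ hm d').symm)
    · refine fun h => SameCycle.map_eq (g := fun d => Γ.src (ofCopy d)) (fun d => ?_) h
      obtain ⟨⟨b, c⟩, _ | _⟩ := d <;> simp only [copyPerm, Equiv.coe_fn_mk, copyNext] <;> split_ifs
      · rfl
      · rw [ofCopy_firstCopy, src_next]; rfl
      · rfl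
      · rw [ofCopy_firstCopy, src_next]; rfl
  loopless d := Γ.loopless (ofCopy d)

/-- A dart of every face after the replacement by parallel edges. -/
def copyFaceRoot (root : Dart B → Dart B) : Dart (Copies m) → Dart (Copies m)
  | (⟨b, c⟩, false) =>
    if 0 < c.1 then (⟨b, ⟨c.1 - 1, (Nat.sub_le _ _).trans_lt c.2⟩⟩, true)
    else firstCopy hm (root (b, false))
  | (⟨b, c⟩, true) => if c.1 + 1 < m b then (⟨b, c⟩, true) else firstCopy hm (root (b, true))

theorem copyFaceRoot_firstCopy (root : Dart B → Dart B) (x : Dart B) :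
    copyFaceRoot hm root (firstCopy hm x) = firstCopy hm (root x) := by
  obtain ⟨b, _ | _⟩ := x
  · simp [firstCopy, copyFaceRoot]
  · have := hm b
    simp only [firstCopy, copyFaceRoot]
    rw [if_neg (by omega)]

/-- The reverse of a first copy is a last copy at the other end, from which the rotation moves on to
another bundle. So the first copies trace the original faces. -/
theorem blowUp_facePerm_firstCopy [Finite B] (x : Dart B) :
    (Γ.blowUp hm).facePerm (firstCopy hm x) = firstCopy hm (Γ.facePerm x) := by
  have : rev (firstCopy hm x) = lastCopy hm (rev x) := by
    obtain ⟨b, _ | _⟩ := x <;> rfl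
  change copyNext Γ hm (rev (firstCopy hm x)) = _
  rw [this, copyNext_lastCopy]
  rfl

/-- A first copy bounds an original face; every other dart bounds the digon between its edge and a
neighbouring copy. -/
theorem copyFaceRoot_facePerm [Finite B] {root : Dart B → Dart B}
    (hroot : ∀ x, root (Γ.facePerm x) = root x) (d : Dart (Copies m)) :
    copyFaceRoot hm root ((Γ.blowUp hm).facePerm d) = copyFaceRoot hm root d := by
  obtain ⟨⟨b, c⟩, _ | _⟩ := d
  · by_cases h : 0 < c.1
    · have h1 : c.1 - 1 + 1 < m b := by omega
      change copyFaceRoot hm root (copyNext Γ hm (⟨b, c⟩, true)) = _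
      simp [copyNext, copyFaceRoot, h, h1]
    · rw [eq_firstCopy_false hm h, blowUp_facePerm_firstCopy, copyFaceRoot_firstCopy, hroot,
        copyFaceRoot_firstCopy]
  · by_cases h : c.1 + 1 < m b
    · change copyFaceRoot hm root (copyNext Γ hm (⟨b, c⟩, false)) = _
      simp [copyNext, copyFaceRoot, h]
    · rw [eq_firstCopy_true hm h, blowUp_facePerm_firstCopy, copyFaceRoot_firstCopy, hroot,
        copyFaceRoot_firstCopy]

theorem sameCycle_face_firstCopy [Finite B] {x y : Dart B} (h : Γ.facePerm.SameCycle x y) :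
    (Γ.blowUp hm).facePerm.SameCycle (firstCopy hm x) (firstCopy hm y) := by
  obtain ⟨i, rfl⟩ := h.exists_nat_pow_eq
  clear h
  induction i with
  | zero => rfl
  | succ i ih =>
    refine ih.trans ?_
    rw [pow_succ', Equiv.Perm.mul_apply, ← blowUp_facePerm_firstCopy]
    exact Equiv.Perm.sameCycle_apply_right.2 (Equiv.Perm.SameCycle.refl _ _)

theorem sameCycle_copyFaceRoot [Finite B] {root : Dart B → Dart B}
    (hr : ∀ x, Γ.facePerm.SameCycle x (root x)) (d : Dart (Copies m)) :
    (Γ.blowUp hm).facePerm.SameCycle d (copyFaceRoot hm root d) := by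
  obtain ⟨⟨b, c⟩, _ | _⟩ := d
  · by_cases h : 0 < c.1
    · rw [← Equiv.Perm.sameCycle_apply_left]
      change Equiv.Perm.SameCycle _ (copyNext Γ hm (⟨b, c⟩, true)) _
      simp [copyNext, copyFaceRoot, h, Equiv.Perm.SameCycle.refl]
    · rw [eq_firstCopy_false hm h, copyFaceRoot_firstCopy]
      exact sameCycle_face_firstCopy Γ hm (hr _)
  · by_cases h : c.1 + 1 < m b
    · simp [copyFaceRoot, h, Equiv.Perm.SameCycle.refl]
    · rw [eq_firstCopy_true hm h, copyFaceRoot_firstCopy]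
      exact sameCycle_face_firstCopy Γ hm (hr _)

/-- The fixed points of `copyFaceRoot`: the faces of the original graph and those between
consecutive parallel edges. -/
def copyFaceRootEquiv {root : Dart B → Dart B} :
    {d : Dart (Copies m) // copyFaceRoot hm root d = d} ≃
      {x // root x = x} ⊕ Σ b, Fin (m b - 1) where
  toFun d :=
    if h : d.1.2 = true ∧ d.1.1.2.1 + 1 < m d.1.1.1 then
      Sum.inr ⟨d.1.1.1, ⟨d.1.1.2.1, by omega⟩⟩
    else Sum.inl ⟨ofCopy d.1, by
      obtain ⟨⟨⟨b, c⟩, _ | _⟩, hd⟩ := d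
      · by_cases h0 : 0 < c.1
        · simp [copyFaceRoot, h0] at hd
        · rw [eq_firstCopy_false hm h0, copyFaceRoot_firstCopy] at hd
          have := congrArg ofCopy hd
          rwa [ofCopy_firstCopy, ofCopy_firstCopy] at this
      · have h0 : ¬ c.1 + 1 < m b := fun h0 => h ⟨rfl, h0⟩
        rw [eq_firstCopy_true hm h0, copyFaceRoot_firstCopy] at hd
        have := congrArg ofCopy hd
        rwa [ofCopy_firstCopy, ofCopy_firstCopy] at this⟩
  invFun := Sum.elim (fun x => ⟨firstCopy hm x.1, by rw [copyFaceRoot_firstCopy, x.2]⟩)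
    fun p => ⟨(⟨p.1, ⟨p.2.1, by omega⟩⟩, true), by
      have : p.2.1 + 1 < m p.1 := by omega
      simp [copyFaceRoot, this]⟩
  left_inv d := by
    obtain ⟨⟨⟨b, c⟩, _ | _⟩, hd⟩ := d
    · by_cases h0 : 0 < c.1
      · simp [copyFaceRoot, h0] at hd
      · apply Subtype.ext
        simp only [Bool.false_eq_true, false_and, dite_false, Sum.elim_inl]
        exact (eq_firstCopy_false hm h0).symm
    · by_cases h0 : c.1 + 1 < m b
      · simp [h0]
      · apply Subtype.ext
        simp only [h0, and_false, dite_false, Sum.elim_inl]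
        exact (eq_firstCopy_true hm h0).symm
  right_inv p := by
    rcases p with ⟨⟨b, _ | _⟩, hx⟩ | ⟨b, c⟩
    · simp [firstCopy, ofCopy]
    · have h0 := hm b
      have : ¬ m b - 1 + 1 < m b := by omega
      simp [firstCopy, ofCopy, this]
    · have : c.1 + 1 < m b := by omega
      simp [this]

/-- Each additional parallel edge creates one digon, so the Euler characteristic is preserved. -/
theorem blowUp_euler [Finite V] [Finite B] {root : Dart B → Dart B}
    (h : ∀ x, root (Γ.facePerm x) = root x) (hr : ∀ x, Γ.facePerm.SameCycle x (root x))
    (heuler : Nat.card V + Nat.card {x // root x = x} = Nat.card B + 2) :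
    Nat.card V + Nat.card (Γ.blowUp hm).Face = Nat.card (Copies m) + 2 := by
  have := Fintype.ofFinite B
  have h1 : Nat.card (Γ.blowUp hm).Face = _ :=
    card_cycles _ _ (copyFaceRoot_facePerm Γ hm h) (sameCycle_copyFaceRoot Γ hm hr)
  rw [h1, Nat.card_congr (copyFaceRootEquiv hm), Nat.card_sum, Nat.card_sigma, Nat.card_sigma]
  simp only [Nat.card_eq_fintype_card, Fintype.card_fin] at heuler ⊢
  have h2 : ∑ b, m b = ∑ b, (m b - 1) + Fintype.card B := by
    rw [Fintype.card_eq_sum_ones, ← Finset.sum_add_distrib]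
    exact Finset.sum_congr rfl fun b _ => by have := hm b; omega
  omega

theorem blowUp_joined [Finite B] {u v : V} (h : Γ.Joined u v) : (Γ.blowUp hm).Joined u v := by
  obtain ⟨l, hl⟩ := h
  induction l generalizing u with
  | nil => rw [show u = v from hl]; exact Joined.refl _
  | cons d l ih =>
    have h1 := Joined.dart (Γ := Γ.blowUp hm) (firstCopy hm d)
    have h2 : (Γ.blowUp hm).src (firstCopy hm d) = u := by
      change Γ.src (ofCopy (firstCopy hm d)) = u
      rw [ofCopy_firstCopy, hl.1]
    have h3 : (Γ.blowUp hm).dst (firstCopy hm d) = Γ.dst d := by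
      obtain ⟨b, _ | _⟩ := d <;> rfl
    rw [h2, h3] at h1
    exact h1.trans (ih hl.2)

end BlowUp

end RotationSystem

end VCG

namespace VCG

/-! ### The bundles of the gadget

The gadget has the rows `0, …, k`. Row `r` consists of the bundles `D r u` for `u < 2 ^ r`, which lead
from `w₀` on the left to `w₁` on the right. Between the rows `r` and `r + 1` there is a triangular
grid with the points `(s, t)`, `0 ≤ s ≤ t ≤ 2 ^ r`: its diagonal is row `r`, and its other two sides
form row `r + 1`. Every bundle has a left and a right end. -/

/-- Bundles of parallel edges: `D r u` joins `(u, u)` to `(u + 1, u + 1)`, `A r s t` joins `(s, t)`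
to `(s + 1, t)`, and `B r s t` joins `(s, t)` to `(s, t + 1)`. -/
inductive Bundle
  | D (r u : ℕ)
  | A (r s t : ℕ)
  | B (r s t : ℕ)

open VCG.Bundle

/-- The bundles of the gadget for bit vectors of length `k`. -/
def Bundle.Valid (k : ℕ) : Bundle → Prop
  | D r u => r ≤ k ∧ u < 2 ^ r
  | A r s t => r < k ∧ s < t ∧ t < 2 ^ r
  | B r s t => r < k ∧ 1 ≤ s ∧ s ≤ t ∧ t < 2 ^ r

/-- The vertices: `w₀`, `w₁` and the inner points of the triangles and of their diagonals. -/
inductive Point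
  | w (c : Bool)
  | p (r s t : ℕ)

/-- The vertices of the gadget for bit vectors of length `k`. -/
def Point.Valid (k : ℕ) : Point → Prop
  | .w _ => True
  | .p r s t => 1 ≤ s ∧ s ≤ t ∧ t < 2 ^ r ∧ (r < k ∨ r = k ∧ s = t)

/-- The vertex at the point `(s, t)` of triangle `r`. -/
def point (r s t : ℕ) : Point :=
  if s = t then
    if s = 0 then .w false else if s = 2 ^ r then .w true else .p r s t
  else if s = 0 then .p (r + 1) t t
  else if t = 2 ^ r then .p (r + 1) (2 ^ r + s) (2 ^ r + s)
  else .p r s t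

/-- The end of a bundle: the left one for `false`, the right one for `true`. -/
def bundleSrc : Bundle × Bool → Point
  | (D r u, false) => point r u u
  | (D r u, true) => point r (u + 1) (u + 1)
  | (A r s t, false) => point r s t
  | (A r s t, true) => point r (s + 1) t
  | (B r s t, false) => point r s t
  | (B r s t, true) => point r s (t + 1)

/-- The next bundle in the clockwise order around an end of a bundle. -/
def bundleNext (k : ℕ) : Bundle × Bool → Bundle × Bool
  | (A r s t, false) => if s = 0 then (D (r + 1) t, false) else (B r s t, false)
  | (A r s t, true) => if s + 1 < t then (B r (s + 1) (t - 1), true) else (D r (t - 1), true)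
  | (B r s t, false) => (A r (s - 1) t, true)
  | (B r s t, true) =>
    if t + 1 < 2 ^ r then (A r s (t + 1), false) else (D (r + 1) (2 ^ r + s), false)
  | (D r u, false) =>
    if u = 0 then if r < k then (D (r + 1) 0, false) else (D 0 0, false)
    else if r < k then (B r u u, false) else (D r (u - 1), true)
  | (D 0 _, true) => (D k (2 ^ k - 1), true)
  | (D (r + 1) u, true) =>
    if u + 1 = 2 ^ (r + 1) then (D r (2 ^ r - 1), true)
    else if u + 1 < 2 ^ r then (A r 0 (u + 1), false)
    else if u + 1 = 2 ^ r then (D (r + 1) (u + 1), false)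
    else (B r (u + 1 - 2 ^ r) (2 ^ r - 1), true)

/-- The inverse of `bundleNext`. -/
def bundlePrev (k : ℕ) : Bundle × Bool → Bundle × Bool
  | (B r s t, false) => if s < t then (A r s t, false) else (D r s, false)
  | (A r s t, true) => (B r (s + 1) t, false)
  | (B r s t, true) =>
    if t + 1 < 2 ^ r then (A r (s - 1) (t + 1), true) else (D (r + 1) (2 ^ r + s - 1), true)
  | (A r s t, false) => if s = 0 then (D (r + 1) (t - 1), true) else (B r s (t - 1), true)
  | (D r u, true) =>
    if u + 1 = 2 ^ r then
      if r < k then (D (r + 1) (2 ^ (r + 1) - 1), true) else (D 0 0, true)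
    else if r < k then (A r u (u + 1), true) else (D k (u + 1), false)
  | (D 0 _, false) => (D k 0, false)
  | (D (r + 1) u, false) =>
    if u = 0 then (D r 0, false)
    else if u < 2 ^ r then (A r 0 u, false)
    else if u = 2 ^ r then (D (r + 1) (u - 1), true)
    else (B r (u - 2 ^ r) (2 ^ r - 1), true)

theorem point_valid {k r s t : ℕ} (hst : s ≤ t) (ht : t ≤ 2 ^ r) (hr : r < k ∨ r = k ∧ s = t) :
    (point r s t).Valid k := by
  have := Nat.one_le_two_pow (n := r)
  unfold point
  split_ifs <;> simp only [Point.Valid, pow_succ, and_true] <;> omega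

theorem bundleSrc_valid {k : ℕ} {d : Bundle × Bool} (h : d.1.Valid k) : (bundleSrc d).Valid k := by
  obtain ⟨_ | _ | _, _ | _⟩ := d <;> simp only [Bundle.Valid] at h <;>
    exact point_valid (by omega) (by omega) (by omega)

theorem bundleNext_valid {k : ℕ} {d : Bundle × Bool} (h : d.1.Valid k) :
    (bundleNext k d).1.Valid k := by
  have h1 := Nat.one_le_two_pow (n := k)
  obtain ⟨⟨_ | r, u⟩ | ⟨r, s, t⟩ | ⟨r, s, t⟩, _ | _⟩ := d <;> simp only [Bundle.Valid] at h <;>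
    simp only [bundleNext] <;>
    (try have h2 := Nat.one_le_two_pow (n := r)) <;> (try simp only [pow_succ] at h ⊢) <;>
    (try split_ifs) <;> simp only [Bundle.Valid, pow_succ] <;> omega

/-- This composition alone suffices: it makes the rotation injective on the valid darts, which form
a finite set. -/
theorem bundlePrev_bundleNext {k : ℕ} {d : Bundle × Bool} (h : d.1.Valid k) :
    bundlePrev k (bundleNext k d) = d := by
  have h1 := Nat.one_le_two_pow (n := k)
  obtain ⟨⟨_ | r, u⟩ | ⟨r, s, t⟩ | ⟨r, s, t⟩, _ | _⟩ := d <;> simp only [Bundle.Valid] at h <;>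
    simp only [bundleNext] <;>
    (try have h2 := Nat.one_le_two_pow (n := r)) <;> (try simp only [pow_succ] at h ⊢) <;>
    (try split_ifs) <;> simp only [bundlePrev, pow_succ] <;> (try split_ifs) <;>
    (try simp only [Prod.mk.injEq, D.injEq, A.injEq, B.injEq, and_true, true_and]) <;>
    first | omega | contradiction

theorem bundleSrc_bundleNext {k : ℕ} {d : Bundle × Bool} (h : d.1.Valid k) :
    bundleSrc (bundleNext k d) = bundleSrc d := by
  have h1 := Nat.one_le_two_pow (n := k)
  obtain ⟨⟨_ | r, u⟩ | ⟨r, s, t⟩ | ⟨r, s, t⟩, _ | _⟩ := d <;> simp only [Bundle.Valid] at h <;>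
    simp only [bundleNext] <;>
    (try have h2 := Nat.one_le_two_pow (n := r)) <;> (try simp only [pow_succ] at h ⊢) <;>
    (try split_ifs) <;> simp only [bundleSrc, point, pow_succ] <;> (try split_ifs) <;>
    (try simp only [Point.p.injEq, Point.w.injEq, reduceCtorEq, true_and, and_true]) <;>
    first | omega | contradiction

/-- A dart starting at a vertex. -/
def pointRoot (k : ℕ) : Point → Bundle × Bool
  | .w false => (D 0 0, false)
  | .w true => (D k (2 ^ k - 1), true)
  | .p r s t => if s = t then (D r s, false) else (A r s t, false)

/-- The number of clockwise steps to `pointRoot` is at most this. -/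
def pointRank (k : ℕ) : Bundle × Bool → ℕ
  | (A _ s _, false) => if s = 0 then 1 else 0
  | (A _ _ _, true) => 3
  | (B _ _ _, false) => 4
  | (B _ _ _, true) => 1
  | (D r u, false) => if u = 0 then if r = 0 then 0 else k + 1 - r else 0
  | (D r u, true) => if u + 1 = 2 ^ r then if r = k then 0 else r + 1 else 2

/-- This yields that the darts at a vertex form a single cycle. At w₀ and w₁ the rank counts the
rows still to be passed; the other vertices have few darts. -/
theorem eq_pointRoot_or_lt {k : ℕ} {d : Bundle × Bool} (h : d.1.Valid k) :
    d = pointRoot k (bundleSrc d) ∨ pointRank k (bundleNext k d) < pointRank k d := by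
  have h1 := Nat.one_le_two_pow (n := k)
  have h4 : 0 = k → 2 ^ k = 1 := by rintro rfl; rfl
  obtain ⟨⟨_ | r, u⟩ | ⟨r, s, t⟩ | ⟨r, s, t⟩, _ | _⟩ := d <;> simp only [Bundle.Valid] at h <;>
    simp only [bundleNext] <;>
    (try have h2 := Nat.one_le_two_pow (n := r)) <;> (try simp only [pow_succ] at h ⊢) <;>
    (try have h3 : r + 1 = k → 2 ^ k = 2 ^ r * 2 := by rintro rfl; rfl) <;>
    simp only [bundleSrc, point] <;> (try split_ifs) <;>
    simp only [pointRoot, pointRank, pow_succ] <;> (try split_ifs) <;>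
    (try simp only [Prod.mk.injEq, D.injEq, A.injEq, and_true, true_and, reduceCtorEq,
      false_and, and_false, false_or, true_or]) <;>
    first | omega | contradiction

end VCG

namespace VCG

open VCG.Bundle

/-! ### The faces between the bundles -/

/-- The faces: the outer face, whose upper and lower part are distinguished, and the squares and
triangles of the grids. -/
inductive Cell
  | top
  | bot
  | X (r p q : ℕ)

/-- The face above a bundle. -/
def topCell : Bundle → Cell
  | D 0 _ => .top
  | D (r + 1) u => if u < 2 ^ r then .X r 0 u else .X r (u - 2 ^ r) (2 ^ r - 1)
  | A r s t => .X r s (t - 1)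
  | B r s t => .X r s t

/-- The face below a bundle. -/
def botCell (k : ℕ) : Bundle → Cell
  | D r u => if r < k then .X r u u else .bot
  | A r s t => .X r s t
  | B r s t => .X r (s - 1) t

/-- The face to the left of a bundle, traversed in either direction. -/
def cell (k : ℕ) : Bundle × Bool → Cell
  | (b, false) => topCell b
  | (b, true) => botCell k b

/-- The dart in the opposite direction. -/
def bundleRev (d : Bundle × Bool) : Bundle × Bool := (d.1, !d.2)

/-- The corner between consecutive darts lies in a single face. The vertices w₀ and w₁ are excluded
because one of their corners lies in the outer face and is bounded by `top` on one side and `bot` on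
the other. -/
theorem cell_bundleNext {k : ℕ} {d : Bundle × Bool} (h : d.1.Valid k)
    (hw : ∀ c, bundleSrc d ≠ .w c) : cell k (bundleNext k d) = cell k (bundleRev d) := by
  have h1 := Nat.one_le_two_pow (n := k)
  obtain ⟨⟨_ | r, u⟩ | ⟨r, s, t⟩ | ⟨r, s, t⟩, _ | _⟩ := d <;> simp only [Bundle.Valid] at h <;>
    simp only [bundleNext, bundleRev, Bool.not_false, Bool.not_true] <;>
    (try have h2 := Nat.one_le_two_pow (n := r)) <;> (try simp only [pow_succ] at h ⊢) <;>
    (try split_ifs) <;> simp only [cell, topCell, botCell] <;> (try split_ifs) <;>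
    (try simp only [Cell.X.injEq, true_and, and_true]) <;>
    first
    | omega
    | contradiction
    | (obtain rfl : u = 0 := by omega
       exact absurd rfl (hw false))
    | (obtain rfl : u = 0 := by omega
       exact absurd rfl (hw true))

/-- A dart with a given face to its left. -/
def cellRoot : Cell → Bundle × Bool
  | .X r p q => if p = q then (D r p, true) else (A r p q, true)
  | _ => (D 0 0, false)

/-- Since `cellRoot` identifies `top` and `bot`, the exception at w₀ and w₁ disappears. -/
theorem cellRoot_bundleNext {k : ℕ} {d : Bundle × Bool} (h : d.1.Valid k) :
    cellRoot (cell k (bundleNext k d)) = cellRoot (cell k (bundleRev d)) := by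
  have h1 := Nat.one_le_two_pow (n := k)
  by_cases hw : ∃ c, bundleSrc d = .w c
  · obtain ⟨⟨_ | r, u⟩ | ⟨r, s, t⟩ | ⟨r, s, t⟩, _ | _⟩ := d <;> simp only [Bundle.Valid] at h <;>
      obtain ⟨c, hw⟩ := hw <;> simp only [bundleSrc, point, pow_succ] at hw <;>
      (try have h2 := Nat.one_le_two_pow (n := r)) <;> (try simp only [pow_succ] at h ⊢) <;>
      split_ifs at hw <;>
      simp only [bundleNext, bundleRev, Bool.not_false, Bool.not_true, pow_succ] <;>
      (try split_ifs) <;> simp only [cell, topCell, botCell] <;> (try split_ifs) <;>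
      simp only [cellRoot] <;> (try split_ifs) <;>
      (try simp only [Prod.mk.injEq, D.injEq, A.injEq, true_and, and_true, reduceCtorEq]) <;>
      omega
  · rw [cell_bundleNext h (by simpa using hw)]

/-- The number of steps along a face to `cellRoot` is at most this. -/
def cellRank (k : ℕ) : Bundle × Bool → ℕ
  | (A _ _ _, true) => 0
  | (D r u, true) => if r = k then u + 1 else 0
  | (B _ _ _, true) => 1
  | (A _ _ _, false) => 2
  | (B _ _ _, false) => 3
  | (D 0 _, false) => 0
  | (D (r + 1) u, false) => if u < 2 ^ r then 3 else 2

theorem eq_cellRoot_or_lt {k : ℕ} {d : Bundle × Bool} (h : d.1.Valid k) :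
    d = cellRoot (cell k d) ∨ cellRank k (bundleNext k (bundleRev d)) < cellRank k d := by
  have h1 := Nat.one_le_two_pow (n := k)
  obtain ⟨⟨_ | r, u⟩ | ⟨r, s, t⟩ | ⟨r, s, t⟩, _ | _⟩ := d <;> simp only [Bundle.Valid] at h <;>
    simp only [bundleNext, bundleRev, Bool.not_false, Bool.not_true] <;>
    (try have h2 := Nat.one_le_two_pow (n := r)) <;> (try simp only [pow_succ] at h ⊢) <;>
    (try split_ifs) <;> simp only [cell, topCell, botCell, cellRank] <;> (try split_ifs) <;>
    simp only [cellRoot] <;> (try split_ifs) <;>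
    (try simp only [Prod.mk.injEq, D.injEq, A.injEq, and_true, true_and, reduceCtorEq,
      false_and, and_false, false_or, true_or]) <;>
    omega

/-! ### Numbering of bundles and vertices -/

/-- Four digits with respect to the base `R`. -/
def pack (R a r s t : ℕ) : ℕ := ((a * R + r) * R + s) * R + t

theorem pack_mod {R a r s t : ℕ} (ht : t < R) : pack R a r s t % R = t := by
  rw [pack, Nat.add_comm, Nat.add_mul_mod_self_right, Nat.mod_eq_of_lt ht]

theorem mul_add_div_eq {R x t : ℕ} (ht : t < R) : (x * R + t) / R = x := by
  rw [Nat.add_comm, Nat.add_mul_div_right _ _ (by omega), Nat.div_eq_of_lt ht, Nat.zero_add]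

theorem mul_add_mod_eq {R x t : ℕ} (ht : t < R) : (x * R + t) % R = t := by
  rw [Nat.add_comm, Nat.add_mul_mod_self_right, Nat.mod_eq_of_lt ht]

theorem pack_div_mod {R a r s t : ℕ} (hs : s < R) (ht : t < R) : pack R a r s t / R % R = s := by
  rw [pack, mul_add_div_eq ht, mul_add_mod_eq hs]

theorem pack_div_div_mod {R a r s t : ℕ} (hr : r < R) (hs : s < R) (ht : t < R) :
    pack R a r s t / R / R % R = r := by
  rw [pack, mul_add_div_eq ht, mul_add_div_eq hs, mul_add_mod_eq hr]

theorem pack_div_div_div {R a r s t : ℕ} (hr : r < R) (hs : s < R) (ht : t < R) :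
    pack R a r s t / R / R / R = a := by
  rw [pack, mul_add_div_eq ht, mul_add_div_eq hs, mul_add_div_eq hr]

theorem pack_lt {R a r s t n : ℕ} (ha : a < n) (hr : r < R) (hs : s < R) (ht : t < R) :
    pack R a r s t < n * R * R * R := by
  unfold pack
  have h1 : a * R + r < n * R := by nlinarith
  have h2 : (a * R + r) * R + s < n * R * R := by nlinarith
  nlinarith

theorem pack_inj {R a r s t a' r' s' t' : ℕ} (hr : r < R) (hs : s < R) (ht : t < R) (hr' : r' < R)
    (hs' : s' < R) (ht' : t' < R) (h : pack R a r s t = pack R a' r' s' t') :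
    a = a' ∧ r = r' ∧ s = s' ∧ t = t' := by
  have h1 := pack_div_div_div (a := a) hr hs ht
  have h2 := pack_div_div_mod (a := a) hr hs ht
  have h3 := pack_div_mod (a := a) (r := r) hs ht
  have h4 := pack_mod (a := a) (r := r) (s := s) ht
  rw [h, pack_div_div_div hr' hs' ht'] at h1
  rw [h, pack_div_div_mod hr' hs' ht'] at h2
  rw [h, pack_div_mod hs' ht'] at h3
  rw [h, pack_mod ht'] at h4
  exact ⟨h1.symm, h2.symm, h3.symm, h4.symm⟩

/-- The number of a bundle. -/
def bundleCode (R : ℕ) : Bundle → ℕ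
  | D r u => pack R 0 r u 0
  | A r s t => pack R 1 r s t
  | B r s t => pack R 2 r s t

/-- The number of a vertex. -/
def pointCode (R : ℕ) : Point → ℕ
  | .w c => pack R 0 0 0 c.toNat
  | .p r s t => pack R 0 r s t

theorem pow_le_of_le {r k : ℕ} (h : r ≤ k) : 2 ^ r ≤ 2 ^ k := Nat.pow_le_pow_right two_pos h

theorem Bundle.Valid.bounds {k : ℕ} {b : Bundle} (h : b.Valid k) :
    match b with
    | D r u => r < 2 ^ (k + 1) ∧ u < 2 ^ (k + 1)
    | A r s t => r < 2 ^ (k + 1) ∧ s < 2 ^ (k + 1) ∧ t < 2 ^ (k + 1)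
    | B r s t => r < 2 ^ (k + 1) ∧ s < 2 ^ (k + 1) ∧ t < 2 ^ (k + 1) := by
  have h1 : k < 2 ^ k := Nat.lt_two_pow_self
  have h2 : 2 ^ (k + 1) = 2 ^ k * 2 := pow_succ 2 k
  rcases b with ⟨r, u⟩ | ⟨r, s, t⟩ | ⟨r, s, t⟩ <;> simp only [Bundle.Valid] at h ⊢ <;>
    have h3 := pow_le_of_le (show r ≤ k by omega) <;> omega

theorem Point.Valid.bounds {k r s t : ℕ} (h : (Point.p r s t).Valid k) :
    r < 2 ^ (k + 1) ∧ s < 2 ^ (k + 1) ∧ t < 2 ^ (k + 1) := by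
  have h1 : k < 2 ^ k := Nat.lt_two_pow_self
  have h2 : 2 ^ (k + 1) = 2 ^ k * 2 := pow_succ 2 k
  simp only [Point.Valid] at h
  have h3 := pow_le_of_le (show r ≤ k by omega)
  omega

/-- The codes in base 2^(k+1) only serve to prove finiteness. The program uses the larger base
`radix k`, which also accommodates the number of an edge in its bundle. -/
theorem bundleCode_inj {k : ℕ} {b b' : Bundle} (h : b.Valid k) (h' : b'.Valid k)
    (hb : bundleCode (2 ^ (k + 1)) b = bundleCode (2 ^ (k + 1)) b') : b = b' := by
  have h1 := h.bounds
  have h2 := h'.bounds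
  have h3 : 0 < 2 ^ (k + 1) := by positivity
  cases b <;> cases b' <;> simp only [bundleCode] at h1 h2 hb <;>
    have := pack_inj (by omega) (by omega) (by omega) (by omega) (by omega) (by omega) hb <;>
    simp_all

theorem bundleCode_lt {k : ℕ} {b : Bundle} (h : b.Valid k) :
    bundleCode (2 ^ (k + 1)) b < 3 * 2 ^ (k + 1) * 2 ^ (k + 1) * 2 ^ (k + 1) := by
  have h1 := h.bounds
  have h3 : 0 < 2 ^ (k + 1) := by positivity
  cases b <;> simp only at h1 <;>
    exact pack_lt (by omega) (by omega) (by omega) (by omega)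

theorem one_lt_radix (k : ℕ) : 1 < 2 ^ (k + 1) := Nat.one_lt_two_pow (by omega)

theorem pointCode_inj {k : ℕ} {v v' : Point} (h : v.Valid k) (h' : v'.Valid k)
    (hv : pointCode (2 ^ (k + 1)) v = pointCode (2 ^ (k + 1)) v') : v = v' := by
  have h3 := one_lt_radix k
  have h4 : ∀ c : Bool, c.toNat < 2 ^ (k + 1) := fun c => by cases c <;> simp
  rcases v with c | ⟨r, s, t⟩ <;> rcases v' with c' | ⟨r', s', t'⟩ <;> simp only [pointCode] at hv
  · have := pack_inj (by omega) (by omega) (h4 c) (by omega) (by omega) (h4 c') hv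
    cases c <;> cases c' <;> simp_all
  · have h2 := h'.bounds
    have := pack_inj (by omega) (by omega) (h4 c) (by omega) (by omega) (by omega) hv
    simp only [Point.Valid] at h'
    omega
  · have h1 := h.bounds
    have := pack_inj (by omega) (by omega) (by omega) (by omega) (by omega) (h4 c') hv
    simp only [Point.Valid] at h
    omega
  · have h1 := h.bounds
    have h2 := h'.bounds
    have := pack_inj (by omega) (by omega) (by omega) (by omega) (by omega) (by omega) hv
    simp_all

theorem pointCode_lt {k : ℕ} {v : Point} (h : v.Valid k) :
    pointCode (2 ^ (k + 1)) v < 1 * 2 ^ (k + 1) * 2 ^ (k + 1) * 2 ^ (k + 1) := by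
  have h3 := one_lt_radix k
  rcases v with c | ⟨r, s, t⟩
  · exact pack_lt (by omega) (by omega) (by omega) (by cases c <;> simp)
  · have h1 := h.bounds
    exact pack_lt (by omega) (by omega) (by omega) (by omega)

/-! ### The graph of bundles -/

/-- The bundles of the gadget. -/
abbrev BundleOf (k : ℕ) : Type := {b : Bundle // b.Valid k}

/-- The vertices of the gadget. -/
abbrev VertexOf (k : ℕ) : Type := {v : Point // v.Valid k}

instance (k : ℕ) : Finite (BundleOf k) :=
  Finite.of_injective (fun b => (⟨_, bundleCode_lt b.2⟩ : Fin _)) fun b b' h =>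
    Subtype.ext (bundleCode_inj b.2 b'.2 (Fin.mk.inj h))

instance (k : ℕ) : Finite (VertexOf k) :=
  Finite.of_injective (fun v => (⟨_, pointCode_lt v.2⟩ : Fin _)) fun v v' h =>
    Subtype.ext (pointCode_inj v.2 v'.2 (Fin.mk.inj h))

/-- Forget that a bundle is valid. -/
def raw {k : ℕ} (d : Dart (BundleOf k)) : Bundle × Bool := (d.1.1, d.2)

theorem raw_injective {k : ℕ} : Function.Injective (raw (k := k)) := by
  rintro ⟨⟨b, hb⟩, x⟩ ⟨⟨b', hb'⟩, x'⟩ h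
  simp only [raw, Prod.mk.injEq] at h
  simp [h]

theorem raw_rev {k : ℕ} (d : Dart (BundleOf k)) : raw (rev d) = bundleRev (raw d) := rfl

/-- A dart of the graph of bundles. -/
def ofRaw {k : ℕ} (d : Bundle × Bool) (h : d.1.Valid k) : Dart (BundleOf k) := (⟨d.1, h⟩, d.2)

theorem raw_ofRaw {k : ℕ} (d : Bundle × Bool) (h : d.1.Valid k) : raw (ofRaw d h) = d := rfl

/-- The rotation of the graph of bundles. -/
noncomputable def bundlePerm (k : ℕ) : Equiv.Perm (Dart (BundleOf k)) :=
  Equiv.ofBijective (fun d => ofRaw (bundleNext k (raw d)) (bundleNext_valid d.1.2)) <|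
    Finite.injective_iff_bijective.1 fun d d' h => raw_injective <| by
      have := congrArg raw h
      simp only [raw_ofRaw] at this
      rw [← bundlePrev_bundleNext (k := k) (d := raw d) d.1.2, this, bundlePrev_bundleNext d'.1.2]

theorem raw_bundlePerm {k : ℕ} (d : Dart (BundleOf k)) :
    raw (bundlePerm k d) = bundleNext k (raw d) := rfl

theorem pointRoot_valid {k : ℕ} {v : Point} (h : v.Valid k) : (pointRoot k v).1.Valid k := by
  have h1 := Nat.one_le_two_pow (n := k)
  rcases v with (_ | _) | ⟨r, s, t⟩ <;> simp only [pointRoot] <;> (try split_ifs) <;>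
    simp only [Bundle.Valid, Point.Valid] at h ⊢ <;> omega

/-- The graph of bundles. -/
noncomputable def bundleGraph (k : ℕ) : RotationSystem (VertexOf k) (BundleOf k) where
  src d := ⟨bundleSrc (raw d), bundleSrc_valid d.1.2⟩
  next := bundlePerm k
  src_eq_iff d d' := by
    constructor
    · intro h
      have h1 := fun d : Dart (BundleOf k) => sameCycle_root (bundlePerm k)
        (fun d => ofRaw (pointRoot k (bundleSrc (raw d))) (pointRoot_valid (bundleSrc_valid d.1.2)))
        (fun d => pointRank k (raw d)) (fun d => by
          rcases eq_pointRoot_or_lt (k := k) (d := raw d) d.1.2 with h | h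
          · exact Or.inl (raw_injective h)
          · refine Or.inr ⟨raw_injective ?_, h⟩
            simp only [raw_ofRaw, raw_bundlePerm]
            rw [bundleSrc_bundleNext d.1.2]) d
      have h2 := h1 d'
      simp only [Subtype.mk.injEq] at h
      simp only [← h] at h2
      exact (h1 d).trans h2.symm
    · refine fun h => SameCycle.map_eq
        (g := fun d => (⟨bundleSrc (raw d), bundleSrc_valid d.1.2⟩ : VertexOf k)) (fun d => ?_) h
      exact Subtype.ext (bundleSrc_bundleNext d.1.2)
  loopless d h := by
    have h1 := Nat.one_le_two_pow (n := k)
    simp only [raw_rev, Subtype.mk.injEq] at h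
    obtain ⟨⟨⟨r, u⟩ | ⟨r, s, t⟩ | ⟨r, s, t⟩, hb⟩, _ | _⟩ := d <;> simp only [Bundle.Valid] at hb <;>
      simp only [raw, bundleRev, bundleSrc, point, Bool.not_false, Bool.not_true] at h <;>
      split_ifs at h <;> simp at h <;> omega

/-- The bundle and the direction of `rootDart`. -/
def faceRoot {k : ℕ} (d : Dart (BundleOf k)) : Bundle × Bool := cellRoot (cell k (raw d))

theorem faceRoot_valid {k : ℕ} (d : Dart (BundleOf k)) : (faceRoot d).1.Valid k := by
  obtain ⟨⟨⟨_ | r, u⟩ | ⟨r, s, t⟩ | ⟨r, s, t⟩, hb⟩, _ | _⟩ := d <;> simp only [Bundle.Valid] at hb <;>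
    simp only [faceRoot, raw, cell, topCell, botCell] <;> (try split_ifs) <;>
    simp only [cellRoot] <;> (try split_ifs) <;> simp only [Bundle.Valid, pow_succ] at hb ⊢ <;> omega

/-- A dart of every face of the graph of bundles. -/
def rootDart {k : ℕ} (d : Dart (BundleOf k)) : Dart (BundleOf k) := ofRaw _ (faceRoot_valid d)

theorem raw_facePerm {k : ℕ} (d : Dart (BundleOf k)) :
    raw ((bundleGraph k).facePerm d) = bundleNext k (bundleRev (raw d)) := rfl

theorem bundleRev_bundleRev (d : Bundle × Bool) : bundleRev (bundleRev d) = d := by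
  simp [bundleRev]

theorem rootDart_facePerm {k : ℕ} (d : Dart (BundleOf k)) :
    rootDart ((bundleGraph k).facePerm d) = rootDart d := by
  refine raw_injective ?_
  simp only [rootDart, raw_ofRaw, faceRoot, raw_facePerm]
  rw [cellRoot_bundleNext (by exact d.1.2), bundleRev_bundleRev]

theorem sameCycle_rootDart {k : ℕ} (d : Dart (BundleOf k)) :
    (bundleGraph k).facePerm.SameCycle d (rootDart d) := by
  refine sameCycle_root _ rootDart (fun d => cellRank k (raw d)) (fun d => ?_) d
  rcases eq_cellRoot_or_lt (k := k) (d := raw d) d.1.2 with h | h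
  · exact Or.inl (raw_injective h)
  · exact Or.inr ⟨rootDart_facePerm d, h⟩

end VCG

namespace VCG

open VCG.Bundle

/-! ### Euler's formula and connectedness for the graph of bundles -/

/-- The bundles that correspond to the face below them; the others correspond to vertices. -/
def Bundle.OfFace (k : ℕ) : Bundle → Prop
  | D r _ => r < k
  | A _ _ _ => True
  | B _ _ _ => False

/-- The vertex that corresponds to a bundle. -/
def bundleVertex : Bundle → Point
  | D r u => if u = 0 then .w true else .p r u u
  | A r s t => .p r s t
  | B r s t => .p r s t

/-- Every inner face is represented by the bundle D or A directly above it, traversed backwards. The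
outer face is the additional one. -/
theorem card_faceRoots (k : ℕ) : Nat.card {d : Dart (BundleOf k) // rootDart d = d} =
    Nat.card {b : BundleOf k // b.1.OfFace k} + 1 := by
  have hD : (D 0 0).Valid k := ⟨Nat.zero_le _, by simp⟩
  rw [← Finite.card_option]
  symm
  refine Nat.card_congr (Equiv.ofBijective (fun o => match o with
    | none => ⟨(⟨D 0 0, hD⟩, false), rfl⟩
    | some b => ⟨(b.1, true), ?_⟩) ⟨?_, ?_⟩)
  · obtain ⟨⟨⟨r, u⟩ | ⟨r, s, t⟩ | ⟨r, s, t⟩, hb⟩, hf⟩ := b <;> simp only [Bundle.OfFace] at hf <;>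
      refine raw_injective ?_
    · change cellRoot (botCell k (D r u)) = (D r u, true)
      simp [hf, cellRoot, botCell]
    · have hst : s ≠ t := hb.2.1.ne
      change cellRoot (botCell k (A r s t)) = (A r s t, true)
      simp [hst, cellRoot, botCell]
  · rintro (_ | b) (_ | b') h
    · rfl
    · exact absurd (congrArg (fun d => d.1.2) h) Bool.false_ne_true
    · exact absurd (congrArg (fun d => d.1.2) h).symm Bool.false_ne_true
    · rw [Subtype.ext (congrArg (fun d => d.1.1) h)]
  · rintro ⟨d, hd⟩
    have h1 := congrArg raw hd
    simp only [rootDart, raw_ofRaw, faceRoot] at h1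
    obtain ⟨⟨b, hb⟩, x⟩ := d
    generalize hc : cell k (raw (⟨b, hb⟩, x)) = c at h1
    rcases c with _ | _ | ⟨r, p, q⟩
    · simp only [cellRoot, raw, Prod.mk.injEq] at h1
      obtain ⟨rfl, rfl⟩ := h1
      exact ⟨none, rfl⟩
    · simp only [cellRoot, raw, Prod.mk.injEq] at h1
      obtain ⟨rfl, rfl⟩ := h1
      exact ⟨none, rfl⟩
    · simp only [cellRoot, raw] at h1
      split_ifs at h1 <;> simp only [Prod.mk.injEq] at h1 <;> obtain ⟨rfl, rfl⟩ := h1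
      · refine ⟨some ⟨⟨_, hb⟩, ?_⟩, rfl⟩
        by_contra h2
        simp [raw, cell, botCell, show ¬ r < k from h2] at hc
      · exact ⟨some ⟨⟨_, hb⟩, trivial⟩, rfl⟩

theorem bundleVertex_valid {k : ℕ} {b : Bundle} (h : b.Valid k) (hf : ¬ b.OfFace k) :
    (bundleVertex b).Valid k := by
  rcases b with ⟨r, u⟩ | ⟨r, s, t⟩ | ⟨r, s, t⟩ <;>
    simp only [Bundle.Valid, Bundle.OfFace, not_true] at h hf <;> simp only [bundleVertex]
  · split_ifs <;> simp only [Point.Valid, and_true]; omega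
  · simp only [Point.Valid]; omega

/-- The vertices other than w₀ use up the bundles left over by the faces: B for the points of the
triangles, and D k u for row k. Here D k 0, whose left end is w₀, is assigned to w₁. -/
theorem card_vertexOf (k : ℕ) : Nat.card (VertexOf k) =
    Nat.card {b : BundleOf k // ¬ b.1.OfFace k} + 1 := by
  rw [← Finite.card_option]
  symm
  refine Nat.card_congr (Equiv.ofBijective (fun o => match o with
    | none => ⟨.w false, trivial⟩
    | some b => ⟨bundleVertex b.1.1, bundleVertex_valid b.1.2 b.2⟩) ⟨?_, ?_⟩)
  · have h1 : ∀ b : {b : BundleOf k // ¬ b.1.OfFace k}, bundleVertex b.1.1 ≠ .w false := by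
      rintro ⟨⟨⟨r, u⟩ | ⟨r, s, t⟩ | ⟨r, s, t⟩, hb⟩, hf⟩ <;> simp only [bundleVertex] <;>
        (try split_ifs) <;> simp
    rintro (_ | b) (_ | b') h
    · rfl
    · exact absurd (congrArg Subtype.val h).symm (h1 b')
    · exact absurd (congrArg Subtype.val h) (h1 b)
    · replace h := congrArg Subtype.val h
      congr 1
      apply Subtype.ext
      apply Subtype.ext
      obtain ⟨⟨⟨r, u⟩ | ⟨r, s, t⟩ | ⟨r, s, t⟩, hb⟩, hf⟩ := b <;>
        obtain ⟨⟨⟨r', u'⟩ | ⟨r', s', t'⟩ | ⟨r', s', t'⟩, hb'⟩, hf'⟩ := b' <;>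
        simp only [Bundle.OfFace, Bundle.Valid, not_true] at hf hf' hb hb' <;>
        simp only [bundleVertex] at h <;> (try split_ifs at h) <;>
        (try simp only [Point.p.injEq] at h) <;>
        (try simp only [D.injEq, B.injEq, reduceCtorEq]) <;> (try omega)
  · rintro ⟨(_ | _) | ⟨r, s, t⟩, hv⟩
    · exact ⟨none, rfl⟩
    · exact ⟨some ⟨⟨D k 0, le_rfl, by positivity⟩, lt_irrefl _⟩, Subtype.ext (by simp [bundleVertex])⟩
    · simp only [Point.Valid] at hv
      rcases hv with ⟨h1, h2, h3, h4 | ⟨rfl, rfl⟩⟩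
      · exact ⟨some ⟨⟨B r s t, h4, h1, h2, h3⟩, not_false⟩, rfl⟩
      · refine ⟨some ⟨⟨D r s, le_rfl, h3⟩, lt_irrefl _⟩, Subtype.ext ?_⟩
        simp only [bundleVertex]
        rw [if_neg (by omega)]

/-- Each bundle corresponds to either a face or a vertex; the outer face and w₀ remain and account
for the 2. -/
theorem bundleGraph_euler (k : ℕ) : Nat.card (VertexOf k) +
    Nat.card {d : Dart (BundleOf k) // rootDart d = d} = Nat.card (BundleOf k) + 2 := by
  classical
  have := Fintype.ofFinite (BundleOf k)
  rw [card_faceRoots, card_vertexOf]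
  have h := Fintype.card_subtype_compl (fun b : BundleOf k => b.1.OfFace k)
  have h2 := Fintype.card_subtype_le (fun b : BundleOf k => b.1.OfFace k)
  simp only [Nat.card_eq_fintype_card]
  omega

/-- The vertex `v` is joined to `w₀`. -/
def JoinedToW (k : ℕ) (v : Point) : Prop :=
  ∃ h : v.Valid k, (bundleGraph k).Joined ⟨v, h⟩ ⟨.w false, trivial⟩

theorem JoinedToW.step {k : ℕ} (d : Bundle × Bool) (h : d.1.Valid k)
    (hj : JoinedToW k (bundleSrc (bundleRev d))) : JoinedToW k (bundleSrc d) := by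
  obtain ⟨_, hj⟩ := hj
  exact ⟨bundleSrc_valid h, (RotationSystem.Joined.dart (Γ := bundleGraph k) (ofRaw d h)).trans hj⟩

theorem joinedToW_diag {k r u : ℕ} (hr : r ≤ k) (hu : u ≤ 2 ^ r) : JoinedToW k (point r u u) := by
  induction u with
  | zero => exact ⟨trivial, RotationSystem.Joined.refl _⟩
  | succ u ih => exact JoinedToW.step (D r u, true) ⟨hr, by omega⟩ (ih (by omega))

theorem joinedToW_point {k r s t : ℕ} (hr : r < k) (hs : s ≤ t) (ht0 : 1 ≤ t) (ht : t < 2 ^ r) :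
    JoinedToW k (point r s t) := by
  induction s with
  | zero =>
    have h1 : point r 0 t = point (r + 1) t t := by
      simp only [point]
      rw [if_neg (by omega), if_pos trivial, if_pos trivial, if_neg (by omega),
        if_neg (by rw [pow_succ]; omega)]
    rw [h1]
    exact joinedToW_diag hr (by rw [pow_succ]; omega)
  | succ s ih => exact JoinedToW.step (A r s t, true) ⟨hr, by omega, by omega⟩ (ih (by omega))

theorem bundleGraph_joined {k : ℕ} (u v : VertexOf k) : (bundleGraph k).Joined u v := by
  suffices h : ∀ v : VertexOf k, JoinedToW k v.1 by
    obtain ⟨_, h1⟩ := h u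
    obtain ⟨_, h2⟩ := h v
    exact h1.trans h2.symm
  rintro ⟨(_ | _) | ⟨r, s, t⟩, hv⟩
  · exact ⟨trivial, RotationSystem.Joined.refl _⟩
  · have := joinedToW_diag (k := k) (r := 0) (u := 1) (Nat.zero_le _) (by simp)
    simpa [point] using this
  · have hv' := hv
    simp only [Point.Valid] at hv
    have : Point.p r s t = point r s t := by
      simp only [point]
      split_ifs <;> first | rfl | omega
    simp only [this]
    rcases hv with ⟨h1, h2, h3, h4 | ⟨rfl, rfl⟩⟩
    · exact joinedToW_point h4 h2 (by omega) h3
    · exact joinedToW_diag le_rfl h3.le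

/-! ### The gadget -/

/-- The number of parallel edges in a bundle. Here `ζ u` is `1` if `u` encodes an element of `Z`, and
`0` otherwise. -/
def mult (k : ℕ) (ζ : ℕ → ℕ) : Bundle → ℕ
  | D r u => (if r = 0 then 1 else 2 ^ (k + 1)) + if r = k then ζ u else 0
  | A r _ _ => 2 ^ (k - 1 - r)
  | B r _ _ => 2 ^ (k - 1 - r)

theorem mult_pos (k : ℕ) (ζ : ℕ → ℕ) (b : Bundle) : 0 < mult k ζ b := by
  have := Nat.one_le_two_pow (n := k + 1)
  cases b <;> simp only [mult]
  · split_ifs <;> omega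
  · positivity
  · positivity

/-- A dart given by a bundle, the number of an edge in the bundle and a direction. -/
abbrev UnitDart : Type := (Bundle × ℕ) × Bool

/-- The first dart of a bundle in the clockwise order around one of its ends. -/
def unitFirst (k : ℕ) (ζ : ℕ → ℕ) : Bundle × Bool → UnitDart
  | (b, false) => ((b, 0), false)
  | (b, true) => ((b, mult k ζ b - 1), true)

/-- The rotation of the gadget. -/
def unitNext (k : ℕ) (ζ : ℕ → ℕ) : UnitDart → UnitDart
  | ((b, c), false) =>
    if c + 1 < mult k ζ b then ((b, c + 1), false) else unitFirst k ζ (bundleNext k (b, false))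
  | ((b, c), true) => if 0 < c then ((b, c - 1), true) else unitFirst k ζ (bundleNext k (b, true))

/-- A plane multigraph whose vertices and edges are named by points and by bundles and numbers
within bundles, as in the gadget. -/
structure Coord (k : ℕ) (ζ : ℕ → ℕ) {V E : Type} [Finite V] [Finite E]
    (G : PlaneMultigraph V E) where
  /-- The bundle of an edge, and its number in the bundle. -/
  pos : E → Bundle × ℕ
  /-- The point of a vertex. -/
  vtx : V → Point
  pos_injective : Function.Injective pos
  vtx_injective : Function.Injective vtx
  pos_valid : ∀ e, (pos e).1.Valid k
  pos_lt : ∀ e, (pos e).2 < mult k ζ (pos e).1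
  exists_pos : ∀ b c, b.Valid k → c < mult k ζ b → ∃ e, pos e = (b, c)
  src : ∀ d, vtx (G.src d) = bundleSrc ((pos d.1).1, d.2)
  next : ∀ d, (pos (G.next d).1, (G.next d).2) = unitNext k ζ (pos d.1, d.2)
  onOuter : ∀ d, G.OnOuter d ↔ (pos d.1, d.2) = ((D 0 0, 0), false) ∨
    ∃ u < 2 ^ k, (pos d.1, d.2) = unitFirst k ζ (D k u, true)

section Gadget

open RotationSystem

variable (k : ℕ) (ζ : ℕ → ℕ)

/-- The edges of the gadget. -/
abbrev GadgetEdge : Type := Copies fun b : BundleOf k => mult k ζ b.1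

/-- The gadget as a rotation system. -/
noncomputable def gadgetRotation : RotationSystem (VertexOf k) (GadgetEdge k ζ) :=
  (bundleGraph k).blowUp fun b => mult_pos k ζ b.1

/-- The bundle of an edge and its number in the bundle. -/
def unitEdge {k : ℕ} {ζ : ℕ → ℕ} (e : GadgetEdge k ζ) : Bundle × ℕ := (e.1.1, e.2.1)

/-- The bundle, the number in the bundle and the direction of a dart. -/
def unit {k : ℕ} {ζ : ℕ → ℕ} (d : Dart (GadgetEdge k ζ)) : UnitDart := (unitEdge d.1, d.2)

theorem unit_firstCopy (x : Dart (BundleOf k)) :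
    unit (firstCopy (fun b => mult_pos k ζ b.1) x) = unitFirst k ζ (raw x) := by
  obtain ⟨b, _ | _⟩ := x <;> rfl

theorem unit_injective : Function.Injective (unit (k := k) (ζ := ζ)) := by
  rintro ⟨⟨⟨b, hb⟩, c, hc⟩, x⟩ ⟨⟨⟨b', hb'⟩, c', hc'⟩, x'⟩ h
  simp only [unit, unitEdge, Prod.mk.injEq] at h
  obtain ⟨⟨rfl, rfl⟩, rfl⟩ := h
  rfl

theorem unit_next (d : Dart (GadgetEdge k ζ)) :
    unit ((gadgetRotation k ζ).next d) = unitNext k ζ (unit d) := by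
  obtain ⟨⟨b, c⟩, _ | _⟩ := d
  · change unit (copyNext _ _ _) = unitNext k ζ ((b.1, c.1), false)
    by_cases h : c.1 + 1 < mult k ζ b.1
    · rw [copyNext, dif_pos h, unitNext, if_pos h]
      rfl
    · rw [copyNext, dif_neg h, unitNext, if_neg h]
      exact unit_firstCopy k ζ _
  · change unit (copyNext _ _ _) = unitNext k ζ ((b.1, c.1), true)
    by_cases h : 0 < c.1
    · rw [copyNext, if_pos h, unitNext, if_pos h]
      rfl
    · rw [copyNext, if_neg h, unitNext, if_neg h]
      exact unit_firstCopy k ζ _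

/-- The uppermost dart from `w₀` to `w₁`. -/
def gadgetOuter : Dart (GadgetEdge k ζ) :=
  (⟨⟨D 0 0, Nat.zero_le _, by simp⟩, ⟨0, mult_pos k ζ _⟩⟩, false)

theorem rootDart_eq_iff {k : ℕ} (d : Dart (BundleOf k)) :
    raw (rootDart d) = (D 0 0, false) ↔
      raw d = (D 0 0, false) ∨ ∃ u < 2 ^ k, raw d = (D k u, true) := by
  simp only [rootDart, raw_ofRaw, faceRoot]
  obtain ⟨⟨⟨_ | r, u⟩ | ⟨r, s, t⟩ | ⟨r, s, t⟩, hb⟩, _ | _⟩ := d <;> simp only [Bundle.Valid] at hb <;>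
    simp only [raw, cell, topCell, botCell] <;> (try split_ifs) <;>
    simp only [cellRoot] <;> (try split_ifs) <;> simp <;> (try omega)
  · simp only [pow_zero] at hb
    have h0 : k = 0 := by omega
    subst h0
    exact ⟨by omega, rfl⟩
  · have h0 : k = r + 1 := by omega
    subst h0
    exact ⟨hb.2, rfl⟩

/-- The face root is a complete invariant of faces, and `gadgetOuter` is its own root. So it remains
to compute which darts have this root. -/
theorem sameCycle_gadgetOuter (d : Dart (GadgetEdge k ζ)) :
    (gadgetRotation k ζ).facePerm.SameCycle (gadgetOuter k ζ) d ↔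
      unit d = ((D 0 0, 0), false) ∨ ∃ u < 2 ^ k, unit d = unitFirst k ζ (D k u, true) := by
  set hm := fun b : BundleOf k => mult_pos k ζ b.1
  have hinv := copyFaceRoot_facePerm (bundleGraph k) hm (root := rootDart) rootDart_facePerm
  have hroot := sameCycle_copyFaceRoot (bundleGraph k) hm (root := rootDart) sameCycle_rootDart
  have h1 : (gadgetRotation k ζ).facePerm.SameCycle (gadgetOuter k ζ) d ↔
      copyFaceRoot hm rootDart d = copyFaceRoot hm rootDart (gadgetOuter k ζ) := by
    constructor
    · intro h
      exact (SameCycle.map_eq hinv h).symm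
    · intro h
      have h2 := hroot d
      rw [h] at h2
      exact (hroot _).trans h2.symm
  have h2 : copyFaceRoot hm rootDart (gadgetOuter k ζ) = gadgetOuter k ζ := rfl
  rw [h1, h2]
  have h3 : unit (gadgetOuter k ζ) = ((D 0 0, 0), false) := rfl
  have hfc : ∀ x : Dart (BundleOf k), firstCopy hm (rootDart x) = gadgetOuter k ζ ↔
      raw (rootDart x) = (D 0 0, false) := by
    intro x
    rw [← (unit_injective k ζ).eq_iff, unit_firstCopy, h3]
    generalize raw (rootDart x) = y
    obtain ⟨b, _ | _⟩ := y <;> simp [unitFirst]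
  obtain ⟨⟨b, c⟩, _ | _⟩ := d
  · by_cases h : 0 < c.1
    · simp only [copyFaceRoot, h, if_true]
      simp [gadgetOuter, unit, unitEdge, unitFirst, show c.1 ≠ 0 by omega]
    · rw [eq_firstCopy_false hm h, copyFaceRoot_firstCopy, hfc, rootDart_eq_iff, unit_firstCopy]
      simp [raw, unitFirst]
  · by_cases h : c.1 + 1 < mult k ζ b.1
    · simp only [copyFaceRoot, h, if_true]
      have h4 : ∀ u, ¬ (b.1 = D k u ∧ c.1 = mult k ζ (D k u) - 1) := by
        rintro u ⟨h4, h5⟩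
        rw [h4] at h
        omega
      simpa [gadgetOuter, unit, unitEdge, unitFirst] using fun x _ h4' => h4 x ∘ And.intro h4'
    · rw [eq_firstCopy_true hm h, copyFaceRoot_firstCopy, hfc, rootDart_eq_iff, unit_firstCopy]
      simp only [raw, unitFirst]
      constructor
      · rintro (h5 | ⟨u, hu, h5⟩)
        · simp at h5
        · simp only [Prod.mk.injEq, and_true] at h5
          exact Or.inr ⟨u, hu, by rw [h5]⟩
      · rintro (h5 | ⟨u, hu, h5⟩)
        · simp at h5
        · simp only [Prod.mk.injEq, and_true] at h5
          exact Or.inr ⟨u, hu, by rw [h5.1]⟩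

variable {k ζ} {n m : ℕ} (eV : VertexOf k ≃ Fin n) (eE : GadgetEdge k ζ ≃ Fin m)

/-- The gadget with numbers as names of the vertices and edges. -/
noncomputable def gadget : PlaneMultigraph (Fin n) (Fin m) where
  toRotationSystem := (gadgetRotation k ζ).renamed eV eE
  connected u v := by
    have := renamed_joined eV eE (blowUp_joined (bundleGraph k) (fun b => mult_pos k ζ b.1)
      (bundleGraph_joined (eV.symm u) (eV.symm v)))
    rw [Equiv.apply_symm_apply, Equiv.apply_symm_apply] at this
    exact this
  euler := by
    have := blowUp_euler (bundleGraph k) (fun b => mult_pos k ζ b.1) rootDart_facePerm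
      sameCycle_rootDart (bundleGraph_euler k)
    rw [renamed_card_face, ← Nat.card_congr eV, ← Nat.card_congr eE]
    exact this
  outer := dartEquiv eE (gadgetOuter k ζ)

theorem unitEdge_dartEquiv (d : Dart (GadgetEdge k ζ)) :
    unitEdge (eE.symm (dartEquiv eE d).1) = unitEdge d.1 :=
  congrArg unitEdge (eE.symm_apply_apply d.1)

/-- The coordinates of the gadget. -/
noncomputable def gadgetCoord : Coord k ζ (gadget eV eE) where
  pos e := unitEdge (eE.symm e)
  vtx v := (eV.symm v).1
  pos_injective e e' h := by
    have := unit_injective k ζ (a₁ := (eE.symm e, false)) (a₂ := (eE.symm e', false))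
      (congrArg (fun x => (x, false)) h)
    simpa using this
  vtx_injective v v' h := by simpa using Subtype.ext h
  pos_valid e := (eE.symm e).1.2
  pos_lt e := (eE.symm e).2.2
  exists_pos b c hb hc := ⟨eE ⟨⟨b, hb⟩, ⟨c, hc⟩⟩, by rw [Equiv.symm_apply_apply]; rfl⟩
  src d := by
    obtain ⟨d, rfl⟩ := (dartEquiv eE).surjective d
    change (eV.symm (((gadgetRotation k ζ).renamed eV eE).src (dartEquiv eE d))).1 = _
    rw [renamed_src, Equiv.symm_apply_apply]
    rw [unitEdge_dartEquiv]
    rfl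
  next d := by
    obtain ⟨d, rfl⟩ := (dartEquiv eE).surjective d
    have h := (gadgetRotation k ζ).renamed_next eV eE d
    change (gadget eV eE).next (dartEquiv eE d) = _ at h
    rw [h]
    rw [unitEdge_dartEquiv, unitEdge_dartEquiv]
    exact unit_next k ζ d
  onOuter d := by
    obtain ⟨d, rfl⟩ := (dartEquiv eE).surjective d
    have h : (gadget eV eE).OnOuter (dartEquiv eE d) ↔
        (gadgetRotation k ζ).facePerm.SameCycle (gadgetOuter k ζ) d := by
      change ((gadgetRotation k ζ).renamed eV eE).facePerm.SameCycle _ _ ↔ _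
      rw [renamed_facePerm]
      exact sameCycle_permCongr _ _ _ _
    rw [h, sameCycle_gadgetOuter, unitEdge_dartEquiv]
    rfl

end Gadget

end VCG

/-! ### Level lines of a height function in a plane multigraph -/

namespace VCG

namespace PlaneMultigraph

/-! ### Lists of darts -/

theorem infix_revDarts {E : Type} {a b : Dart E} {l : List (Dart E)} :
    [a, b] <:+: revDarts l ↔ [rev b, rev a] <:+: l := by
  have h1 : ∀ l : List (Dart E), l = (revDarts (revDarts l)) := by
    intro l
    simp only [revDarts, List.map_reverse, List.reverse_reverse, List.map_map]
    rw [show (rev ∘ rev : Dart E → Dart E) = id from funext rev_rev, List.map_id]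
  have h2 : ∀ x y : Dart E, ∀ l, [x, y] <:+: l → [rev y, rev x] <:+: revDarts l := by
    rintro x y l ⟨s, t, rfl⟩
    exact ⟨revDarts t, revDarts s, by simp [revDarts]⟩
  constructor
  · intro h
    have := h2 _ _ _ h
    rwa [← h1] at this
  · intro h
    have := h2 _ _ _ h
    rwa [rev_rev, rev_rev] at this

theorem mem_revDarts {E : Type} {d : Dart E} {l : List (Dart E)} : d ∈ revDarts l ↔ rev d ∈ l := by
  simp only [revDarts, List.mem_reverse, List.mem_map]
  constructor
  · rintro ⟨a, ha, rfl⟩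
    rwa [rev_rev]
  · intro hd
    exact ⟨_, hd, rev_rev d⟩

/-- The last case is the junction of two walks, the only place where condition (b) goes beyond
condition (a). -/
theorem infix_pair_append {α : Type} {a b : α} {l l' : List α} (hab : [a, b] <:+: l ++ l') :
    [a, b] <:+: l ∨ [a, b] <:+: l' ∨ (l.getLast? = some a ∧ l'.head? = some b) := by
  induction l with
  | nil => exact Or.inr (Or.inl hab)
  | cons x l ih =>
    rw [List.cons_append, List.infix_cons_iff] at hab
    rcases hab with hab | hab
    · rw [List.cons_prefix_cons] at hab
      obtain ⟨rfl, hab⟩ := hab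
      cases l with
      | nil =>
        right; right
        cases l' with
        | nil => simp at hab
        | cons y l' => simp at hab; simp [hab]
      | cons y l =>
        left
        simp only [List.cons_append, List.cons_prefix_cons, List.nil_prefix, and_true] at hab
        subst hab
        exact ⟨[], l, rfl⟩
    · rcases ih hab with h1 | h1 | ⟨h1, h2⟩
      · exact Or.inl (h1.trans (List.suffix_cons x l).isInfix)
      · exact Or.inr (Or.inl h1)
      · refine Or.inr (Or.inr ⟨?_, h2⟩)
        rw [List.getLast?_cons, h1]
        rfl

/-- The dart `d` is used by the walk with label `c`: the face to its left has height at most `c`, and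
the one to its right has height `c + 1`. -/
def Used {E : Type} (h : Dart E → ℕ) (c : ℕ) (d : Dart E) : Prop := h d ≤ c ∧ h (rev d) = c + 1

/-- The label is determined by the edge: it is one less than the larger of the heights on its two
sides. -/
theorem Used.ne {E : Type} {h : Dart E → ℕ} {c c' : ℕ} {d d' : Dart E} (hd : Used h c d) (hd' : Used h c' d') (hc : c ≠ c') :
    d.1 ≠ d'.1 := by
  intro he
  obtain ⟨e, x⟩ := d
  obtain ⟨e', x'⟩ := d'
  obtain rfl : e = e' := he
  simp only [Used, rev] at hd hd'
  cases x <;> cases x' <;> simp only [Bool.not_false, Bool.not_true] at hd hd' <;> omega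

variable {V E : Type} [Finite V] [Finite E] (G : PlaneMultigraph V E)

/-! ### Cyclic order and crossings -/

variable {G} in
theorem CyclicOrder.rotate {a b c d : Dart E} (h : G.CyclicOrder a b c d) :
    G.CyclicOrder b c d a := by
  obtain ⟨i, j, l, hi, hij, hjl, rfl, rfl, rfl, hne⟩ := h
  have hp := Function.minimalPeriod_pos_of_mem_periodicPts
    (Function.Injective.mem_periodicPts G.next.injective a)
  set p := Function.minimalPeriod G.next a
  have hpa : (G.next ^ p) a = a := by
    rw [← Equiv.Perm.iterate_eq_pow]; exact Function.iterate_minimalPeriod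
  have hlp : l < p := by
    by_contra h
    exact hne p hp (by omega) hpa
  refine ⟨j - i, l - i, p - i, by omega, by omega, by omega, ?_, ?_, ?_, ?_⟩
  · rw [← Equiv.Perm.mul_apply, ← pow_add]; congr 2; omega
  · rw [← Equiv.Perm.mul_apply, ← pow_add]; congr 2; omega
  · rw [← Equiv.Perm.mul_apply, ← pow_add, show p - i + i = p by omega, hpa]
  · intro m hm0 hm hm'
    rw [← Equiv.Perm.mul_apply, ← pow_add, add_comm, pow_add, Equiv.Perm.mul_apply] at hm'
    have h1 := (G.next ^ i).injective hm'
    rw [← Equiv.Perm.iterate_eq_pow] at h1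
    have := Function.IsPeriodicPt.minimalPeriod_le hm0 h1
    omega

/-- The darts `x, x'` do not separate `y, y'` in the cyclic order. -/
def Unseparated (x x' y y' : Dart E) : Prop :=
  ¬ G.CyclicOrder x y x' y' ∧ ¬ G.CyclicOrder x y' x' y

variable {G}

theorem Unseparated.swap {x x' y y' : Dart E} (h : G.Unseparated x x' y y') :
    G.Unseparated x' x y y' :=
  ⟨fun h' => h.2 h'.rotate.rotate, fun h' => h.1 h'.rotate.rotate⟩

theorem Unseparated.swap_right {x x' y y' : Dart E} (h : G.Unseparated x x' y y') :
    G.Unseparated x x' y' y := ⟨h.2, h.1⟩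

theorem Unseparated.not_cross {x x' y y' : Dart E} (h : G.Unseparated x x' y y') :
    ¬ G.Cross x x' y y' := by
  rintro (h' | h')
  · exact h.1 h'
  · exact h.2 h'.rotate.rotate.rotate

theorem pow_apply_unique {a : Dart E} {i j l : ℕ} (hi : i ≤ l) (hj : j ≤ l)
    (hne : ∀ m, 0 < m → m ≤ l → (G.next ^ m) a ≠ a) (h : (G.next ^ i) a = (G.next ^ j) a) :
    i = j := by
  wlog hij : i ≤ j generalizing i j
  · exact (this hj hi h.symm (by omega)).symm
  by_contra hne'
  refine hne (j - i) (by omega) (by omega) ((G.next ^ i).injective ?_)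
  rw [← Equiv.Perm.mul_apply, ← pow_add, h]
  congr 2
  omega

/-! ### Heights -/

variable (G) (h : Dart E → ℕ)

/-- The heights above `c` form the arc from `o` clockwise to `r`. -/
def Arc (c : ℕ) (o r : Dart E) : Prop :=
  h o ≤ c ∧ h (G.next r) ≤ c ∧
    ∃ j, 0 < j ∧ (G.next ^ j) o = r ∧ ∀ i, 0 < i → i ≤ j → c < h ((G.next ^ i) o)

variable {G h}

theorem Arc.lt_of_cyclicOrder {c : ℕ} {o r y y' : Dart E} (ha : G.Arc h c o r)
    (hc : G.CyclicOrder o y r y') : c < h y ∧ c < h (G.next y) := by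
  obtain ⟨ho, -, j, hj0, hj, hlt⟩ := ha
  obtain ⟨i, j', l, hi, hij, hjl, rfl, hj', -, hne⟩ := hc
  -- The dart `o` has height at most `c`, so it is not met again before `r`; hence both descriptions
  -- reach `r` after the same number of steps.
  have hjj : j = j' := by
    by_cases hjl' : j ≤ l
    · exact pow_apply_unique hjl' hjl.le hne (hj.trans hj'.symm)
    · have hne' : ∀ m, 0 < m → m ≤ j → (G.next ^ m) o ≠ o := by
        intro m hm0 hm hm'
        have := hlt m hm0 hm
        rw [hm'] at this
        omega
      exact pow_apply_unique le_rfl (by omega) hne' (hj.trans hj'.symm)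
  subst hjj
  refine ⟨hlt i hi hij.le, ?_⟩
  rw [← Equiv.Perm.mul_apply, ← pow_succ']
  exact hlt (i + 1) (by omega) hij

/-- If the ends interleaved, each arc would contain an end of the other one. Heights are low just
outside an arc and high inside, so both c < c' and c' < c would follow. -/
theorem Arc.unseparated {c c' : ℕ} {o r o' r' : Dart E} (ha : G.Arc h c o r)
    (ha' : G.Arc h c' o' r') : G.Unseparated o r o' r' := by
  have h1 := ha.1
  have h2 := ha.2.1
  have h1' := ha'.1
  have h2' := ha'.2.1
  constructor
  · intro hc
    have h3 := ha.lt_of_cyclicOrder hc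
    have h4 := ha'.lt_of_cyclicOrder hc.rotate
    omega
  · intro hc
    have h3 := ha.lt_of_cyclicOrder hc
    have h4 := ha'.lt_of_cyclicOrder hc.rotate.rotate.rotate
    omega

/-- The arc ends where the height first falls back to at most `c`. This makes the step along a level
line injective. -/
theorem Arc.right_unique {c : ℕ} {o r r' : Dart E} (ha : G.Arc h c o r) (ha' : G.Arc h c o r') :
    r = r' := by
  obtain ⟨-, hr, j, hj0, rfl, hlt⟩ := ha
  obtain ⟨-, hr', j', hj0', rfl, hlt'⟩ := ha'
  rw [← Equiv.Perm.mul_apply, ← pow_succ'] at hr hr'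
  rcases lt_trichotomy j j' with h1 | h1 | h1
  · have := hlt' (j + 1) (by omega) h1
    omega
  · rw [h1]
  · have := hlt (j' + 1) (by omega) h1
    omega

/-- The dart `o` is the first one counterclockwise from `r` with height at most `c`. The search
succeeds, since it would reach `G.next r` after almost a full turn. -/
theorem exists_arc {c : ℕ} {r : Dart E} (h1 : c < h r) (h2 : h (G.next r) ≤ c) :
    ∃ o, G.Arc h c o r ∧ c < h (G.next o) := by
  have hex : ∃ j, h ((G.next⁻¹ ^ j) r) ≤ c := by
    have hp := Function.minimalPeriod_pos_of_mem_periodicPts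
      (Function.Injective.mem_periodicPts G.next.injective r)
    set p := Function.minimalPeriod G.next r
    have hpa : (G.next ^ p) r = r := by
      rw [← Equiv.Perm.iterate_eq_pow]; exact Function.iterate_minimalPeriod
    refine ⟨p - 1, ?_⟩
    have : (G.next⁻¹ ^ (p - 1)) r = G.next r := by
      rw [inv_pow, Equiv.Perm.inv_eq_iff_eq, ← Equiv.Perm.mul_apply, ← pow_succ,
        show p - 1 + 1 = p by omega, hpa]
    rw [this]
    exact h2
  classical
  obtain ⟨j, hj1, hmin⟩ : ∃ j, h ((G.next⁻¹ ^ j) r) ≤ c ∧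
      ∀ i < j, ¬ h ((G.next⁻¹ ^ i) r) ≤ c :=
    ⟨Nat.find hex, Nat.find_spec hex, fun i hi => Nat.find_min hex hi⟩
  have hj0 : 0 < j := by
    rw [Nat.pos_iff_ne_zero]
    intro h0
    rw [h0] at hj1
    simp only [pow_zero, Equiv.Perm.coe_one, id_eq] at hj1
    omega
  have key : ∀ i ≤ j, (G.next ^ i) ((G.next⁻¹ ^ j) r) = (G.next⁻¹ ^ (j - i)) r := by
    intro i hi
    obtain ⟨m, rfl⟩ : ∃ m, j = i + m := ⟨j - i, by omega⟩
    rw [Nat.add_sub_cancel_left, pow_add, Equiv.Perm.mul_apply, ← Equiv.Perm.mul_apply, inv_pow,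
      mul_inv_cancel, Equiv.Perm.one_apply]
  have hlt : ∀ i, 0 < i → i ≤ j → c < h ((G.next ^ i) ((G.next⁻¹ ^ j) r)) := by
    intro i hi0 hi
    rw [key i hi]
    exact not_le.1 (hmin _ (by omega))
  refine ⟨(G.next⁻¹ ^ j) r, ⟨hj1, h2, j, hj0, ?_, hlt⟩, by simpa using hlt 1 one_pos hj0⟩
  rw [key j le_rfl]
  simp

/-! ### Walks along the level lines of the heights -/

/-- Consecutive darts of the list are matched by the heights around `c`. -/
def Follows (G : PlaneMultigraph V E) (h : Dart E → ℕ) (c : ℕ) (l : List (Dart E)) : Prop :=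
  ∀ a b, [a, b] <:+: l → G.Arc h c b (rev a) ∨ G.Arc h c (rev a) b

theorem Follows.nonCrossing {c c' : ℕ} {l l' : List (Dart E)} (hl : G.Follows h c l)
    (hl' : G.Follows h c' l') : G.NonCrossing l l' := by
  intro a b a' b' hab hab'
  rcases hl a b hab with h1 | h1 <;> rcases hl' a' b' hab' with h2 | h2
  · exact (h1.unseparated h2).swap.swap_right.not_cross
  · exact (h1.unseparated h2).swap.not_cross
  · exact (h1.unseparated h2).swap_right.not_cross
  · exact (h1.unseparated h2).not_cross

theorem Follows.reverse {c : ℕ} {l : List (Dart E)} (hl : G.Follows h c l) :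
    G.Follows h c (revDarts l) := by
  intro a b hab
  have := hl _ _ (infix_revDarts.1 hab)
  rw [rev_rev] at this
  exact this.symm

/-- A walk along the level line with label `c`; its inner vertices are not in `T`. -/
structure LevelWalk (G : PlaneMultigraph V E) (h : Dart E → ℕ) (c : ℕ) (T : V → Prop)
    (W : G.Walk) : Prop where
  used : ∀ d ∈ W.darts, Used h c d
  arc : ∀ a b, [a, b] <:+: W.darts → G.Arc h c b (rev a)
  inner : ∀ a b, [a, b] <:+: W.darts → ¬ T (G.dst a)

theorem LevelWalk.follows {c : ℕ} {T : V → Prop} {W : G.Walk} (hW : G.LevelWalk h c T W) :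
    G.Follows h c W.darts := fun a b hab => Or.inl (hW.arc a b hab)

/-- The step along a level line is injective. A line that never reached `T` would therefore be
periodic and return to its first dart, whose start lies in `T`. -/
theorem exists_levelWalk {c : ℕ} {T : V → Prop}
    (hstep : ∀ d, Used h c d → ¬ T (G.dst d) → ∃ d', Used h c d' ∧ G.Arc h c d' (rev d))
    {d₀ : Dart E} (hd₀ : Used h c d₀) (hT : T (G.src d₀)) :
    ∃ W : G.Walk, G.LevelWalk h c T W ∧ W.start = G.src d₀ ∧ W.darts.head? = some d₀ ∧
      ∃ d, W.darts.getLast? = some d ∧ Used h c d ∧ G.dst d = W.finish ∧ T W.finish := by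
  classical
  choose! f hf1 hf2 using hstep
  have hsrc : ∀ d, Used h c d → ¬ T (G.dst d) → G.src (f d) = G.dst d := by
    intro d hd hd'
    obtain ⟨-, -, j, -, hj, -⟩ := hf2 d hd hd'
    rw [RotationSystem.dst, ← hj, G.src_eq_iff]
    exact ⟨j, by simp⟩
  have hend : ∃ n, T (G.dst (f^[n] d₀)) := by
    by_contra! hne
    have hused : ∀ n, Used h c (f^[n] d₀) := by
      intro n
      induction n with
      | zero => exact hd₀
      | succ n ih => rw [Function.iterate_succ_apply']; exact hf1 _ ih (hne n)
    obtain ⟨i, j, hij, he⟩ := Finite.exists_ne_map_eq_of_infinite fun n => f^[n] d₀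
    wlog hlt : i < j generalizing i j
    · exact this j i hij.symm he.symm (by omega)
    -- Injectivity cancels steps on both sides of a repetition, until it involves the first dart.
    have hback : ∀ i j, i ≤ j → f^[i] d₀ = f^[j] d₀ → d₀ = f^[j - i] d₀ := by
      intro i
      induction i with
      | zero => intro j _ h0; exact h0
      | succ i ih =>
        intro j hij he
        obtain ⟨m, rfl⟩ : ∃ m, j = m + 1 := ⟨j - 1, by omega⟩
        rw [Function.iterate_succ_apply', Function.iterate_succ_apply'] at he
        have h1 := hf2 _ (hused i) (hne i)
        have h2 := hf2 _ (hused m) (hne m)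
        rw [he] at h1
        have h3 := congrArg rev (h1.right_unique h2)
        rw [rev_rev, rev_rev] at h3
        rw [Nat.add_sub_add_right]
        exact ih m (by omega) h3
    have h0 := hback i j hlt.le he
    obtain ⟨m, hm⟩ : ∃ m, j - i = m + 1 := ⟨j - i - 1, by omega⟩
    rw [hm, Function.iterate_succ_apply'] at h0
    rw [h0, hsrc _ (hused m) (hne m)] at hT
    exact hne m hT
  have hlist : ∀ n d, Used h c d → (∀ i < n, ¬ T (G.dst (f^[i] d))) → T (G.dst (f^[n] d)) →
      ∃ W : G.Walk, G.LevelWalk h c T W ∧ W.start = G.src d ∧ W.darts.head? = some d ∧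
        ∃ d', W.darts.getLast? = some d' ∧ Used h c d' ∧ G.dst d' = W.finish ∧ T W.finish := by
    intro n
    induction n with
    | zero =>
      intro d hd _ hn
      refine ⟨⟨G.src d, G.dst d, [d], rfl, rfl⟩, ⟨by simpa using hd, ?_, ?_⟩, rfl, rfl, d, rfl, hd,
        rfl, hn⟩ <;> intro a b hab <;> have := hab.length_le <;> simp at this
    | succ n ih =>
      intro d hd hlt hn
      have h0 : ¬ T (G.dst d) := hlt 0 (by omega)
      obtain ⟨⟨u, v, l, hw⟩, hW, hs, hh, d', hl, hd', hv, hT'⟩ := ih (f d) (hf1 d hd h0)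
        (fun i hi => by simpa using hlt (i + 1) (by omega)) (by simpa using hn)
      simp only at hs hh hl hv hT'
      have hpair : ∀ a b, [a, b] <:+: d :: l → (a = d ∧ b = f d) ∨ [a, b] <:+: l := by
        intro a b hab
        rw [List.infix_cons_iff, List.cons_prefix_cons] at hab
        rcases hab with ⟨rfl, hab⟩ | hab
        · left
          cases l with
          | nil => simp at hh
          | cons y l =>
            simp only [List.head?_cons, Option.some.injEq] at hh
            simp only [List.cons_prefix_cons, List.nil_prefix, and_true] at hab
            exact ⟨rfl, hab.trans hh⟩
        · exact Or.inr hab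
      refine ⟨⟨G.src d, v, d :: l, rfl, ?_⟩, ⟨?_, ?_, ?_⟩, rfl, rfl, d', ?_, hd', hv, hT'⟩
      · rw [← hsrc d hd h0, ← hs]
        exact hw
      · intro x hx
        rcases List.mem_cons.1 hx with rfl | hx
        · exact hd
        · exact hW.used x hx
      · intro a b hab
        rcases hpair a b hab with ⟨rfl, rfl⟩ | hab
        · exact hf2 _ hd h0
        · exact hW.arc a b hab
      · intro a b hab
        rcases hpair a b hab with ⟨rfl, rfl⟩ | hab
        · exact h0
        · exact hW.inner a b hab
      · rw [List.getLast?_cons, hl]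
        rfl
  obtain ⟨n, hn, hmin⟩ : ∃ n, T (G.dst (f^[n] d₀)) ∧ ∀ i < n, ¬ T (G.dst (f^[i] d₀)) :=
    ⟨Nat.find hend, Nat.find_spec hend, fun i hi => Nat.find_min hend hi⟩
  exact hlist n d₀ hd₀ hmin hn

/-- One step along a level line. -/
theorem exists_used_arc {c : ℕ} {d : Dart E} (hd : Used h c d)
    (hface : ∀ o, G.src o = G.dst d → h (G.next o) = h (rev o))
    (hjump : ∀ o, G.src o = G.dst d → h o ≤ c → c < h (rev o) → h (rev o) = c + 1) :
    ∃ d', Used h c d' ∧ G.Arc h c d' (rev d) := by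
  obtain ⟨o, ho, hlt⟩ := exists_arc (G := G) (h := h) (c := c) (r := rev d)
    (by rw [hd.2]; omega) (by rw [hface _ rfl, rev_rev]; exact hd.1)
  have hsrc : G.src o = G.dst d := by
    obtain ⟨-, -, j, -, hj, -⟩ := ho
    rw [RotationSystem.dst, ← hj, G.src_eq_iff]
    exact ⟨j, by simp⟩
  rw [hface o hsrc] at hlt
  exact ⟨o, ⟨ho.1, hjump o hsrc ho.1 hlt⟩, ho⟩

end PlaneMultigraph

end VCG

namespace VCG

open VCG.Bundle

/-! ### Heights of the faces

The bits `e 0, e 1, …` tell on which side the cut passes the rows `1, 2, …`. -/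

section Heights

variable (k : ℕ) (e : ℕ → Bool) (ζ : ℕ → ℕ)

/-- The position at which the cut passes row `r`. -/
def idx : ℕ → ℕ
  | 0 => 0
  | r + 1 => idx r + if e r then 2 ^ r else 0

theorem idx_lt (r : ℕ) : idx e r < 2 ^ r := by
  induction r with
  | zero => simp [idx]
  | succ r ih =>
    rw [idx, pow_succ]
    split_ifs <;> omega

/-- The number of edges in a bundle of triangle `r`. -/
def thin (r : ℕ) : ℕ := 2 ^ (k - 1 - r)

/-- The slope of the heights on the side of the cut where the bits are `c`. -/
def slope (c : Bool) (r : ℕ) : ℕ := 1 + ∑ i ∈ Finset.Ico r k, if e i = c then thin k i else 0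

variable {k} in
theorem slope_succ {r : ℕ} (hr : r < k) (c : Bool) :
    slope k e c r = slope k e c (r + 1) + if e r = c then thin k r else 0 := by
  rw [slope, slope, Finset.sum_eq_sum_Ico_succ_bot hr]
  omega

theorem slope_self (c : Bool) : slope k e c k = 1 := by simp [slope]

-- The slope is at most 1 + (1 + 2 + ⋯ + 2^(k-1-r)), a geometric sum.
variable {k} in
theorem slope_le {r : ℕ} (hr : r ≤ k) (c : Bool) : slope k e c r ≤ 2 ^ (k - r) := by
  obtain ⟨j, rfl⟩ : ∃ j, k = r + j := ⟨k - r, by omega⟩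
  induction j generalizing r with
  | zero => simp [slope]
  | succ j ih =>
    have h1 := ih (r := r + 1) (by omega)
    rw [show r + 1 + j = r + (j + 1) by omega] at h1
    rw [slope_succ e (by omega)]
    have h2 : r + (j + 1) - (r + 1) = j := by omega
    have h3 : r + (j + 1) - r = j + 1 := by omega
    have h4 : thin (r + (j + 1)) r = 2 ^ j := by rw [thin]; congr 1; omega
    rw [h2] at h1
    rw [h3, h4, pow_succ]
    split_ifs <;> omega

-- The slopes that row r + 1 imposes on triangle r do not exceed the capacity of the thin bundles
-- there.
variable {k} in
theorem slope_succ_le {r : ℕ} (hr : r < k) (c : Bool) : slope k e c (r + 1) ≤ thin k r := by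
  have := slope_le e (show r + 1 ≤ k from hr) c
  rwa [show k - (r + 1) = k - 1 - r by omega] at this

/-- The number of edges of triangle `r` in the cut. -/
def shift (r : ℕ) : ℕ := thin k r * if e r then 2 ^ r - 1 - idx e r else idx e r

/-- The height of the face below row `r` at the cut. -/
def base : ℕ → ℕ
  | 0 => 1 + if 0 = k then ζ 0 else 0
  | r + 1 => base r + shift k e r + 2 ^ (k + 1) + if r + 1 = k then ζ (idx e (r + 1)) else 0

/-- The height of a face. -/
def cellHeight : Cell → ℕ
  | .top => 0
  | .bot => base k e ζ k
  | .X r p q => base k e ζ r +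
    if e r then thin k r * (q - idx e r) +
      (slope k e true (r + 1) * (p - idx e r) + slope k e false (r + 1) * (idx e r - p))
    else thin k r * (idx e r - p) +
      (slope k e true (r + 1) * (q - idx e r) + slope k e false (r + 1) * (idx e r - q))

/-- The first label of the walks for row `r + 1`. -/
def zone (r : ℕ) : ℕ := base k e ζ r + shift k e r + 2 ^ (k - 1)

variable {k e ζ}

theorem thin_mul {r : ℕ} (hr : r < k) : thin k r * 2 ^ r = 2 ^ (k - 1) := by
  rw [thin, ← pow_add]; congr 1; omega

theorem two_pow_eq {k : ℕ} (hk : 0 < k) : 2 ^ k = 2 * 2 ^ (k - 1) := by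
  rw [← pow_succ']; congr 1; omega

theorem two_pow_succ_eq {k : ℕ} (hk : 0 < k) : 2 ^ (k + 1) = 4 * 2 ^ (k - 1) := by
  rw [pow_succ, two_pow_eq hk]; ring

/-- At most one of the two truncated differences is nonzero. -/
theorem slopes_le {r x y N : ℕ} (hr : r < k) (hx : x ≤ N) (hy : y ≤ N) :
    slope k e true (r + 1) * (x - y) + slope k e false (r + 1) * (y - x) ≤ thin k r * N := by
  have h1 := slope_succ_le e hr true
  have h2 := slope_succ_le e hr false
  rcases le_total x y with h | h
  · rw [Nat.sub_eq_zero_of_le h, mul_zero, zero_add]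
    exact Nat.mul_le_mul h2 (by omega)
  · rw [Nat.sub_eq_zero_of_le h, mul_zero, add_zero]
    exact Nat.mul_le_mul h1 (by omega)

/-- The summand of the cut direction is at most `shift k e r`. The sloping part is at most 2^r times
`thin k r`, which is the term 2^(k-1) in `zone`. -/
theorem cellHeight_le {r p q : ℕ} (hr : r < k) (hpq : p ≤ q) (hq : q < 2 ^ r) :
    cellHeight k e ζ (.X r p q) ≤ zone k e ζ r := by
  have hn := idx_lt e r
  simp only [cellHeight, zone, shift, ← thin_mul hr]
  split_ifs
  · have h1 : thin k r * (q - idx e r) ≤ thin k r * (2 ^ r - 1 - idx e r) :=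
      Nat.mul_le_mul_left _ (by omega)
    have h2 := slopes_le (e := e) hr (x := p) (y := idx e r) (N := 2 ^ r) (by omega) (by omega)
    omega
  · have h1 : thin k r * (idx e r - p) ≤ thin k r * idx e r :=
      Nat.mul_le_mul_left _ (by omega)
    have h2 := slopes_le (e := e) hr (x := q) (y := idx e r) (N := 2 ^ r) (by omega) (by omega)
    omega

theorem base_le_cellHeight (r p q : ℕ) : base k e ζ r ≤ cellHeight k e ζ (.X r p q) :=
  Nat.le_add_right _ _

/-- The 2^(k+1) labels of a row bundle at the cut split into 2^(k-1) before the zone, 2^k in the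
zone and 2^(k-1) after it. -/
theorem zone_add_le {r : ℕ} (hr : r < k) : zone k e ζ r + 2 ^ k ≤ base k e ζ (r + 1) := by
  rw [zone, base, two_pow_eq (k := k) (by omega), two_pow_succ_eq (k := k) (by omega)]
  omega

theorem base_le_zone (r : ℕ) : base k e ζ r ≤ zone k e ζ r := by
  have := Nat.one_le_two_pow (n := k - 1)
  rw [zone]; omega

theorem base_mono {r r' : ℕ} (h : r ≤ r') : base k e ζ r ≤ base k e ζ r' :=
  monotone_nat_of_le_succ (f := base k e ζ) (fun r => by
    have := Nat.one_le_two_pow (n := k); rw [base]; omega) h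

theorem zone_add_le_zone {r r' : ℕ} (h : r < r') (hr' : r' ≤ k) :
    zone k e ζ r + 2 ^ k ≤ base k e ζ r' :=
  (zone_add_le (by omega)).trans (base_mono h)

/-- On the diagonal both summands depend on the same coordinate, so `thin k r` is added to the slope
on the side given by e r. This is the recursion of `slope`. -/
theorem cellHeight_diag {r u : ℕ} (hr : r < k) :
    cellHeight k e ζ (.X r u u) = base k e ζ r +
      (slope k e true r * (u - idx e r) + slope k e false r * (idx e r - u)) := by
  rw [cellHeight, slope_succ e hr, slope_succ e hr]
  cases e r <;> simp <;> ring

/-- The height of the face above a bundle. -/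
abbrev topHeight (k : ℕ) (e : ℕ → Bool) (ζ : ℕ → ℕ) (b : Bundle) : ℕ :=
  cellHeight k e ζ (topCell b)

/-- The height of the face below a bundle. -/
abbrev botHeight (k : ℕ) (e : ℕ → Bool) (ζ : ℕ → ℕ) (b : Bundle) : ℕ :=
  cellHeight k e ζ (botCell k b)

theorem topHeight_le_zone {r u : ℕ} (hr : r < k) (hu : u < 2 ^ (r + 1)) :
    topHeight k e ζ (D (r + 1) u) ≤ zone k e ζ r := by
  rw [pow_succ] at hu
  simp only [topHeight, topCell]
  split_ifs
  · exact cellHeight_le hr (by omega) (by omega)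
  · exact cellHeight_le hr (by omega) (by omega)

theorem base_le_topHeight (r u : ℕ) : base k e ζ r ≤ topHeight k e ζ (D (r + 1) u) := by
  simp only [topHeight, topCell]
  split_ifs <;> exact base_le_cellHeight _ _ _

theorem base_le_botHeight {r u : ℕ} (hr : r ≤ k) :
    base k e ζ r ≤ botHeight k e ζ (D r u) := by
  simp only [botHeight, botCell]
  split_ifs
  · exact base_le_cellHeight _ _ _
  · exact base_mono hr

theorem topHeight_zero (u : ℕ) : topHeight k e ζ (D 0 u) = 0 := rfl

theorem botHeight_zero : botHeight k e ζ (D 0 0) = mult k ζ (D 0 0) := by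
  simp only [botHeight, botCell, mult]
  split_ifs with h1 h2 h2
  · omega
  · rw [cellHeight_diag h1]
    simp [idx, base, h2]
  · subst h2
    simp [cellHeight, base]
  · omega

/-- The walks for row `r + 1` do not use the bundle. -/
def Far (e : ℕ → Bool) (r u : ℕ) : Prop := e r = decide (u < 2 ^ r)

/-- On this half the heights above and below row r + 1 have the same slopes if r + 1 < k, so they
differ by exactly 2^(k+1) everywhere. Only row k needs a further argument. -/
theorem botHeight_le_of_not_far {r u : ℕ} (hζ : ∀ u, ζ u ≤ 1) (hr : r < k)
    (hf : ¬ Far e r u) :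
    botHeight k e ζ (D (r + 1) u) ≤ topHeight k e ζ (D (r + 1) u) + mult k ζ (D (r + 1) u) := by
  have hn := idx_lt e r
  have hz1 := hζ u
  have hz2 := hζ (idx e (r + 1))
  have hsl : slope k e true (r + 1) * (u - idx e (r + 1)) +
      slope k e false (r + 1) * (idx e (r + 1) - u) + base k e ζ r + shift k e r =
      topHeight k e ζ (D (r + 1) u) := by
    simp only [topHeight, topCell, Far] at hf ⊢
    by_cases hlt : u < 2 ^ r
    · have he : e r = false := by simpa [hlt] using hf
      simp only [hlt, if_true, cellHeight, he, shift, idx]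
      simp
      ring
    · have he : e r = true := by simpa [hlt] using hf
      have h1 : u - (idx e r + 2 ^ r) = u - 2 ^ r - idx e r := by omega
      have h2 : idx e r + 2 ^ r - u = idx e r - (u - 2 ^ r) := by omega
      simp only [hlt, if_false, cellHeight, he, shift, idx, if_true, h1, h2]
      ring
  rw [← hsl]
  simp only [botHeight, botCell, mult]
  rw [if_neg (by omega : ¬ r + 1 = 0)]
  by_cases h1 : r + 1 < k
  · rw [if_pos h1, cellHeight_diag h1, base, if_neg (by omega), if_neg (by omega)]
    omega
  · obtain rfl : k = r + 1 := by omega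
    rw [if_neg h1, cellHeight, base, slope_self, slope_self, one_mul, one_mul, if_pos rfl,
      if_pos rfl]
    -- The height below row k may include the additional edge at the cut. Other bundles may lack
    -- this edge, but there the height above has already gained at least 1; this is why all slopes
    -- start from 1.
    by_cases h4 : u = idx e (r + 1)
    · rw [← h4]; omega
    · omega

/-- Two effects make the row too thin on this half. The height above need not contain the shift of
the triangle, which is at most 2^(k-1) - `thin k r`, and the slope below continues beyond z, for at
most 2^(k-1) more. The deficit is at most 2^k, the number of labels in the zone. -/
theorem botHeight_le_of_far {r u : ℕ} (hζ : ∀ u, ζ u ≤ 1) (hr : r < k) (hu : u < 2 ^ (r + 1))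
    (hf : Far e r u) :
    botHeight k e ζ (D (r + 1) u) ≤
      topHeight k e ζ (D (r + 1) u) + 2 ^ k + mult k ζ (D (r + 1) u) := by
  have hn := idx_lt e r
  rw [pow_succ] at hu
  have hz2 := hζ (idx e (r + 1))
  have hQ := thin_mul hr
  have hm : 2 ^ (k + 1) ≤ mult k ζ (D (r + 1) u) := by simp [mult]
  have hs1 := slope_succ_le e hr true
  have hs0 := slope_succ_le e hr false
  have hthin : 1 ≤ thin k r := Nat.one_le_two_pow
  have hmul : thin k r * (2 ^ r - 1) + thin k r = 2 ^ (k - 1) := by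
    rw [← hQ, ← Nat.mul_succ]
    congr 1
    omega
  -- The maximum with 1 covers the additional edge in row k, where no slope is left below the row.
  have hbot : botHeight k e ζ (D (r + 1) u) ≤ base k e ζ r + shift k e r + 4 * 2 ^ (k - 1) +
      max 1 (slope k e true (r + 1) * (u - idx e (r + 1)) +
        slope k e false (r + 1) * (idx e (r + 1) - u)) := by
    simp only [botHeight, botCell]
    split_ifs with h1
    · rw [cellHeight_diag h1, base, if_neg (by omega), two_pow_succ_eq (k := k) (by omega)]
      omega
    · obtain rfl : k = r + 1 := by omega
      rw [cellHeight, base, two_pow_succ_eq (k := r + 1) (by omega)]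
      simp only [if_true]
      omega
  rw [two_pow_succ_eq (k := k) (by omega)] at hm
  rw [two_pow_eq (k := k) (by omega)]
  refine hbot.trans ?_
  simp only [Far] at hf
  by_cases hlt : u < 2 ^ r
  · have he : e r = true := by simpa [hlt] using hf
    simp only [topHeight, topCell, hlt, if_true, cellHeight, he, shift, idx]
    rw [Nat.sub_eq_zero_of_le (show u ≤ idx e r + 2 ^ r by omega),
      Nat.zero_sub, Nat.sub_zero, mul_zero, zero_add,
      show idx e r + 2 ^ r - u = idx e r + (2 ^ r - u) by omega, mul_add]
    have h1 : slope k e false (r + 1) * (2 ^ r - u) ≤ 2 ^ (k - 1) := by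
      rw [← hQ]; exact Nat.mul_le_mul hs0 (by omega)
    have h2 : thin k r * (2 ^ r - 1 - idx e r) ≤ thin k r * (2 ^ r - 1) :=
      Nat.mul_le_mul_left _ (by omega)
    omega
  · have he : e r = false := by simpa [hlt] using hf
    simp only [topHeight, topCell, hlt, if_false, cellHeight, he, shift, idx, Bool.false_eq_true,
      add_zero]
    rw [Nat.sub_eq_zero_of_le (show idx e r ≤ u by omega),
      Nat.sub_eq_zero_of_le (show idx e r ≤ 2 ^ r - 1 by omega), mul_zero, add_zero, add_zero,
      show u - idx e r = (2 ^ r - 1 - idx e r) + (u - 2 ^ r + 1) by omega, mul_add]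
    have h1 : slope k e true (r + 1) * (u - 2 ^ r + 1) ≤ 2 ^ (k - 1) := by
      rw [← hQ]; exact Nat.mul_le_mul hs1 (by omega)
    have h2 : thin k r * idx e r ≤ thin k r * (2 ^ r - 1) := Nat.mul_le_mul_left _ (by omega)
    omega

/-- Across a thin bundle one coordinate of the face changes by one. The height changes by at most
`thin k r` in the direction of the cut, and by at most a slope of row r + 1 in the other one. -/
theorem topHeight_botHeight_of_thin {b : Bundle} (hb : b.Valid k) (hD : ∀ r u, b ≠ D r u) :
    topHeight k e ζ b ≤ botHeight k e ζ b + mult k ζ b ∧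
      botHeight k e ζ b ≤ topHeight k e ζ b + mult k ζ b := by
  have key : ∀ {r x n : ℕ}, r < k →
      slope k e true (r + 1) * (x - n) + slope k e false (r + 1) * (n - x) ≤
        slope k e true (r + 1) * (x + 1 - n) + slope k e false (r + 1) * (n - (x + 1)) + thin k r ∧
      slope k e true (r + 1) * (x + 1 - n) + slope k e false (r + 1) * (n - (x + 1)) ≤
        slope k e true (r + 1) * (x - n) + slope k e false (r + 1) * (n - x) + thin k r := by
    intro r x n hr
    have h1 := slope_succ_le e hr true
    have h2 := slope_succ_le e hr false
    rcases le_or_gt n x with h | h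
    · rw [Nat.sub_eq_zero_of_le h, Nat.sub_eq_zero_of_le (show n ≤ x + 1 by omega),
        show x + 1 - n = x - n + 1 by omega, mul_add]
      omega
    · rw [Nat.sub_eq_zero_of_le h.le, Nat.sub_eq_zero_of_le (show x + 1 ≤ n by omega),
        show n - x = n - (x + 1) + 1 by omega, mul_add]
      omega
  have key2 : ∀ {r x n : ℕ}, thin k r * (x - n) ≤ thin k r * (x + 1 - n) ∧
      thin k r * (x + 1 - n) ≤ thin k r * (x - n) + thin k r := by
    intro r x n
    refine ⟨Nat.mul_le_mul_left _ (by omega), ?_⟩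
    rw [← Nat.mul_succ]
    exact Nat.mul_le_mul_left _ (by omega)
  have key3 : ∀ {r x n : ℕ}, thin k r * (n - (x + 1)) ≤ thin k r * (n - x) ∧
      thin k r * (n - x) ≤ thin k r * (n - (x + 1)) + thin k r := by
    intro r x n
    refine ⟨Nat.mul_le_mul_left _ (by omega), ?_⟩
    rw [← Nat.mul_succ]
    exact Nat.mul_le_mul_left _ (by omega)
  rcases b with ⟨r, u⟩ | ⟨r, s, t⟩ | ⟨r, s, t⟩
  · exact absurd rfl (hD r u)
  · obtain ⟨hr, hst, ht⟩ := hb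
    obtain ⟨t, rfl⟩ : ∃ t', t = t' + 1 := ⟨t - 1, by omega⟩
    have h1 := key (x := t) (n := idx e r) hr
    have h2 := key2 (r := r) (x := t) (n := idx e r)
    simp only [topHeight, botHeight, topCell, botCell, cellHeight, mult, ← thin.eq_1,
      Nat.add_sub_cancel]
    split_ifs <;> omega
  · obtain ⟨hr, hs, hst, ht⟩ := hb
    obtain ⟨s, rfl⟩ : ∃ s', s = s' + 1 := ⟨s - 1, by omega⟩
    have h1 := key (x := s) (n := idx e r) hr
    have h2 := key3 (r := r) (x := s) (n := idx e r)
    simp only [topHeight, botHeight, topCell, botCell, cellHeight, mult, ← thin.eq_1,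
      Nat.add_sub_cancel]
    split_ifs <;> omega

end Heights

end VCG

/-! ### Interpolation of the heights inside the bundles -/

namespace VCG

open VCG.Bundle

section UnitHeights

variable (k : ℕ) (e : ℕ → Bool) (ζ : ℕ → ℕ)

instance (r u : ℕ) : Decidable (Far e r u) := inferInstanceAs (Decidable (_ = _))

/-- The height of the face above edge `c` of a bundle. -/
def unitHeight (b : Bundle) (c : ℕ) : ℕ :=
  match b with
  | D (r + 1) u =>
    if Far e r u then
      -- One edge leads from height `zone` to `zone + 2 ^ k + 1`. It carries the label `zone + 2 ^
      -- k`, and the 2^k labels of the zone get no edge.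
      if topHeight k e ζ (D (r + 1) u) + c ≤ zone k e ζ r then topHeight k e ζ (D (r + 1) u) + c
      else min (topHeight k e ζ (D (r + 1) u) + c + 2 ^ k) (botHeight k e ζ (D (r + 1) u))
    else min (topHeight k e ζ (D (r + 1) u) + c) (botHeight k e ζ (D (r + 1) u))
  | D 0 u => min c (botHeight k e ζ (D 0 u))
  | b =>
    if topHeight k e ζ b ≤ botHeight k e ζ b then min (topHeight k e ζ b + c) (botHeight k e ζ b)
    else max (topHeight k e ζ b - c) (botHeight k e ζ b)

variable {k e ζ}

/-- The label `l` belongs to the walks for row `r + 1`. -/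
def InZone (k : ℕ) (e : ℕ → Bool) (ζ : ℕ → ℕ) (r l : ℕ) : Prop :=
  zone k e ζ r ≤ l ∧ l < zone k e ζ r + 2 ^ k

theorem zone_lt_botHeight {r u : ℕ} (hr : r < k) :
    zone k e ζ r + 2 ^ k < botHeight k e ζ (D (r + 1) u) := by
  refine lt_of_lt_of_le ?_ (base_le_botHeight hr)
  have := Nat.one_le_two_pow (n := k - 1)
  rw [zone, base, two_pow_eq (k := k) (by omega), two_pow_succ_eq (k := k) (by omega)]
  omega

theorem topHeight_le_botHeight {r u : ℕ} (hr : r ≤ k) (hu : u < 2 ^ r) :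
    topHeight k e ζ (D r u) ≤ botHeight k e ζ (D r u) := by
  cases r with
  | zero => rw [topHeight_zero]; exact Nat.zero_le _
  | succ r => exact (topHeight_le_zone hr hu).trans (by
      have := zone_lt_botHeight (e := e) (ζ := ζ) (u := u) hr
      have hk2 := Nat.one_le_two_pow (n := k)
      omega)

theorem unitHeight_zero {b : Bundle} (hb : b.Valid k) :
    unitHeight k e ζ b 0 = topHeight k e ζ b := by
  rcases b with ⟨_ | r, u⟩ | ⟨r, s, t⟩ | ⟨r, s, t⟩
  · simp [unitHeight, topHeight_zero]
  · have h1 := topHeight_le_botHeight (e := e) (ζ := ζ) hb.1 hb.2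
    have h2 := topHeight_le_zone (e := e) (ζ := ζ) hb.1 hb.2
    simp only [unitHeight, add_zero]
    split_ifs <;> omega
  · simp only [unitHeight]
    split_ifs <;> omega
  · simp only [unitHeight]
    split_ifs <;> omega

/-- The capacity bounds enter here: the number of edges suffices to arrive at the height below, in
far bundles thanks to the leap. -/
theorem unitHeight_mult (hζ : ∀ u, ζ u ≤ 1) {b : Bundle} (hb : b.Valid k) :
    unitHeight k e ζ b (mult k ζ b) = botHeight k e ζ b := by
  rcases b with ⟨_ | r, u⟩ | ⟨r, s, t⟩ | ⟨r, s, t⟩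
  · obtain rfl : u = 0 := by simpa using hb.2
    simp only [unitHeight, botHeight_zero, min_self]
  · have hr : r < k := hb.1
    have h1 := topHeight_le_botHeight (e := e) (ζ := ζ) hb.1 hb.2
    have h2 := topHeight_le_zone (e := e) (ζ := ζ) hr hb.2
    simp only [unitHeight]
    split_ifs with hf h3
    -- The leap does take place: the zone begins at most 2 * 2^(k-1) above the lowest possible
    -- height, and the bundle has at least 4 * 2^(k-1) edges.
    · exfalso
      have h4 := base_le_topHeight (k := k) (e := e) (ζ := ζ) r u
      have h5 : 2 ^ (k + 1) ≤ mult k ζ (D (r + 1) u) := by simp [mult]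
      have h6 : shift k e r ≤ 2 ^ (k - 1) := by
        rw [shift, ← thin_mul hr]
        have := idx_lt e r
        exact Nat.mul_le_mul_left _ (by split_ifs <;> omega)
      have h7 := Nat.one_le_two_pow (n := k - 1)
      rw [two_pow_succ_eq (k := k) (by omega)] at h5
      rw [zone] at h3
      omega
    · have := botHeight_le_of_far (e := e) hζ hr hb.2 hf
      omega
    · have := botHeight_le_of_not_far (e := e) hζ hr hf
      omega
  · have := topHeight_botHeight_of_thin (e := e) (ζ := ζ) hb (by simp)
    simp only [unitHeight]
    split_ifs <;> omega
  · have := topHeight_botHeight_of_thin (e := e) (ζ := ζ) hb (by simp)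
    simp only [unitHeight]
    split_ifs <;> omega

theorem unitHeight_le_succ {r u : ℕ} (hb : (D r u).Valid k) (c : ℕ) :
    unitHeight k e ζ (D r u) c ≤ unitHeight k e ζ (D r u) (c + 1) := by
  rcases r with _ | r
  · simp only [unitHeight]
    omega
  · have h3 := zone_lt_botHeight (e := e) (ζ := ζ) (u := u) (show r < k from hb.1)
    have hk2 := Nat.one_le_two_pow (n := k)
    simp only [unitHeight, min_def]
    split_ifs <;> omega

theorem unitHeight_mono {r u : ℕ} (hb : (D r u).Valid k) {c c' : ℕ} (h : c ≤ c') :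
    unitHeight k e ζ (D r u) c ≤ unitHeight k e ζ (D r u) c' :=
  monotone_nat_of_le_succ (unitHeight_le_succ hb) h

/-- Apart from the leap over the zone in far bundles, the height rises by at most one per edge. -/
theorem eq_succ_of_up {b : Bundle} {c l : ℕ} (h1 : unitHeight k e ζ b c ≤ l)
    (h2 : l < unitHeight k e ζ b (c + 1)) :
    unitHeight k e ζ b (c + 1) = l + 1 ∨
      ∃ r u, b = D (r + 1) u ∧ Far e r u ∧ InZone k e ζ r l := by
  rcases b with ⟨_ | r, u⟩ | ⟨r, s, t⟩ | ⟨r, s, t⟩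
  · simp only [unitHeight] at h1 h2 ⊢
    omega
  · by_cases hf : Far e r u
    · by_cases hl : InZone k e ζ r l
      · exact Or.inr ⟨r, u, rfl, hf, hl⟩
      · left
        simp only [InZone] at hl
        simp only [unitHeight, hf, if_true] at h1 h2 ⊢
        split_ifs at h1 h2 ⊢ <;> omega
    · left
      simp only [unitHeight, hf, if_false] at h1 h2 ⊢
      omega
  · left
    simp only [unitHeight] at h1 h2 ⊢
    split_ifs at h1 h2 ⊢ <;> omega
  · left
    simp only [unitHeight] at h1 h2 ⊢
    split_ifs at h1 h2 ⊢ <;> omega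

theorem eq_succ_of_down {b : Bundle} (hb : b.Valid k) {c l : ℕ}
    (h1 : unitHeight k e ζ b (c + 1) ≤ l) (h2 : l < unitHeight k e ζ b c) :
    unitHeight k e ζ b c = l + 1 := by
  rcases b with ⟨r, u⟩ | ⟨r, s, t⟩ | ⟨r, s, t⟩
  · have := unitHeight_le_succ (e := e) (ζ := ζ) hb c
    omega
  · simp only [unitHeight] at h1 h2 ⊢
    split_ifs at h1 h2 ⊢ <;> omega
  · simp only [unitHeight] at h1 h2 ⊢
    split_ifs at h1 h2 ⊢ <;> omega

theorem unitHeight_bounds {b : Bundle} (hb : b.Valid k) (c : ℕ) :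
    min (topHeight k e ζ b) (botHeight k e ζ b) ≤ unitHeight k e ζ b c ∧
      unitHeight k e ζ b c ≤ max (topHeight k e ζ b) (botHeight k e ζ b) := by
  rcases b with ⟨_ | r, u⟩ | ⟨r, s, t⟩ | ⟨r, s, t⟩
  · simp only [unitHeight, topHeight_zero]
    omega
  · have h2 := topHeight_le_zone (e := e) (ζ := ζ) hb.1 hb.2
    have h3 := zone_lt_botHeight (e := e) (ζ := ζ) (u := u) (show r < k from hb.1)
    have hk2 := Nat.one_le_two_pow (n := k)
    rw [min_eq_left (by omega), max_eq_right (by omega)]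
    simp only [unitHeight, min_def]
    split_ifs <;> omega
  · simp only [unitHeight]
    split_ifs <;> omega
  · simp only [unitHeight]
    split_ifs <;> omega

/-- A label between two heights of triangle r is at least `base r` and below `zone r`. It lies after
all earlier zones and before zone r and all later ones. -/
theorem not_inZone_of_cell {r p q : ℕ} (hr : r < k) (hpq : p ≤ q) (hq : q < 2 ^ r) {p' q' : ℕ}
    (hpq' : p' ≤ q') (hq' : q' < 2 ^ r) {r' l : ℕ} (hr' : r' < k) (hl : InZone k e ζ r' l)
    (h1 : min (cellHeight k e ζ (.X r p q)) (cellHeight k e ζ (.X r p' q')) ≤ l)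
    (h2 : l < max (cellHeight k e ζ (.X r p q)) (cellHeight k e ζ (.X r p' q'))) : False := by
  have h3 := cellHeight_le (e := e) (ζ := ζ) hr hpq hq
  have h4 := cellHeight_le (e := e) (ζ := ζ) hr hpq' hq'
  have h5 := base_le_cellHeight (k := k) (e := e) (ζ := ζ) r p q
  have h6 := base_le_cellHeight (k := k) (e := e) (ζ := ζ) r p' q'
  simp only [InZone] at hl
  rcases lt_trichotomy r r' with h | rfl | h
  · have h7 := zone_add_le_zone (e := e) (ζ := ζ) h hr'.le
    have h8 := base_le_zone (k := k) (e := e) (ζ := ζ) r'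
    omega
  · omega
  · have h7 := zone_add_le_zone (e := e) (ζ := ζ) h hr.le
    omega

/-- Only the bundles of row `r + 1` are crossed by the labels for this row. -/
theorem eq_row_of_inZone {b : Bundle} (hb : b.Valid k) {r l c : ℕ} (hr : r < k)
    (hl : InZone k e ζ r l)
    (h1 : min (unitHeight k e ζ b c) (unitHeight k e ζ b (c + 1)) ≤ l)
    (h2 : l < max (unitHeight k e ζ b c) (unitHeight k e ζ b (c + 1))) : ∃ u, b = D (r + 1) u := by
  have h3 := unitHeight_bounds (e := e) (ζ := ζ) hb c
  have h4 := unitHeight_bounds (e := e) (ζ := ζ) hb (c + 1)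
  rcases b with ⟨_ | r', u⟩ | ⟨r', s, t⟩ | ⟨r', s, t⟩
  · exfalso
    have h5 : botHeight k e ζ (D 0 u) = base k e ζ 0 := by
      obtain rfl : u = 0 := by simpa using hb.2
      rw [botHeight_zero]
      simp only [mult, base, if_true]
    have h6 := base_mono (k := k) (e := e) (ζ := ζ) (Nat.zero_le r)
    have h7 := base_le_zone (k := k) (e := e) (ζ := ζ) r
    simp only [InZone] at hl
    simp only [topHeight_zero] at h3 h4
    omega
  · have hr' : r' < k := hb.1
    rcases lt_trichotomy r r' with h | rfl | h
    · exfalso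
      have h5 := base_le_topHeight (k := k) (e := e) (ζ := ζ) r' u
      have h6 := zone_add_le_zone (e := e) (ζ := ζ) h hr'.le
      have h7 := topHeight_le_botHeight (e := e) (ζ := ζ) hb.1 hb.2
      simp only [InZone] at hl
      omega
    · exact ⟨u, rfl⟩
    · exfalso
      have h7 := topHeight_le_botHeight (e := e) (ζ := ζ) hb.1 hb.2
      have h8 : botHeight k e ζ (D (r' + 1) u) ≤ zone k e ζ r := by
        simp only [botHeight, botCell]
        rw [if_pos (by omega)]
        refine (cellHeight_le (by omega) le_rfl hb.2).trans ?_
        rcases Nat.lt_or_ge (r' + 1) r with h9 | h9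
        · have := zone_add_le_zone (e := e) (ζ := ζ) h9 hr.le
          have := base_le_zone (k := k) (e := e) (ζ := ζ) r
          have hk2 := Nat.one_le_two_pow (n := k)
          omega
        · rw [show r' + 1 = r by omega]
      simp only [InZone] at hl
      omega
  · simp only [Bundle.Valid] at hb
    exact (not_inZone_of_cell (p := s) (q := t - 1) (p' := s) (q' := t) hb.1 (by omega) (by omega)
      (by omega) (by omega) hr hl
      (by simp only [topHeight, botHeight, topCell, botCell] at h3 h4; omega)
      (by simp only [topHeight, botHeight, topCell, botCell] at h3 h4; omega)).elim
  · simp only [Bundle.Valid] at hb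
    exact (not_inZone_of_cell (p := s) (q := t) (p' := s - 1) (q' := t) hb.1 (by omega) (by omega)
      (by omega) (by omega) hr hl
      (by simp only [topHeight, botHeight, topCell, botCell] at h3 h4; omega)
      (by simp only [topHeight, botHeight, topCell, botCell] at h3 h4; omega)).elim

theorem not_far_of_used {r u c l : ℕ} (hb : (D (r + 1) u).Valid k) (hl : InZone k e ζ r l)
    (h2 : unitHeight k e ζ (D (r + 1) u) (c + 1) = l + 1) : ¬ Far e r u := by
  intro hf
  have h3 := zone_lt_botHeight (e := e) (ζ := ζ) (u := u) (show r < k from hb.1)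
  simp only [InZone] at hl
  have hk2 := Nat.one_le_two_pow (n := k)
  simp only [unitHeight, hf, if_true, min_def] at h2
  split_ifs at h2 <;> omega

/-- Every label that does not avoid a bundle of a row is carried by an edge of the bundle. -/
theorem exists_unit {r u l : ℕ} (hζ : ∀ u, ζ u ≤ 1) (hb : (D r u).Valid k)
    (h1 : topHeight k e ζ (D r u) ≤ l) (h2 : l < botHeight k e ζ (D r u))
    (h3 : ∀ r', r = r' + 1 → Far e r' u → ¬ InZone k e ζ r' l) :
    ∃ c < mult k ζ (D r u), unitHeight k e ζ (D r u) c ≤ l ∧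
      unitHeight k e ζ (D r u) (c + 1) = l + 1 := by
  rcases r with _ | r
  · obtain rfl : u = 0 := by simpa using hb.2
    refine ⟨l, by rwa [← botHeight_zero], ?_⟩
    simp only [unitHeight]
    omega
  · have h5 := topHeight_le_zone (e := e) (ζ := ζ) hb.1 hb.2
    by_cases hf : Far e r u
    · have h4 := botHeight_le_of_far (e := e) hζ hb.1 hb.2 hf
      have h6 := h3 r rfl hf
      simp only [InZone] at h6
      rcases Nat.lt_or_ge l (zone k e ζ r) with h7 | h7
      · have h8 : 2 ^ (k + 1) ≤ mult k ζ (D (r + 1) u) := by simp [mult]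
        have h9 := base_le_topHeight (k := k) (e := e) (ζ := ζ) r u
        have h10 : shift k e r ≤ 2 ^ (k - 1) := by
          rw [shift, ← thin_mul hb.1]
          have := idx_lt e r
          exact Nat.mul_le_mul_left _ (by split_ifs <;> omega)
        have hk : 0 < k := by have := hb.1; omega
        have h11 := Nat.one_le_two_pow (n := k - 1)
        rw [two_pow_succ_eq hk] at h8
        refine ⟨l - topHeight k e ζ (D (r + 1) u), ?_, ?_⟩
        · have h12 : l < base k e ζ r + shift k e r + 2 ^ (k - 1) := h7
          omega
        · simp only [unitHeight, hf, if_true]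
          split_ifs <;> omega
      -- After the zone, the leap has saved 2^k edges.
      · refine ⟨l - 2 ^ k - topHeight k e ζ (D (r + 1) u), by omega, ?_⟩
        simp only [unitHeight, hf, if_true]
        split_ifs <;> omega
    · have h4 := botHeight_le_of_not_far (e := e) hζ hb.1 hf
      refine ⟨l - topHeight k e ζ (D (r + 1) u), by omega, ?_⟩
      simp only [unitHeight, hf, if_false]
      omega

/-- The labels are distributed among the bundles that start at `w₀`. -/
theorem exists_first_row {l : ℕ} (hl : l < base k e ζ k) :
    ∃ r ≤ k, topHeight k e ζ (D r 0) ≤ l ∧ l < botHeight k e ζ (D r 0) := by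
  classical
  have hex : ∃ r, l < botHeight k e ζ (D r 0) ∧ r ≤ k := ⟨k, by
    simp only [botHeight, botCell, lt_irrefl, if_false]; exact hl, le_rfl⟩
  refine ⟨Nat.find hex, (Nat.find_spec hex).2, ?_, (Nat.find_spec hex).1⟩
  have hle := (Nat.find_spec hex).2
  generalize hr : Nat.find hex = r at hle
  rcases r with _ | r
  · exact Nat.zero_le _
  · have h1 := Nat.find_min hex (m := r) (by omega)
    -- Consecutive rows share a face at w₀, so the intervals of labels of their first bundles
    -- adjoin.
    have h2 : topHeight k e ζ (D (r + 1) 0) = botHeight k e ζ (D r 0) := by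
      simp only [topHeight, botHeight, topCell, botCell]
      rw [if_pos (by positivity), if_pos (by omega)]
    rw [h2]
    by_contra h3
    exact h1 ⟨by omega, by omega⟩

end UnitHeights

end VCG

namespace VCG

open VCG.Bundle PlaneMultigraph

/-! ### The flow in the gadget -/

theorem bundleSrc_eq_w {k : ℕ} {d : Bundle × Bool} (h : d.1.Valid k) {c : Bool}
    (hd : bundleSrc d = .w c) :
    ∃ r ≤ k, d = if c then (D r (2 ^ r - 1), true) else (D r 0, false) := by
  obtain ⟨⟨r, u⟩ | ⟨r, s, t⟩ | ⟨r, s, t⟩, _ | _⟩ := d <;> simp only [Bundle.Valid] at h <;>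
    simp only [bundleSrc, point] at hd <;> split_ifs at hd <;>
    simp only [Point.w.injEq] at hd <;> first | omega | contradiction | skip
  all_goals
    subst hd
    exact ⟨r, h.1, by simp; omega⟩

theorem point_self (r s : ℕ) :
    point r s s = if s = 0 then .w false else if s = 2 ^ r then .w true else .p r s s := by
  simp [point]

theorem InZone.eq {k : ℕ} {e : ℕ → Bool} {ζ : ℕ → ℕ} {r r' l : ℕ} (h : InZone k e ζ r l)
    (h' : InZone k e ζ r' l) (hr : r < k) (hr' : r' < k) : r = r' := by
  simp only [InZone] at h h'
  rcases lt_trichotomy r r' with h1 | h1 | h1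
  · have := zone_add_le_zone (e := e) (ζ := ζ) h1 hr'.le
    have := base_le_zone (k := k) (e := e) (ζ := ζ) r'
    omega
  · exact h1
  · have := zone_add_le_zone (e := e) (ζ := ζ) h1 hr.le
    have := base_le_zone (k := k) (e := e) (ζ := ζ) r
    omega

namespace Coord

variable {k : ℕ} {ζ : ℕ → ℕ} {V E : Type} [Finite V] [Finite E] {G : PlaneMultigraph V E}
  (C : Coord k ζ G) (e : ℕ → Bool)

/-- The height of the face to the left of a dart. -/
def height (d : Dart E) : ℕ := unitHeight k e ζ (C.pos d.1).1 ((C.pos d.1).2 + d.2.toNat)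

theorem exists_dart {b : Bundle} {c : ℕ} (hb : b.Valid k) (hc : c < mult k ζ b) (x : Bool) :
    ∃ d : Dart E, C.pos d.1 = (b, c) ∧ d.2 = x := by
  obtain ⟨a, ha⟩ := C.exists_pos b c hb hc
  exact ⟨(a, x), ha, rfl⟩

theorem dart_ext {d d' : Dart E} (h : (C.pos d.1, d.2) = (C.pos d'.1, d'.2)) : d = d' := by
  simp only [Prod.mk.injEq] at h
  exact Prod.ext (C.pos_injective h.1) h.2

variable {C e}

theorem height_of_unitFirst (hζ : ∀ u, ζ u ≤ 1) {d : Dart E} {x : Bundle × Bool}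
    (hx : x.1.Valid k) (h : (C.pos d.1, d.2) = unitFirst k ζ x) :
    C.height e d = cellHeight k e ζ (cell k x) := by
  obtain ⟨b, _ | _⟩ := x <;> simp only [unitFirst, Prod.mk.injEq] at h
  · rw [height, h.1, h.2]
    exact unitHeight_zero hx
  · rw [height, h.1, h.2]
    have := mult_pos k ζ b
    simp only [Bool.toNat_true, Nat.sub_add_cancel this]
    exact unitHeight_mult hζ hx

/-- A corner has one height: within a bundle because the counts match, between bundles because the
corner lies in one face. This cannot hold at w₀ and w₁, where the outer face has the height 0 above
and that of the whole cut below. -/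
theorem height_next (hζ : ∀ u, ζ u ≤ 1) {d : Dart E} (hw : ∀ c, C.vtx (G.src d) ≠ .w c) :
    C.height e (G.next d) = C.height e (rev d) := by
  have h1 := C.next d
  have h2 := C.pos_valid d.1
  have h3 := C.pos_lt d.1
  simp only [C.src] at hw
  obtain ⟨a, x⟩ := d
  generalize hp : C.pos a = p at *
  obtain ⟨b, c⟩ := p
  simp only at h2 h3 hw
  cases x
  · simp only [unitNext] at h1
    split_ifs at h1 with hc
    · simp only [Prod.mk.injEq] at h1
      simp [height, rev, h1.1, h1.2, hp]
    · rw [height_of_unitFirst hζ (bundleNext_valid h2) h1, cell_bundleNext h2 hw]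
      have : c + 1 = mult k ζ b := by omega
      simp only [height, rev, hp, Bool.not_false, Bool.toNat_true, this, unitHeight_mult hζ h2]
      rfl
  · simp only [unitNext] at h1
    split_ifs at h1 with hc
    · simp only [Prod.mk.injEq] at h1
      simp [height, rev, h1.1, h1.2, hp, Nat.sub_add_cancel hc]
    · rw [height_of_unitFirst hζ (bundleNext_valid h2) h1, cell_bundleNext h2 hw]
      have : c = 0 := by omega
      simp only [height, rev, hp, Bool.not_true, Bool.toNat_false, this, add_zero,
        unitHeight_zero h2]
      rfl

theorem height_rev_eq {d : Dart E} {l : ℕ} (h1 : C.height e d ≤ l) (h2 : l < C.height e (rev d)) :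
    C.height e (rev d) = l + 1 ∨
      ∃ r u, (C.pos d.1).1 = D (r + 1) u ∧ d.2 = false ∧ Far e r u ∧ InZone k e ζ r l := by
  have h3 := C.pos_valid d.1
  obtain ⟨a, _ | _⟩ := d
  · rcases eq_succ_of_up h1 h2 with h | ⟨r, u, h⟩
    · exact Or.inl h
    · exact Or.inr ⟨r, u, h.1, rfl, h.2⟩
  · exact Or.inl (eq_succ_of_down h3 h1 h2)

/-- The dart `d` of a row carries the label `l`, in one of the two directions. -/
theorem unitHeight_of_used {d : Dart E} {l r u c : ℕ} (hp : C.pos d.1 = (D r u, c))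
    (h : Used (C.height e) l d ∨ Used (C.height e) l (rev d)) :
    unitHeight k e ζ (D r u) c ≤ l ∧ unitHeight k e ζ (D r u) (c + 1) = l + 1 := by
  have h1 := C.pos_valid d.1
  rw [hp] at h1
  have h2 := unitHeight_le_succ (e := e) (ζ := ζ) h1 c
  obtain ⟨a, _ | _⟩ := d <;> simp only at hp <;>
    simp [Used, height, rev, hp] at h <;> omega

theorem direction_of_used {d : Dart E} {l r u c : ℕ} (hp : C.pos d.1 = (D r u, c))
    (h : Used (C.height e) l d) : d.2 = false := by
  have h1 := C.pos_valid d.1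
  rw [hp] at h1
  have h2 := unitHeight_le_succ (e := e) (ζ := ζ) h1 c
  obtain ⟨a, _ | _⟩ := d
  · rfl
  · simp only at hp
    simp [Used, height, rev, hp] at h
    omega

theorem used_of_unitHeight {d : Dart E} {l r u c : ℕ} (hp : C.pos d.1 = (D r u, c))
    (hd : d.2 = false) (h1 : unitHeight k e ζ (D r u) c ≤ l)
    (h2 : unitHeight k e ζ (D r u) (c + 1) = l + 1) : Used (C.height e) l d := by
  simp [Used, height, rev, hp, hd, h1, h2]

/-- Heights increase downwards in every row, so level lines use row bundles from left to right, and
only left ends of rows lie at w₀. Hence a level line does not return to w₀. -/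
theorem dst_ne_w_false {d : Dart E} {l : ℕ} (h : Used (C.height e) l d) :
    C.vtx (G.dst d) ≠ .w false := by
  intro hw
  rw [RotationSystem.dst, C.src] at hw
  obtain ⟨r, -, hr⟩ := bundleSrc_eq_w (C.pos_valid (rev d).1) hw
  simp only [rev, Bool.false_eq_true, if_false, Prod.mk.injEq] at hr
  have := direction_of_used (d := d) (c := (C.pos d.1).2) (Prod.ext hr.1 rfl) h
  simp [this] at hr

/-- For a label outside the zones no leap matters, so its line can be continued at every vertex
other than w₀ and w₁. -/
theorem exists_walk_of_not_inZone (hζ : ∀ u, ζ u ≤ 1) {l : ℕ} (hl : l < base k e ζ k)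
    (hz : ∀ r < k, ¬ InZone k e ζ r l) :
    ∃ W : G.Walk, G.LevelWalk (C.height e) l (fun v => ∃ c, C.vtx v = .w c) W ∧
      C.vtx W.start = .w false ∧ C.vtx W.finish = .w true := by
  obtain ⟨r, hr, h1, h2⟩ := exists_first_row hl
  have hb : (D r 0).Valid k := ⟨hr, by positivity⟩
  obtain ⟨c, hc, h3, h4⟩ := exists_unit hζ hb h1 h2 fun r' h _ => hz r' (by omega)
  obtain ⟨d, hd, hx⟩ := C.exists_dart hb hc false
  have hsrc : C.vtx (G.src d) = .w false := by
    rw [C.src, hd, hx]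
    simp [bundleSrc, point]
  obtain ⟨W, hW, h5, -, d', -, h6, h7, c', h8⟩ := exists_levelWalk (G := G) (h := C.height e) (c := l)
    (T := fun v => ∃ c, C.vtx v = .w c) (fun d hd hT => by
      simp only [not_exists] at hT
      refine exists_used_arc hd (fun o ho => height_next hζ (by rwa [ho])) fun o ho h5 h6 => ?_
      rcases height_rev_eq h5 h6 with h | ⟨r, u, h, -, -, h'⟩
      · exact h
      · have := C.pos_valid o.1
        rw [h] at this
        exact (hz r this.1 h').elim) (used_of_unitHeight hd hx h3 h4) ⟨_, hsrc⟩
  refine ⟨W, hW, by rw [h5, hsrc], ?_⟩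
  cases c'
  · rw [← h7] at h8
    exact (dst_ne_w_false h6 h8).elim
  · exact h8

/-- The labels for row `r + 1` use only the bundles on one side of this row. -/
theorem row_of_used {d : Dart E} {l r : ℕ} (hr : r < k) (hl : InZone k e ζ r l)
    (h : Used (C.height e) l d) :
    ∃ u, (C.pos d.1).1 = D (r + 1) u ∧ d.2 = false ∧ ¬ Far e r u ∧ u < 2 ^ (r + 1) := by
  have h1 := C.pos_valid d.1
  obtain ⟨u, hu⟩ : ∃ u, (C.pos d.1).1 = D (r + 1) u := by
    refine eq_row_of_inZone (c := (C.pos d.1).2) h1 hr hl ?_ ?_ <;>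
      obtain ⟨a, _ | _⟩ := d <;> simp [Used, height, rev] at h <;> simp [h]
  have hp : C.pos d.1 = (D (r + 1) u, (C.pos d.1).2) := Prod.ext hu rfl
  rw [hu] at h1
  exact ⟨u, hu, direction_of_used hp h,
    not_far_of_used h1 hl (unitHeight_of_used hp (Or.inl h)).2, h1.2⟩

/-- A label of the zone is carried only by the near half of row r + 1. That half lies between z and
the terminal to which z is to be joined. -/
theorem exists_walk_of_inZone (hζ : ∀ u, ζ u ≤ 1) {l r : ℕ} (hr : r < k) (hl : InZone k e ζ r l) :
    ∃ W : G.Walk, G.LevelWalk (C.height e) l (fun v => ∃ c, C.vtx v = .w c) W ∧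
      (e r = false → C.vtx W.start = .w false ∧ C.vtx W.finish = .p (r + 1) (2 ^ r) (2 ^ r)) ∧
      (e r = true → C.vtx W.start = .p (r + 1) (2 ^ r) (2 ^ r) ∧ C.vtx W.finish = .w true) := by
  have hpos := Nat.one_le_two_pow (n := r)
  -- The middle vertex is a further place to stop, because the label has no edge in the far half.
  set T : V → Prop := fun v => (∃ c, C.vtx v = .w c) ∨ C.vtx v = .p (r + 1) (2 ^ r) (2 ^ r)
  obtain ⟨d, hd, hT, hsrc⟩ : ∃ d, Used (C.height e) l d ∧ T (G.src d) ∧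
      C.vtx (G.src d) = if e r then .p (r + 1) (2 ^ r) (2 ^ r) else .w false := by
    have hb : (D (r + 1) (if e r then 2 ^ r else 0)).Valid k :=
      ⟨hr, by split_ifs <;> rw [pow_succ] <;> omega⟩
    have hf : ¬ Far e r (if e r then 2 ^ r else 0) := by
      cases h : e r <;> simp [Far, h]
    have hl1 : zone k e ζ r ≤ l := hl.1
    have hl2 : l < zone k e ζ r + 2 ^ k := hl.2
    have hbot := zone_lt_botHeight (e := e) (ζ := ζ) (u := if e r then 2 ^ r else 0) hr
    obtain ⟨c, hc, h3, h4⟩ := exists_unit hζ hb ((topHeight_le_zone hr hb.2).trans hl1)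
      (hl2.trans hbot) (fun r' h => by
        obtain rfl : r = r' := by omega
        exact fun h' => (hf h').elim)
    obtain ⟨d, hd, hx⟩ := C.exists_dart hb hc false
    have hsrc : C.vtx (G.src d) = if e r then .p (r + 1) (2 ^ r) (2 ^ r) else .w false := by
      rw [C.src, hd, hx]
      cases h : e r
      · simp [bundleSrc, point]
      · simp [bundleSrc, point]
    refine ⟨d, used_of_unitHeight hd hx h3 h4, ?_, hsrc⟩
    cases h : e r
    · exact Or.inl ⟨_, by simpa [h] using hsrc⟩
    · exact Or.inr (by simpa [h] using hsrc)
  have hdst : ∀ d, Used (C.height e) l d → ∃ u, (C.pos d.1).1 = D (r + 1) u ∧ ¬ Far e r u ∧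
      u < 2 ^ (r + 1) ∧ C.vtx (G.dst d) = point (r + 1) (u + 1) (u + 1) := by
    intro d hd
    obtain ⟨u, hu, hx, hf, hlt⟩ := row_of_used hr hl hd
    refine ⟨u, hu, hf, hlt, ?_⟩
    rw [RotationSystem.dst, C.src]
    simp only [rev, hu, hx]
    rfl
  obtain ⟨W, hW, h5, -, d', -, h8, h9, h10⟩ := exists_levelWalk (G := G) (h := C.height e)
    (c := l) (T := T) (fun d hd hT => by
      simp only [T, not_or, not_exists] at hT
      obtain ⟨hT1, hT2⟩ := hT
      refine exists_used_arc hd (fun o ho => height_next hζ (by rwa [ho])) fun o ho h5 h6 => ?_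
      rcases height_rev_eq h5 h6 with h | ⟨r', u', h, hx, hf', h'⟩
      · exact h
      -- A leap would mean that a far bundle starts where a near one ends. The two halves meet only
      -- in the middle vertex, where the walk has already stopped.
      · have hv := C.pos_valid o.1
        rw [h] at hv
        obtain rfl := hl.eq h' hr hv.1
        obtain ⟨u, -, hf, hlt, hd'⟩ := hdst d hd
        have hs := C.src o
        rw [h, hx, ho, hd'] at hs
        rw [hd'] at hT1 hT2
        exfalso
        simp only [Far, bundleSrc, point] at *
        split_ifs at * with h1 h2 h3 h4
        all_goals try simp only [Point.w.injEq, Point.p.injEq, true_and, and_self, forall_eq',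
          not_false_iff] at *
        all_goals cases her : e r <;> simp [her] at hf hf' <;> omega) hd hT
  refine ⟨W, ⟨hW.used, hW.arc, fun a b hab h => hW.inner a b hab (Or.inl h)⟩, ?_, ?_⟩
  all_goals
    intro her
    rw [h5, hsrc, her]
    obtain ⟨u, -, hf, hlt, hd'⟩ := hdst d' h8
    rw [h9] at hd'
    simp only [T, hd'] at h10
    rw [pow_succ] at hlt
    simp only [her, Far] at hf
    simp only [hd', point_self, pow_succ] at h10 ⊢
  · have hu : u < 2 ^ r := by simpa using hf
    rw [if_neg Bool.false_ne_true]
    rw [if_neg (by omega), if_neg (by omega)] at h10 ⊢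
    simpa using h10
  · have hu : 2 ^ r ≤ u := by simpa using hf
    rw [if_pos trivial]
    rw [if_neg (by omega)] at h10 ⊢
    split_ifs at h10 ⊢
    · simp
    · simp at h10
      omega

end Coord

end VCG

/-! ### The walks of the flow and their concatenations -/

namespace VCG

open VCG.Bundle PlaneMultigraph

namespace RotationSystem

variable {V E : Type} {Γ : RotationSystem V E} {u v : V} {l : List (Dart E)}

theorem IsWalk.src_head (h : Γ.IsWalk u v l) {d : Dart E} (hd : l.head? = some d) :
    Γ.src d = u := by
  cases l with
  | nil => simp at hd
  | cons x l =>
    simp only [List.head?_cons, Option.some.injEq] at hd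
    subst hd
    exact h.1

theorem IsWalk.dst_getLast (h : Γ.IsWalk u v l) {d : Dart E} (hd : l.getLast? = some d) :
    Γ.dst d = v := by
  induction l generalizing u with
  | nil => simp at hd
  | cons x l ih =>
    cases l with
    | nil =>
      simp only [List.getLast?_singleton, Option.some.injEq] at hd
      subst hd
      exact h.2
    | cons y l => exact ih h.2 (by simpa [List.getLast?_cons_cons] using hd)

theorem IsWalk.src_eq_dst (h : Γ.IsWalk u v l) {a b : Dart E} (hab : [a, b] <:+: l) :
    Γ.src b = Γ.dst a := by
  induction l generalizing u with
  | nil => simp at hab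
  | cons x l ih =>
    rw [List.infix_cons_iff, List.cons_prefix_cons] at hab
    rcases hab with ⟨rfl, hab⟩ | hab
    · cases l with
      | nil => simp at hab
      | cons y l =>
        simp only [List.cons_prefix_cons, List.nil_prefix, and_true] at hab
        subst hab
        exact h.2.1
    · exact ih h.2 hab

end RotationSystem

namespace PlaneMultigraph

theorem head?_revDarts {E : Type} (l : List (Dart E)) : (revDarts l).head? = l.getLast?.map rev := by
  simp [revDarts, List.head?_reverse]

variable {V E : Type} [Finite V] [Finite E] {G : PlaneMultigraph V E}

/-- The walk traversed backwards. -/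
def Walk.reverse (W : G.Walk) : G.Walk := ⟨W.finish, W.start, revDarts W.darts, W.isWalk.reverse⟩

theorem CyclicOrder.src_eq {a b c d : Dart E} (h : G.CyclicOrder a b c d) : G.src b = G.src a := by
  obtain ⟨i, j, l, -, -, -, rfl, -⟩ := h
  exact ((G.src_eq_iff _ _).2 ⟨i, by simp⟩).symm

/-- If the rank increases along the rotation until `y` is reached, then the order is that of the
ranks. -/
theorem precedes_of_rank {y d d' : Dart E} (rank : Dart E → ℕ)
    (hrank : ∀ x, G.src x = G.src y → G.next x ≠ y → rank x < rank (G.next x))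
    (hd : G.src d = G.src y) (hd' : G.src d' = G.src y) (hlt : rank d < rank d') :
    G.Precedes y d d' := by
  have hp := Function.minimalPeriod_pos_of_mem_periodicPts
    (Function.Injective.mem_periodicPts G.next.injective y)
  set p := Function.minimalPeriod G.next y
  have hne : ∀ m, 0 < m → m < p → (G.next ^ m) y ≠ y := by
    intro m hm hmp h
    rw [← Equiv.Perm.iterate_eq_pow] at h
    have := Function.IsPeriodicPt.minimalPeriod_le hm h
    omega
  have hpow : ∀ x, G.src x = G.src y → ∃ i < p, (G.next ^ i) y = x := by
    intro x hx
    obtain ⟨i, hi⟩ := ((G.src_eq_iff _ _).1 hx.symm).exists_nat_pow_eq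
    refine ⟨i % p, Nat.mod_lt _ hp, ?_⟩
    rw [← hi, ← Equiv.Perm.iterate_eq_pow, ← Equiv.Perm.iterate_eq_pow,
      Function.iterate_mod_minimalPeriod_eq]
  have hsrc : ∀ i, G.src ((G.next ^ i) y) = G.src y := fun i =>
    ((G.src_eq_iff _ _).2 ⟨i, by simp⟩).symm
  have hmono : ∀ j < p, ∀ i ≤ j, rank ((G.next ^ i) y) ≤ rank ((G.next ^ j) y) := by
    intro j
    induction j with
    | zero => intro _ i hi; rw [Nat.le_zero.1 hi]
    | succ j ih =>
      intro hj i hi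
      rcases Nat.lt_or_ge i (j + 1) with h | h
      · refine (ih (by omega) i (by omega)).trans ?_
        have h1 := hrank ((G.next ^ j) y) (hsrc j) (by
          rw [← Equiv.Perm.mul_apply, ← pow_succ']; exact hne _ (by omega) hj)
        rw [← Equiv.Perm.mul_apply, ← pow_succ'] at h1
        exact h1.le
      · rw [show i = j + 1 by omega]
  obtain ⟨i, hi, rfl⟩ := hpow d hd
  obtain ⟨j, hj, rfl⟩ := hpow d' hd'
  refine ⟨i, j, ?_, rfl, rfl, fun m hm hmj => hne m hm (by omega)⟩
  by_contra h
  have := hmono i hi j (by omega)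
  omega

end PlaneMultigraph

namespace Coord

variable {k : ℕ} {ζ : ℕ → ℕ} {V E : Type} [Finite V] [Finite E] {G : PlaneMultigraph V E}
  (C : Coord k ζ G) (e : ℕ → Bool)

/-- The walk with label `l` as required by the flow. -/
structure FlowWalk (l : ℕ) (W : G.Walk) : Prop where
  follows : G.Follows (C.height e) l W.darts
  used : ∀ d ∈ W.darts, Used (C.height e) l d ∨ Used (C.height e) l (rev d)
  inner : ∀ a b, [a, b] <:+: W.darts → ∀ c, C.vtx (G.dst a) ≠ .w c
  free : (∀ r < k, ¬ InZone k e ζ r l) → C.vtx W.start = .w false ∧ C.vtx W.finish = .w true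
  zone : ∀ r < k, InZone k e ζ r l →
    C.vtx W.start = .w (e r) ∧ C.vtx W.finish = .p (r + 1) (2 ^ r) (2 ^ r) ∧
      ∀ d ∈ W.darts, d.2 = e r ∧ ∃ u < 2 ^ (r + 1), (C.pos d.1).1 = D (r + 1) u

variable {C e}

/-- Level lines run from left to right. If the bit is true, the line in the zone leads from z to w₁
and has to be reversed, since requests start at w₀ or w₁. -/
theorem exists_flowWalk (hζ : ∀ u, ζ u ≤ 1) {l : ℕ} (hl : l < base k e ζ k) :
    ∃ W, C.FlowWalk e l W := by
  by_cases hz : ∃ r < k, InZone k e ζ r l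
  · obtain ⟨r, hr, hlr⟩ := hz
    obtain ⟨W, hW, h0, h1⟩ := exists_walk_of_inZone (C := C) hζ hr hlr
    cases her : e r
    · refine ⟨W, hW.follows, fun d hd => Or.inl (hW.used d hd),
        fun a b hab c hc => hW.inner a b hab ⟨c, hc⟩, fun h => (h r hr hlr).elim, ?_⟩
      intro r' hr' hlr'
      obtain rfl := hlr.eq hlr' hr hr'
      refine ⟨her ▸ (h0 her).1, (h0 her).2, fun d hd => ?_⟩
      obtain ⟨u, hu, hx, -, hlt⟩ := row_of_used hr hlr (hW.used d hd)
      exact ⟨hx.trans her.symm, u, hlt, hu⟩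
    · refine ⟨W.reverse, hW.follows.reverse, fun d hd => ?_, fun a b hab c hc => ?_,
        fun h => (h r hr hlr).elim, ?_⟩
      · exact Or.inr (hW.used _ (mem_revDarts.1 hd))
      · refine hW.inner _ _ (infix_revDarts.1 hab) ⟨c, ?_⟩
        rw [← W.reverse.isWalk.src_eq_dst hab] at hc
        rw [RotationSystem.dst, rev_rev]
        exact hc
      · intro r' hr' hlr'
        obtain rfl := hlr.eq hlr' hr hr'
        refine ⟨her ▸ (h1 her).2, (h1 her).1, fun d hd => ?_⟩
        obtain ⟨u, hu, hx, -, hlt⟩ := row_of_used hr hlr (hW.used _ (mem_revDarts.1 hd))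
        refine ⟨?_, u, hlt, hu⟩
        rw [her]
        simpa [rev] using hx
  · push Not at hz
    obtain ⟨W, hW, h0, h1⟩ := exists_walk_of_not_inZone (C := C) hζ hl hz
    exact ⟨W, hW.follows, fun d hd => Or.inl (hW.used d hd),
        fun a b hab c hc => hW.inner a b hab ⟨c, hc⟩, fun _ => ⟨h0, h1⟩,
        fun r hr h => (hz r hr h).elim⟩

theorem FlowWalk.edgeDisjoint {l l' : ℕ} {W W' : G.Walk} (h : C.FlowWalk e l W)
    (h' : C.FlowWalk e l' W') (hl : l ≠ l') : EdgeDisjoint W.darts W'.darts := by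
  intro d hd d' hd'
  rcases h.used d hd with h1 | h1 <;> rcases h'.used d' hd' with h2 | h2 <;>
    (have h3 := h1.ne h2 hl; exact h3)

/-- The darts of a bundle are consecutive. -/
theorem pos_next_pow {x : Dart E} {b : Bundle} {c : ℕ} (hx : C.pos x.1 = (b, c)) (i : ℕ) :
    (x.2 = false → c + i < mult k ζ b →
      C.pos ((G.next ^ i) x).1 = (b, c + i) ∧ ((G.next ^ i) x).2 = false) ∧
    (x.2 = true → i ≤ c →
      C.pos ((G.next ^ i) x).1 = (b, c - i) ∧ ((G.next ^ i) x).2 = true) := by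
  induction i with
  | zero => exact ⟨fun h _ => ⟨hx, h⟩, fun h _ => ⟨hx, h⟩⟩
  | succ i ih =>
    rw [pow_succ', Equiv.Perm.mul_apply]
    have h1 := C.next ((G.next ^ i) x)
    constructor
    · intro h h2
      obtain ⟨h3, h4⟩ := ih.1 h (by omega)
      rw [h3, h4, unitNext, if_pos (by omega)] at h1
      simp only [Prod.mk.injEq] at h1
      exact h1
    · intro h h2
      obtain ⟨h3, h4⟩ := ih.2 h (by omega)
      rw [h3, h4, unitNext, if_pos (by omega)] at h1
      simp only [Prod.mk.injEq] at h1
      exact ⟨h1.1, h1.2⟩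

/-- The darts between two darts of a bundle belong to the bundle. -/
theorem between_of_cyclicOrder {x x' y y' : Dart E} {b : Bundle} {c c' : ℕ}
    (hx : C.pos x.1 = (b, c)) (hx' : C.pos x'.1 = (b, c')) (hxx : x.2 = x'.2)
    (h : G.CyclicOrder x y x' y') :
    ∃ c'', min c c' < c'' ∧ c'' < max c c' ∧ (C.pos y.1 = (b, c'') ∨ C.pos y'.1 = (b, c'')) := by
  -- If the clockwise arc from x to x' stays in the bundle, then y lies between them. Otherwise the
  -- arc from x' to x does, and this is applied to y'.
  have key : ∀ {x x' y y' : Dart E} {c c' : ℕ}, C.pos x.1 = (b, c) → C.pos x'.1 = (b, c') →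
      x.2 = x'.2 → G.CyclicOrder x y x' y' → (if x.2 then c' < c else c < c') →
      ∃ c'', min c c' < c'' ∧ c'' < max c c' ∧ C.pos y.1 = (b, c'') := by
    intro x x' y y' c c' hx hx' hxx h hlt
    obtain ⟨i, j, l, hi, hij, hjl, rfl, hj, -, hne⟩ := h
    have hm' := C.pos_lt x'.1
    rw [hx'] at hm'
    cases hb : x.2
    · simp only [hb, Bool.false_eq_true, if_false] at hlt
      have hpow := fun i => (pos_next_pow hx i).1 hb
      have hn : (G.next ^ (c' - c)) x = x' := by
        apply C.dart_ext
        obtain ⟨h1, h2⟩ := hpow (c' - c) (by simp only at hm'; omega)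
        rw [h1, h2, hx', ← hxx, hb]
        simp only [Prod.mk.injEq, true_and, and_true]
        omega
      have hjn : j = c' - c := by
        rcases Nat.lt_or_ge (c' - c) j with h1 | h1
        · exact pow_apply_unique hjl.le (by omega) hne (hj.trans hn.symm)
        · have h2 := (hpow j (by simp only at hm'; omega)).1
          rw [hj, hx'] at h2
          simp only [Prod.mk.injEq, true_and] at h2
          omega
      exact ⟨c + i, by omega, by omega, (hpow i (by simp only at hm'; omega)).1⟩
    · simp only [hb, if_true] at hlt
      have hpow := fun i => (pos_next_pow hx i).2 hb
      have hn : (G.next ^ (c - c')) x = x' := by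
        apply C.dart_ext
        obtain ⟨h1, h2⟩ := hpow (c - c') (by omega)
        rw [h1, h2, hx', ← hxx, hb]
        simp only [Prod.mk.injEq, true_and, and_true]
        omega
      have hjn : j = c - c' := by
        rcases Nat.lt_or_ge (c - c') j with h1 | h1
        · exact pow_apply_unique hjl.le (by omega) hne (hj.trans hn.symm)
        · have h2 := (hpow j (by omega)).1
          rw [hj, hx'] at h2
          simp only [Prod.mk.injEq, true_and] at h2
          omega
      exact ⟨c - i, by omega, by omega, (hpow i (by omega)).1⟩
  have hne : c ≠ c' := by
    rintro rfl
    have hxe : x = x' := C.dart_ext (by rw [hx, hx', hxx])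
    obtain ⟨i, j, l, hi, hij, hjl, -, hj, -, hne⟩ := h
    exact hne j (by omega) hjl.le (by rw [hj, hxe])
  by_cases hlt : if x.2 then c' < c else c < c'
  · obtain ⟨c'', h1, h2, h3⟩ := key hx hx' hxx h hlt
    exact ⟨c'', h1, h2, Or.inl h3⟩
  · obtain ⟨c'', h1, h2, h3⟩ := key hx' hx hxx.symm h.rotate.rotate (by
      rw [← hxx]
      split_ifs at hlt ⊢ <;> omega)
    exact ⟨c'', by omega, by omega, Or.inr h3⟩

/-- Two walks for the same row can be joined at the end of the first one without crossing a walk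
with another label. -/
theorem FlowWalk.unseparated {r l l' m : ℕ} (hr : r < k) {W W' M : G.Walk} (hW : C.FlowWalk e l W)
    (hW' : C.FlowWalk e l' W') (hM : C.FlowWalk e m M) (hl : InZone k e ζ r l)
    (hl' : InZone k e ζ r l') (hm : ¬ InZone k e ζ r m) {d d' : Dart E}
    (hd : W.darts.getLast? = some d) (hd' : W'.darts.getLast? = some d') {a a' : Dart E}
    (ha : [a, a'] <:+: M.darts) : G.Unseparated (rev d) (rev d') (rev a) a' := by
  -- All walks of the zone arrive at the middle vertex through the same bundle: the last one of the
  -- left half or the first one of the right half.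
  have hlast : ∀ {l W d}, C.FlowWalk e l W → InZone k e ζ r l → W.darts.getLast? = some d →
      d.2 = e r ∧ (C.pos d.1).1 = D (r + 1) (if e r then 2 ^ r else 2 ^ r - 1) ∧
        Used (C.height e) l d ∨ d.2 = e r ∧
        (C.pos d.1).1 = D (r + 1) (if e r then 2 ^ r else 2 ^ r - 1) ∧
        Used (C.height e) l (rev d) := by
    intro l W d hW hl hd
    obtain ⟨-, h1, h2⟩ := hW.zone r hr hl
    have hmem := List.mem_of_getLast? hd
    obtain ⟨h3, u, hu, h4⟩ := h2 d hmem
    have h5 := C.src (rev d)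
    change C.vtx (G.dst d) = _ at h5
    rw [W.isWalk.dst_getLast hd, h1] at h5
    simp only [rev, h3, h4] at h5
    have h6 : u = if e r then 2 ^ r else 2 ^ r - 1 := by
      have := Nat.one_le_two_pow (n := r)
      cases her : e r <;> simp only [her, Bool.not_false, Bool.not_true, bundleSrc, point_self] at h5
        <;> split_ifs at h5 <;> simp at h5 ⊢ <;> omega
    rw [← h6]
    rcases hW.used d hmem with h7 | h7
    · exact Or.inl ⟨h3, h4, h7⟩
    · exact Or.inr ⟨h3, h4, h7⟩
  have h1 := hlast hW hl hd
  have h2 := hlast hW' hl' hd'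
  generalize (if e r then 2 ^ r else 2 ^ r - 1) = u at h1 h2
  obtain ⟨hx, hb, hu⟩ : d.2 = e r ∧ (C.pos d.1).1 = D (r + 1) u ∧
    (Used (C.height e) l d ∨ Used (C.height e) l (rev d)) := by tauto
  obtain ⟨hx', hb', hu'⟩ : d'.2 = e r ∧ (C.pos d'.1).1 = D (r + 1) u ∧
    (Used (C.height e) l' d' ∨ Used (C.height e) l' (rev d')) := by tauto
  have hp : C.pos d.1 = (D (r + 1) u, (C.pos d.1).2) := Prod.ext hb rfl
  have hp' : C.pos d'.1 = (D (r + 1) u, (C.pos d'.1).2) := Prod.ext hb' rfl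
  have hv := C.pos_valid d.1
  rw [hb] at hv
  have hmem : a ∈ M.darts ∧ a' ∈ M.darts :=
    ⟨ha.subset (by simp), ha.subset (by simp)⟩
  have k1 := unitHeight_of_used hp hu
  have k2 := unitHeight_of_used hp' hu'
  -- Heights are monotone within the bundle, so an edge between two edges with labels of the zone
  -- can only carry a label between these two. The zone is an interval and contains it.
  have main : ∀ {y : Dart E} {c : ℕ}, y ∈ M.darts → C.pos y.1 = (D (r + 1) u, c) →
      min (C.pos d.1).2 (C.pos d'.1).2 < c → c < max (C.pos d.1).2 (C.pos d'.1).2 → False := by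
    intro y c hy hyc h3 h4
    have k3 := unitHeight_of_used hyc (hM.used y hy)
    simp only [InZone] at hl hl' hm
    rcases Nat.lt_or_ge (C.pos d.1).2 (C.pos d'.1).2 with h5 | h5
    · have := unitHeight_mono (e := e) (ζ := ζ) hv (show (C.pos d.1).2 + 1 ≤ c by omega)
      have := unitHeight_mono (e := e) (ζ := ζ) hv (show c + 1 ≤ (C.pos d'.1).2 by omega)
      omega
    · have := unitHeight_mono (e := e) (ζ := ζ) hv (show (C.pos d'.1).2 + 1 ≤ c by omega)
      have := unitHeight_mono (e := e) (ζ := ζ) hv (show c + 1 ≤ (C.pos d.1).2 by omega)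
      omega
  have hrev : (rev d).2 = (rev d').2 := by simp [rev, hx, hx']
  constructor
  · intro h
    obtain ⟨c, h3, h4, h5 | h5⟩ := between_of_cyclicOrder (C := C) (x := rev d) (x' := rev d')
      hp hp' hrev h
    · exact main hmem.1 h5 h3 h4
    · exact main hmem.2 h5 h3 h4
  · intro h
    obtain ⟨c, h3, h4, h5 | h5⟩ := between_of_cyclicOrder (C := C) (x := rev d) (x' := rev d')
      hp hp' hrev h
    · exact main hmem.2 h5 h3 h4
    · exact main hmem.1 h5 h3 h4

/-- Two of the four concatenations do not exist, as the walks lead from w₀ or w₁ to the middle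
vertex. At the middle vertex `FlowWalk.unseparated` applies. At w₀ or w₁ nothing can cross, because
no walk passes through these vertices. -/
theorem FlowWalk.nonCrossing_concat {r l l' m : ℕ} (hr : r < k) {W W' M : G.Walk}
    (hW : C.FlowWalk e l W) (hW' : C.FlowWalk e l' W') (hM : C.FlowWalk e m M)
    (hl : InZone k e ζ r l) (hl' : InZone k e ζ r l') (hm : ¬ InZone k e ζ r m)
    {L : List (Dart E)} (hL : G.IsConcat W W' L) : G.NonCrossing L M.darts := by
  obtain ⟨h1, h2, -⟩ := hW.zone r hr hl
  obtain ⟨h1', h2', -⟩ := hW'.zone r hr hl'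
  intro a b a' b' hab hab'
  rcases hL with ⟨h, -⟩ | ⟨-, rfl⟩ | ⟨-, rfl⟩ | ⟨h, -⟩
  · rw [h, h1'] at h2
    simp at h2
  · rcases infix_pair_append hab with h | h | ⟨h3, h4⟩
    · exact hW.follows.nonCrossing hM.follows a b a' b' h hab'
    · exact hW'.follows.reverse.nonCrossing hM.follows a b a' b' h hab'
    · rw [head?_revDarts, Option.map_eq_some_iff] at h4
      obtain ⟨d', h5, rfl⟩ := h4
      exact (hW.unseparated hr hW' hM hl hl' hm h3 h5 hab').not_cross
  · rcases infix_pair_append hab with h | h | ⟨h3, h4⟩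
    · exact hW.follows.reverse.nonCrossing hM.follows a b a' b' h hab'
    · exact hW'.follows.nonCrossing hM.follows a b a' b' h hab'
    · have h5 := W'.isWalk.src_head h4
      have h6 : G.src b ≠ G.dst a' := by
        intro h
        rw [← h5, h] at h1'
        exact hM.inner a' b' hab' _ h1'
      rintro (h | h)
      · have h7 := h.src_eq
        have h8 := h.rotate.src_eq
        exact h6 (h8.trans rfl)
      · have h7 := h.rotate.src_eq
        exact h6 h7.symm
  · rw [h, h2'] at h1
    simp at h1

end Coord

end VCG

namespace VCG

open VCG.Bundle PlaneMultigraph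

/-! ### Bit vectors -/

/-- The bit of level `r`. -/
def bit {k : ℕ} (b : BitVector k) (r : ℕ) : Bool :=
  if h : r < k then b (Fin.rev ⟨r, h⟩) else false

theorem bit_val {k : ℕ} (b : BitVector k) (r : Fin k) : bit b r = b r.rev := by
  simp [bit]

theorem bit_sub {k : ℕ} (b : BitVector k) (i : Fin k) : bit b (k - 1 - i) = b i := by
  rw [show k - 1 - (i : ℕ) = (i.rev : ℕ) by rw [Fin.val_rev]; omega, bit_val, Fin.rev_rev]

/-- The characteristic function of the values of the elements of `Z`. -/
noncomputable def charFun {k : ℕ} (Z : Finset (BitVector k)) (u : ℕ) : ℕ :=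
  open Classical in if ∃ b ∈ Z, value b = u then 1 else 0

theorem charFun_le_one {k : ℕ} (Z : Finset (BitVector k)) (u : ℕ) : charFun Z u ≤ 1 := by
  unfold charFun
  split_ifs <;> omega

theorem idx_eq_sum (e : ℕ → Bool) (r : ℕ) :
    idx e r = ∑ j ∈ Finset.range r, if e j then 2 ^ j else 0 := by
  induction r with
  | zero => rfl
  | succ r ih => rw [Finset.sum_range_succ, idx, ih]

/-- The complementary bits represent 2^r - 1 - `idx e r`, the number of thin bundles in the cut if e
r is true. -/
theorem idx_add_sum (e : ℕ → Bool) (r : ℕ) :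
    idx e r + (∑ j ∈ Finset.range r, if e j then 0 else 2 ^ j) + 1 = 2 ^ r := by
  induction r with
  | zero => rfl
  | succ r ih =>
    rw [Finset.sum_range_succ, idx, pow_succ]
    split_ifs <;> omega

theorem bit_eq_of_idx_eq {e e' : ℕ → Bool} {k : ℕ} (h : idx e k = idx e' k) : ∀ r < k, e r = e' r := by
  induction k with
  | zero => omega
  | succ k ih =>
    have h1 := idx_lt e k
    have h2 := idx_lt e' k
    simp only [idx] at h
    have h3 : e k = e' k := by
      cases he : e k <;> cases he' : e' k <;> simp [he, he'] at h ⊢ <;> omega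
    rw [h3] at h
    intro r hr
    rcases Nat.lt_or_ge r k with hr' | hr'
    · exact ih (by omega) r hr'
    · rwa [show r = k by omega]

theorem value_eq_idx {k : ℕ} (b : BitVector k) : value b = idx (bit b) k := by
  rw [idx_eq_sum, Finset.sum_range, value]
  refine Fintype.sum_equiv Fin.revPerm _ _ fun i => ?_
  rw [Fin.revPerm_apply, bit_val, Fin.rev_rev, Fin.val_rev, Nat.sub_sub, add_comm]

theorem value_injective (k : ℕ) : Function.Injective (value (k := k)) := by
  intro b b' h
  rw [value_eq_idx, value_eq_idx] at h
  ext i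
  rw [← bit_sub b i, ← bit_sub b' i, bit_eq_of_idx_eq h _ (by omega)]

theorem charFun_idx {k : ℕ} (Z : Finset (BitVector k)) (b : BitVector k) :
    charFun Z (idx (bit b) k) = if b ∈ Z then 1 else 0 := by
  unfold charFun
  congr 1
  rw [← value_eq_idx]
  simp [(value_injective k).eq_iff]

/-- If e r is false, `idx e r` adds the weights of the lower bits that are true; if it is true, the
complement adds those of the bits that are false. Either way these are the bits different from e r.
-/
theorem shift_eq_sum (k : ℕ) (e : ℕ → Bool) (r : ℕ) :
    shift k e r = ∑ j ∈ Finset.range r, if e j ≠ e r then 2 ^ (k - 1 - r + j) else 0 := by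
  have h1 := idx_eq_sum e r
  have h2 := idx_add_sum e r
  rw [shift, thin]
  cases h : e r
  · rw [if_neg Bool.false_ne_true, h1, Finset.mul_sum]
    refine Finset.sum_congr rfl fun j _ => ?_
    cases e j <;> simp [pow_add]
  · rw [if_pos rfl, show 2 ^ r - 1 - idx e r = ∑ j ∈ Finset.range r, if e j then 0 else 2 ^ j by omega,
      Finset.mul_sum]
    refine Finset.sum_congr rfl fun j _ => ?_
    cases e j <;> simp [pow_add]

/-- Levels reverse the order of the coordinates, so j < i means that i has the lower level. Grouping
the pairs by j leaves the shift at the level of j. -/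
theorem gamma_eq_sum {k : ℕ} (b : BitVector k) :
    gamma k b = ∑ r ∈ Finset.range k, shift k (bit b) r := by
  rw [gamma, Finset.sum_comm, Finset.sum_range]
  refine Fintype.sum_equiv Fin.revPerm _ _ fun j => ?_
  have h1 : ∀ y : Fin k, (y.rev : ℕ) = k - 1 - y := fun y => by rw [Fin.val_rev]; omega
  calc (∑ x : Fin k, if j < x ∧ b x ≠ b j then 2 ^ (k - (x : ℕ) + (j : ℕ) - 1) else 0)
      = ∑ y : Fin k, if (y : ℕ) < j.rev ∧ bit b y ≠ bit b j.rev then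
          2 ^ (k - 1 - j.rev + (y : ℕ)) else 0 := by
        refine Fintype.sum_equiv Fin.revPerm _ _ fun x => ?_
        rw [Fin.revPerm_apply, bit_val, bit_val, Fin.rev_rev, Fin.rev_rev, h1, h1]
        have h2 : j < x ↔ k - 1 - (x : ℕ) < k - 1 - j := by rw [Fin.lt_def]; omega
        have h3 : k - (x : ℕ) + j - 1 = k - 1 - (k - 1 - j) + (k - 1 - x) := by omega
        rw [h3]
        simp only [h2]
    _ = ∑ y ∈ Finset.range k, if y < (j.rev : ℕ) ∧ bit b y ≠ bit b j.rev then
          2 ^ (k - 1 - j.rev + y) else 0 := (Finset.sum_range (n := k) fun y =>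
            if y < (j.rev : ℕ) ∧ bit b y ≠ bit b j.rev then 2 ^ (k - 1 - j.rev + y) else 0).symm
    _ = shift k (bit b) j.rev := by
        rw [shift_eq_sum]
        symm
        refine (Finset.sum_congr rfl fun y hy => ?_).trans
          (Finset.sum_subset (Finset.range_subset_range.2 j.rev.2.le) fun y _ hy => ?_)
        · simp only [Finset.mem_range.1 hy, true_and]
        · rw [Finset.mem_range] at hy
          exact if_neg fun h => hy h.1

theorem base_eq (k : ℕ) (e : ℕ → Bool) (ζ : ℕ → ℕ) {r : ℕ} (hr : r ≤ k) :
    base k e ζ r = 1 + r * 2 ^ (k + 1) + (∑ i ∈ Finset.range r, shift k e i) +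
      if r = k then ζ (idx e r) else 0 := by
  induction r with
  | zero => simp [base, idx]
  | succ r ih =>
    rw [base, ih (by omega), if_neg (show r ≠ k by omega), Finset.sum_range_succ]
    ring

/-- Half of the k 2^(k+1) is consumed by the requests for the z_i; the other half is the summand k
2^k of `gammaHat`. -/
theorem base_bit {k : ℕ} (Z : Finset (BitVector k)) (b : BitVector k) :
    base k (bit b) (charFun Z) k = k * 2 ^ k + (gammaHat k b + if b ∈ Z then 1 else 0) := by
  rw [base_eq k _ _ le_rfl, if_pos rfl, charFun_idx, gammaHat, gamma_eq_sum, pow_succ]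
  ring

/-! ### The order of the walks at `w₀` and `w₁` -/

/-- The darts at `w₀`, and those at `w₁`, are ordered clockwise by this number. -/
def rowRank (k : ℕ) (ζ : ℕ → ℕ) : UnitDart → ℕ
  | ((D r _, c), false) => r * (2 ^ (k + 1) + 2) + c
  | ((D r u, c), true) => (k - r) * (2 ^ (k + 1) + 2) + (mult k ζ (D r u) - 1 - c)
  | _ => 0

/-- With this bound as the weight of a row, `rowRank` is a lexicographic order: first by row, then
by the number in the bundle. -/
theorem mult_row_lt {k : ℕ} {ζ : ℕ → ℕ} (hζ : ∀ u, ζ u ≤ 1) (r u : ℕ) :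
    mult k ζ (D r u) < 2 ^ (k + 1) + 2 := by
  have := hζ u
  have := Nat.one_le_two_pow (n := k + 1)
  simp only [mult]
  split_ifs <;> omega

namespace Coord

variable {k : ℕ} {ζ : ℕ → ℕ} {V E : Type} [Finite V] [Finite E] {G : PlaneMultigraph V E}
  (C : Coord k ζ G)

/-- Clockwise, the rows appear downwards at w₀ and upwards at w₁. The rank falls only at the passage
through the outer face, that is, at the step to `y`. -/
theorem rowRank_next (hζ : ∀ u, ζ u ≤ 1) {x y : Dart E} {c : Bool} (hx : C.vtx (G.src x) = .w c)
    (hy : (C.pos y.1, y.2) = if c then unitFirst k ζ (D k (2 ^ k - 1), true) else ((D 0 0, 0), false))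
    (hne : G.next x ≠ y) :
    rowRank k ζ (C.pos x.1, x.2) < rowRank k ζ (C.pos (G.next x).1, (G.next x).2) := by
  rw [C.src] at hx
  have hn := C.next x
  have hv := C.pos_valid x.1
  have hlt := C.pos_lt x.1
  obtain ⟨r, hr, h⟩ := bundleSrc_eq_w hv hx
  have hne' : (C.pos (G.next x).1, (G.next x).2) ≠ (C.pos y.1, y.2) := fun h => hne (C.dart_ext h)
  rw [hn] at hne' ⊢
  rw [hy] at hne'
  generalize C.pos x.1 = p at *
  obtain ⟨b, i⟩ := p
  have hm := mult_row_lt (k := k) hζ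
  cases c
  · simp only [Bool.false_eq_true, if_false, Prod.mk.injEq] at h
    obtain ⟨rfl, hx2⟩ := h
    rw [hx2] at hne' ⊢
    simp only [Bool.false_eq_true, if_false] at hne'
    simp only [unitNext] at hne' ⊢
    have h0 := hm r 0
    simp only at hlt
    split_ifs at hne' ⊢ with h1
    · simp only [rowRank]
      omega
    · simp only [bundleNext, if_true] at hne' ⊢
      split_ifs at hne' ⊢ with h2
      · simp only [unitFirst, rowRank, add_mul]
        omega
      · simp [unitFirst] at hne'
  · simp only [if_true, Prod.mk.injEq] at h
    obtain ⟨rfl, hx2⟩ := h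
    rw [hx2] at hne' ⊢
    simp only [unitNext] at hne' ⊢
    simp only at hlt
    split_ifs at hne' ⊢ with h1
    · simp only [rowRank]
      omega
    · rcases r with _ | r
      · simp [bundleNext] at hne'
      · have h0 := hm (r + 1) (2 ^ (r + 1) - 1)
        have := Nat.one_le_two_pow (n := r + 1)
        simp only [bundleNext, Nat.sub_add_cancel this, if_true]
        simp only [unitFirst, rowRank]
        rw [show k - r = k - (r + 1) + 1 by omega, add_mul]
        omega

variable {C} {e : ℕ → Bool}

theorem FlowWalk.joinsVia {l r : ℕ} {W : G.Walk} (hW : C.FlowWalk e l W) {v u : V}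
    (hu : C.vtx u = .p (r + 1) (2 ^ r) (2 ^ r)) {d : Dart E} (hd : G.JoinsVia W v u d) :
    G.src d = v ∧ ∃ u', (C.pos d.1).1 = D (r + 1) u' := by
  have hstart : ∃ c, C.vtx W.start = .w c := by
    by_cases hz : ∃ r < k, InZone k e ζ r l
    · obtain ⟨r, hr, hl⟩ := hz
      exact ⟨_, (hW.zone r hr hl).1⟩
    · push Not at hz
      exact ⟨_, (hW.free hz).1⟩
  obtain ⟨c', hc'⟩ := hstart
  rcases hd with ⟨h1, h2, h3⟩ | ⟨-, h2, -⟩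
  · refine ⟨(W.isWalk.src_head h3).trans h1, ?_⟩
    rw [← h2] at hu
    by_cases hz : ∃ r < k, InZone k e ζ r l
    · obtain ⟨r', hr', hl⟩ := hz
      obtain ⟨-, h4, h5⟩ := hW.zone r' hr' hl
      rw [hu] at h4
      simp only [Point.p.injEq, Nat.add_right_cancel_iff] at h4
      obtain ⟨rfl, -⟩ := h4
      obtain ⟨-, u', -, h6⟩ := h5 d (List.mem_of_head? h3)
      exact ⟨u', h6⟩
    · push Not at hz
      have := (hW.free hz).2
      rw [hu] at this
      simp at this
  · rw [← h2, hc'] at hu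
    simp at hu

theorem exists_outer (c : Bool) : ∃ y : Dart E, C.vtx (G.src y) = .w c ∧ G.OnOuter y ∧
    (C.pos y.1, y.2) = if c then unitFirst k ζ (D k (2 ^ k - 1), true) else ((D 0 0, 0), false) := by
  have hpos := Nat.one_le_two_pow (n := k)
  cases c
  · obtain ⟨y, h1, h2⟩ := C.exists_dart (b := D 0 0) ⟨Nat.zero_le _, by simp⟩ (mult_pos k ζ _) false
    refine ⟨y, ?_, (C.onOuter y).2 (Or.inl (by rw [h1, h2])), by rw [h1, h2]; rfl⟩
    rw [C.src, h1, h2]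
    simp [bundleSrc, point]
  · have hm := mult_pos k ζ (D k (2 ^ k - 1))
    obtain ⟨y, h1, h2⟩ := C.exists_dart (b := D k (2 ^ k - 1)) (c := mult k ζ (D k (2 ^ k - 1)) - 1)
      ⟨le_rfl, by omega⟩ (by omega) true
    refine ⟨y, ?_, (C.onOuter y).2 (Or.inr ⟨2 ^ k - 1, by omega, by rw [h1, h2]; rfl⟩),
      by rw [h1, h2]; rfl⟩
    rw [C.src, h1, h2]
    simp only [bundleSrc, Nat.sub_add_cancel hpos, point_self]
    rw [if_neg (by omega), if_pos trivial]

/-- The boundary consists of the top edge of row 0 and the bottom edges of row k. For k = 0 these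
may be one and the same edge. -/
theorem outerSimpleCycle (C : Coord k ζ G) (hk : 0 < k) : G.OuterSimpleCycle := by
  have hm : ∀ u, unitFirst k ζ (D k u, true) = ((D k u, mult k ζ (D k u) - 1), true) := fun _ => rfl
  constructor
  · intro d d' hd hd' h
    apply C.dart_ext
    replace h := congrArg C.vtx h
    rw [C.src, C.src] at h
    rcases (C.onOuter d).1 hd with h1 | ⟨u, hu, h1⟩ <;>
      rcases (C.onOuter d').1 hd' with h2 | ⟨u', hu', h2⟩ <;> rw [h1, h2] <;>
      simp only [hm, Prod.mk.injEq] at h1 h2 <;>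
      simp only [h1, h2, bundleSrc, point_self] at h
    · exfalso
      split_ifs at h <;> simp at h <;> omega
    · exfalso
      split_ifs at h <;> simp at h <;> omega
    · have : u = u' := by split_ifs at h <;> simp at h <;> first | contradiction | omega
      rw [this]
  · intro d hd hd'
    rcases (C.onOuter d).1 hd with h1 | ⟨u, hu, h1⟩ <;>
      rcases (C.onOuter _).1 hd' with h2 | ⟨u', hu', h2⟩ <;>
      simp only [hm, Prod.mk.injEq, rev] at h1 h2 <;> rw [h1.1, h1.2] at h2 <;> simp at h2
    · omega
    · omega

end Coord

end VCG

/-! ### Assembly of the non-crossing flow -/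

namespace VCG

open VCG.Bundle PlaneMultigraph

namespace Coord

variable {k : ℕ} {ζ : ℕ → ℕ} {V E : Type} [Finite V] [Finite E] {G : PlaneMultigraph V E}
  {C : Coord k ζ G} {e : ℕ → Bool}

instance (r l : ℕ) : Decidable (InZone k e ζ r l) := inferInstanceAs (Decidable (_ ∧ _))

theorem card_filter_inZone {r : ℕ} (hr : r < k) :
    (Finset.univ.filter fun l : Fin (base k e ζ k) => InZone k e ζ r l).card = 2 ^ k := by
  have h1 := zone_add_le_zone (e := e) (ζ := ζ) hr le_rfl
  rw [← Finset.card_map Fin.valEmbedding]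
  have : (Finset.univ.filter fun l : Fin (base k e ζ k) => InZone k e ζ r l).map Fin.valEmbedding =
      Finset.Ico (zone k e ζ r) (zone k e ζ r + 2 ^ k) := by
    ext l
    simp only [Finset.mem_map, Finset.mem_filter, Finset.mem_univ, true_and, Fin.valEmbedding_apply,
      Finset.mem_Ico]
    constructor
    · rintro ⟨l, hl, rfl⟩
      exact hl
    · intro hl
      exact ⟨⟨l, by omega⟩, hl, rfl⟩
  rw [this, Nat.card_Ico, Nat.add_sub_cancel_left]

/-- The k zones contain at most k 2^k labels, so at least d labels remain for walks from w₀ to w₁.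
-/
theorem exists_free_labels {d : ℕ} (hd : k * 2 ^ k + d ≤ base k e ζ k) :
    ∃ f : Fin d ↪ Fin (base k e ζ k), ∀ j, ∀ r < k, ¬ InZone k e ζ r (f j) := by
  classical
  set N := Finset.univ.filter fun l : Fin (base k e ζ k) => ∀ r < k, ¬ InZone k e ζ r l
  have h1 : Finset.univ ⊆ N ∪ (Finset.range k).biUnion fun r =>
      Finset.univ.filter fun l : Fin (base k e ζ k) => InZone k e ζ r l := by
    intro l _
    by_cases hl : ∀ r < k, ¬ InZone k e ζ r l
    · exact Finset.mem_union_left _ (by simpa [N] using hl)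
    · push Not at hl
      exact Finset.mem_union_right _ (by simpa using hl)
  have h2 := (Finset.card_le_card h1).trans (Finset.card_union_le _ _)
  have h3 := Finset.card_biUnion_le_card_mul (Finset.range k) (fun r =>
      Finset.univ.filter fun l : Fin (base k e ζ k) => InZone k e ζ r l) (2 ^ k)
      fun r hr => (card_filter_inZone (Finset.mem_range.1 hr)).le
  rw [Finset.card_range] at h3
  rw [Finset.card_univ, Fintype.card_fin] at h2
  refine ⟨(N.orderEmbOfCardLe (k := d) (by omega)).toEmbedding, fun j => ?_⟩
  have := N.orderEmbOfCardLe_mem (k := d) (by omega) j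
  exact (Finset.mem_filter.1 this).2

/-- The walks to z_i leave through row k - i. So the downward order of rows at w₀ is decreasing in
i, and the upward order at w₁ is increasing. -/
theorem sees_of_flowWalk (hζ : ∀ u, ζ u ≤ 1) {ι : Type} {P : ι → G.Walk} {label : ι → ℕ}
    (hP : ∀ i, C.FlowWalk e (label i) (P i)) {z : Fin k → V} {v : V} {c : Bool}
    (hz : ∀ i, C.vtx (z i) = .p (k - 1 - i + 1) (2 ^ (k - 1 - i : ℕ)) (2 ^ (k - 1 - i : ℕ)))
    (hv : C.vtx v = .w c) {us : List (Fin k)}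
    (hus : us.Pairwise fun i j => if c then i < j else j < i) : G.Sees P v (us.map z) := by
  obtain ⟨y, h1, h2, h3⟩ := exists_outer (C := C) c
  have hy : G.src y = v := C.vtx_injective (h1.trans hv.symm)
  refine ⟨?_, y, hy, h2, ?_⟩
  · rw [List.mem_map]
    rintro ⟨i, -, h⟩
    have := hz i
    rw [h, hv] at this
    simp at this
  · rw [List.pairwise_map]
    refine hus.imp fun {i j} hij a a' d d' hd hd' => ?_
    obtain ⟨h4, u, h5⟩ := (hP a).joinsVia (hz i) hd
    obtain ⟨h6, u', h7⟩ := (hP a').joinsVia (hz j) hd'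
    refine precedes_of_rank (fun x => rowRank k ζ (C.pos x.1, x.2)) (fun x hx hne =>
      C.rowRank_next hζ (by rw [hx, h1]) h3 hne) (h4.trans hy.symm) (h6.trans hy.symm) ?_
    have hpos : ∀ {d : Dart E} {r u : ℕ}, G.src d = v → (C.pos d.1).1 = D r u →
        C.pos d.1 = (D r u, (C.pos d.1).2) ∧ d.2 = c ∧ (C.pos d.1).2 < mult k ζ (D r u) ∧ r ≤ k := by
      intro d r u hd hu
      have h8 := C.src d
      rw [hd, hv] at h8
      have hlt := C.pos_lt d.1
      have hval := C.pos_valid d.1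
      obtain ⟨r', -, h9⟩ := bundleSrc_eq_w hval h8.symm
      rw [hu] at hlt hval
      refine ⟨Prod.ext hu rfl, ?_, hlt, hval.1⟩
      cases c <;> simp at h9 <;> exact h9.2
    obtain ⟨p1, p2, p3, -⟩ := hpos h4 h5
    obtain ⟨q1, q2, q3, -⟩ := hpos h6 h7
    have hi := i.2
    have hj := j.2
    rw [p1, q1, p2, q2]
    have m1 := mult_row_lt (k := k) hζ (k - 1 - i + 1) u
    have m2 := mult_row_lt (k := k) hζ (k - 1 - j + 1) u'
    cases c
    · simp only [Bool.false_eq_true, if_false, Fin.lt_def] at hij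
      simp only [rowRank]
      have : (k - 1 - (i : ℕ) + 1 + 1) * (2 ^ (k + 1) + 2) ≤
        (k - 1 - (j : ℕ) + 1) * (2 ^ (k + 1) + 2) := Nat.mul_le_mul_right _ (by omega)
      rw [add_mul _ 1] at this
      omega
    · simp only [if_true, Fin.lt_def] at hij
      simp only [rowRank]
      have : (k - (k - 1 - (i : ℕ) + 1) + 1) * (2 ^ (k + 1) + 2) ≤
        (k - (k - 1 - (j : ℕ) + 1)) * (2 ^ (k + 1) + 2) := Nat.mul_le_mul_right _ (by omega)
      rw [add_mul _ 1] at this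
      omega

/-- The flow that follows the level lines of the heights. -/
theorem exists_nonCrossingFlow (C : Coord k ζ G) (hζ : ∀ u, ζ u ≤ 1) {b : BitVector k} {d : ℕ}
    (hd : k * 2 ^ k + d ≤ base k (bit b) ζ k) {z : Fin k → V} {w : Bool → V}
    (hz : ∀ i, C.vtx (z i) = .p (k - 1 - i + 1) (2 ^ (k - 1 - i : ℕ)) (2 ^ (k - 1 - i : ℕ)))
    (hw : ∀ c, C.vtx (w c) = .w c) :
    ∃ (n : ℕ) (P : Fin n → G.Walk) (S : Fin k ⊕ Fin d → Finset (Fin n)),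
      G.IsFlow (gadgetRequests z w b d) P S ∧ G.IsNonCrossingFlow P S ∧
      G.Sees P (w false) (((List.finRange k).filter fun i => b i = false).reverse.map z) ∧
      G.Sees P (w true) (((List.finRange k).filter fun i => b i = true).map z) := by
  obtain ⟨f, hf⟩ := exists_free_labels hd
  choose P hP using fun l : Fin (base k (bit b) ζ k) => exists_flowWalk (C := C) hζ l.2
  have hlt : ∀ i : Fin k, k - 1 - (i : ℕ) < k := fun i => by omega
  let S : Fin k ⊕ Fin d → Finset (Fin (base k (bit b) ζ k)) := Sum.elim
    (fun i => Finset.univ.filter fun l : Fin (base k (bit b) ζ k) => InZone k (bit b) ζ (k - 1 - i) l)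
    fun j => {f j}
  have hS : ∀ i l, l ∈ S (Sum.inl i) ↔ InZone k (bit b) ζ (k - 1 - i) l := by
    intro i l
    simp [S]
  have hS' : ∀ j l, l ∈ S (Sum.inr j) ↔ l = f j := by
    intro j l
    simp [S]
  -- The family has a walk for every label; labels that serve no request remain as walks outside all
  -- `S r`.
  refine ⟨_, P, S, ⟨?_, ?_, ?_, ?_, ?_⟩, ⟨?_, ?_⟩, ?_, ?_⟩
  · exact fun i j hij => (hP i).edgeDisjoint (hP j) (by rwa [ne_eq, Fin.val_inj])
  · rintro (i | j)
    · exact card_filter_inZone (hlt i)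
    · exact Finset.card_singleton _
  · rintro (i | j) l hl
    · apply C.vtx_injective
      rw [((hP l).zone _ (hlt i) ((hS i l).1 hl)).1, bit_sub]
      exact (hw _).symm
    · rw [hS'] at hl
      apply C.vtx_injective
      rw [((hP l).free (hl ▸ hf j)).1]
      exact (hw _).symm
  · rintro (i | j) l hl
    · apply C.vtx_injective
      rw [((hP l).zone _ (hlt i) ((hS i l).1 hl)).2.1]
      exact (hz i).symm
    · rw [hS'] at hl
      apply C.vtx_injective
      rw [((hP l).free (hl ▸ hf j)).2]
      exact (hw _).symm
  · rintro (i | j) (i' | j') hne <;> rw [Finset.disjoint_left] <;> intro l hl hl'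
    · rw [hS] at hl hl'
      have := hl.eq hl' (hlt i) (hlt i')
      exact hne (by rw [show i = i' from Fin.ext (by omega)])
    · rw [hS] at hl
      rw [hS'] at hl'
      exact hf j' _ (hlt i) (hl' ▸ hl)
    · rw [hS'] at hl
      rw [hS] at hl'
      exact hf j _ (hlt i') (hl ▸ hl')
    · rw [hS'] at hl hl'
      exact hne (by rw [f.injective (hl.symm.trans hl')])
  · exact fun i j _ => (hP i).follows.nonCrossing (hP j).follows
  · rintro (i | j) l hl l' hl' hne m hm L hL
    · rw [hS] at hl hl' hm
      exact (hP l).nonCrossing_concat (hlt i) (hP l') (hP m) hl hl' hm hL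
    · rw [hS'] at hl hl'
      exact (hne (hl.trans hl'.symm)).elim
  · refine sees_of_flowWalk hζ hP hz (hw false) ?_
    rw [List.pairwise_reverse]
    exact ((List.pairwise_lt_finRange k).filter _).imp fun h => by simpa using h
  · refine sees_of_flowWalk hζ hP hz (hw true) ?_
    exact ((List.pairwise_lt_finRange k).filter _).imp fun h => by simpa using h

end Coord

end VCG

namespace VCG

open VCG.Bundle PlaneMultigraph

/-! ### The cut -/

/-- The vertices on the side of `w₀` of the cut. -/
def InCut (e : ℕ → Bool) : Point → Prop
  | .w c => c = false
  | .p r s t => if e r then s ≤ idx e r else t ≤ idx e r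

/-- The condition is consistent where triangle r meets row r + 1, since `idx e (r + 1)` is `idx e
r`, increased by 2^r if e r is true. -/
theorem inCut_point {e : ℕ → Bool} {r s t : ℕ} (ht : t ≤ 2 ^ r) :
    InCut e (point r s t) ↔ if e r then s ≤ idx e r else t ≤ idx e r := by
  have h1 := idx_lt e r
  simp only [point]
  cases her : e r <;> split_ifs <;> simp [InCut, her, idx] <;> first | omega | contradiction

/-- The edges of the row `r` in the cut. -/
noncomputable def rowCut (k : ℕ) (ζ : ℕ → ℕ) (e : ℕ → Bool) (r : ℕ) : Finset (Bundle × ℕ) :=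
  open Classical in (Finset.range (mult k ζ (D r (idx e r)))).image fun c => (D r (idx e r), c)

/-- The edges of the triangle `r` in the cut. -/
noncomputable def triangleCut (k : ℕ) (e : ℕ → Bool) (r : ℕ) : Finset (Bundle × ℕ) :=
  open Classical in if e r then (Finset.Ico (idx e r + 1) (2 ^ r)).biUnion fun t =>
    (Finset.range (thin k r)).image fun c => (A r (idx e r) t, c)
  else (Finset.Ico 1 (idx e r + 1)).biUnion fun s =>
    (Finset.range (thin k r)).image fun c => (B r s (idx e r), c)

/-- The edges in the cut. -/
noncomputable def cutEdges (k : ℕ) (ζ : ℕ → ℕ) (e : ℕ → Bool) : Finset (Bundle × ℕ) :=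
  open Classical in (Finset.range (k + 1)).biUnion (rowCut k ζ e) ∪
    (Finset.range k).biUnion (triangleCut k e)

theorem card_cutEdges_le (k : ℕ) (ζ : ℕ → ℕ) (e : ℕ → Bool) :
    (cutEdges k ζ e).card ≤ base k e ζ k := by
  classical
  have h1 : ∀ r, (rowCut k ζ e r).card ≤ mult k ζ (D r (idx e r)) := fun r =>
    Finset.card_image_le.trans (Finset.card_range _).le
  have h2 : ∀ r, (triangleCut k e r).card ≤ shift k e r := by
    intro r
    unfold triangleCut shift
    rw [mul_comm]
    split_ifs
    · refine (Finset.card_biUnion_le_card_mul _ _ (thin k r) fun t _ =>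
        Finset.card_image_le.trans (Finset.card_range _).le).trans (le_of_eq ?_)
      rw [Nat.card_Ico, Nat.sub_sub, add_comm]
    · refine (Finset.card_biUnion_le_card_mul _ _ (thin k r) fun t _ =>
        Finset.card_image_le.trans (Finset.card_range _).le).trans (le_of_eq ?_)
      rw [Nat.card_Ico, Nat.add_sub_cancel]
  have h3 : ∑ r ∈ Finset.range (k + 1), mult k ζ (D r (idx e r)) =
      1 + k * 2 ^ (k + 1) + ζ (idx e k) := by
    rw [Finset.sum_range_succ']
    simp only [mult, Nat.add_eq_zero_iff, one_ne_zero, and_false, if_false, if_true,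
      Finset.sum_add_distrib, Finset.sum_const, Finset.card_range, smul_eq_mul]
    -- Only row k contributes ζ; for k = 0 it coincides with row 0.
    rcases k with _ | k
    · simp [idx]
    · rw [Finset.sum_range_succ, Finset.sum_eq_zero]
      · simp
        ring
      · intro r hr
        rw [Finset.mem_range] at hr
        rw [if_neg (by omega)]
  refine (Finset.card_union_le _ _).trans ?_
  rw [base_eq k e ζ le_rfl, if_pos rfl]
  have h4 := (Finset.card_biUnion_le (s := Finset.range (k + 1)) (t := rowCut k ζ e)).trans
    (Finset.sum_le_sum fun r _ => h1 r)
  have h5 := (Finset.card_biUnion_le (s := Finset.range k) (t := triangleCut k e)).trans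
    (Finset.sum_le_sum fun r _ => h2 r)
  omega

/-- The side is decided by one coordinate, which changes by at most one along a bundle. Hence the
side changes only where this coordinate equals `idx e r` at the left end. -/
theorem mem_cutEdges {k : ℕ} {ζ : ℕ → ℕ} {e : ℕ → Bool} {b : Bundle} {c : ℕ} (hb : b.Valid k)
    (hc : c < mult k ζ b) (h : ¬ (InCut e (bundleSrc (b, false)) ↔ InCut e (bundleSrc (b, true)))) :
    (b, c) ∈ cutEdges k ζ e := by
  have hsucc : ∀ {u n : ℕ}, ¬ (u ≤ n ↔ u + 1 ≤ n) → u = n := fun h => by omega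
  simp only [cutEdges, Finset.mem_union, Finset.mem_biUnion, Finset.mem_range, rowCut,
    Finset.mem_image, triangleCut]
  rcases b with ⟨r, u⟩ | ⟨r, s, t⟩ | ⟨r, s, t⟩ <;> simp only [Bundle.Valid] at hb <;>
    simp only [bundleSrc] at h <;>
    rw [inCut_point (by omega), inCut_point (by omega)] at h
  · have hu : u = idx e r := hsucc (by cases her : e r <;> simpa [her] using h)
    subst hu
    exact Or.inl ⟨r, by omega, c, hc, rfl⟩
  · cases her : e r
    · simp [her] at h
    · have hu : s = idx e r := hsucc (by simpa [her] using h)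
      subst hu
      refine Or.inr ⟨r, hb.1, ?_⟩
      rw [if_pos her]
      simp only [Finset.mem_biUnion, Finset.mem_image, Finset.mem_range, Finset.mem_Ico]
      exact ⟨t, by omega, c, hc, rfl⟩
  · cases her : e r
    · have hu : t = idx e r := hsucc (by simpa [her] using h)
      subst hu
      refine Or.inr ⟨r, hb.1, ?_⟩
      rw [if_neg (by simp [her])]
      simp only [Finset.mem_biUnion, Finset.mem_image, Finset.mem_range, Finset.mem_Ico]
      exact ⟨s, by omega, c, hc, rfl⟩
    · simp [her] at h

theorem RotationSystem.IsWalk.exists_crossing {V E : Type} {Γ : RotationSystem V E} {u v : V}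
    {l : List (Dart E)} (h : Γ.IsWalk u v l) {S : V → Prop} (huv : ¬ (S u ↔ S v)) :
    ∃ d ∈ l, ¬ (S (Γ.src d) ↔ S (Γ.dst d)) := by
  induction l generalizing u with
  | nil => exact (huv (by rw [show u = v from h])).elim
  | cons d l ih =>
    by_cases hd : S (Γ.src d) ↔ S (Γ.dst d)
    · rw [h.1] at hd
      obtain ⟨x, hx, hx'⟩ := ih h.2 (by rwa [← hd])
      exact ⟨x, List.mem_cons_of_mem _ hx, hx'⟩
    · exact ⟨d, List.mem_cons_self, hd⟩

namespace Coord

variable {k : ℕ} {ζ : ℕ → ℕ} {V E : Type} [Finite V] [Finite E] {G : PlaneMultigraph V E}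

/-- Every walk of a flow uses an edge of the cut. -/
theorem le_of_hasFlow (C : Coord k ζ G) {b : BitVector k} {d : ℕ} {z : Fin k → V} {w : Bool → V}
    (hz : ∀ i, C.vtx (z i) = .p (k - 1 - i + 1) (2 ^ (k - 1 - i : ℕ)) (2 ^ (k - 1 - i : ℕ)))
    (hw : ∀ c, C.vtx (w c) = .w c) (h : G.HasFlow (gadgetRequests z w b d)) :
    k * 2 ^ k + d ≤ base k (bit b) ζ k := by
  classical
  obtain ⟨n, P, S, hS⟩ := h
  set e := bit b with he
  have hcross : ∀ i ∈ Finset.univ.biUnion S, ∃ x ∈ (P i).darts, C.pos x.1 ∈ cutEdges k ζ e := by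
    intro i hi
    obtain ⟨q, -, hq⟩ := Finset.mem_biUnion.1 hi
    -- With r the level of i, z_i is on the side of w₀ iff 2^r ≤ `idx e (r + 1)`, that is, iff b_i
    -- is true, and then its request starts at w₁.
    have hsep : ¬ (InCut e (C.vtx (P i).start) ↔ InCut e (C.vtx (P i).finish)) := by
      rw [hS.start q i hq, hS.finish q i hq]
      rcases q with i | j
      · simp only [gadgetRequests, hw, hz, InCut]
        have h1 := bit_sub b i
        have h2 := idx_lt e (k - 1 - i)
        rw [← he] at h1
        simp only [ite_self, idx, h1]
        cases b i <;> simp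
        omega
      · simp [gadgetRequests, hw, InCut]
    obtain ⟨x, hx, hx'⟩ := (P i).isWalk.exists_crossing (S := fun v => InCut e (C.vtx v)) hsep
    refine ⟨x, hx, mem_cutEdges (C.pos_valid x.1) (C.pos_lt x.1) ?_⟩
    rw [RotationSystem.dst, C.src, C.src] at hx'
    obtain ⟨a, _ | _⟩ := x
    · exact hx'
    · exact fun h => hx' h.symm
  have : Nonempty (Dart E) := ⟨G.outer⟩
  choose! f hf1 hf2 using hcross
  have hcard := Finset.card_le_card_of_injOn (s := Finset.univ.biUnion S) (t := cutEdges k ζ e)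
    (fun i => C.pos (f i).1) hf2 (by
      intro i hi j hj hij
      by_contra hne
      exact hS.edgeDisjoint i j hne _ (hf1 i hi) _ (hf1 j hj) (C.pos_injective hij))
  refine le_trans (le_of_eq ?_) (hcard.trans (card_cutEdges_le k ζ e))
  rw [Finset.card_biUnion fun q _ q' _ h => hS.disjoint q q' h, Fintype.sum_sum_type]
  simp [hS.card, gadgetRequests]

/-- The gadget has the required flows. -/
theorem isVectorContainmentGadget {Z : Finset (BitVector k)} {G : PlaneMultigraph V E}
    (C : Coord k (charFun Z) G) {z : Fin k → V} {w : Bool → V}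
    (hz : ∀ i, C.vtx (z i) = .p (k - 1 - i + 1) (2 ^ (k - 1 - i : ℕ)) (2 ^ (k - 1 - i : ℕ)))
    (hw : ∀ c, C.vtx (w c) = .w c) : IsVectorContainmentGadget k (gammaHat k) Z G z w where
  distinct := by
    apply Function.Injective.of_comp (f := C.vtx)
    rintro (i | c) (i' | c') h <;> simp [hz, hw] at h
    · rw [show i = i' from Fin.ext (by omega)]
    · rw [h]
  outer c := by
    obtain ⟨y, h1, h2, -⟩ := exists_outer (C := C) c
    exact ⟨y, C.vtx_injective (h1.trans (hw c).symm), h2⟩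
  outerCycle := C.outerSimpleCycle
  equiv b d := by
    have hb := base_bit Z b
    tfae_have 1 → 3 := fun h =>
      C.exists_nonCrossingFlow (charFun_le_one Z) (by rw [hb]; omega) hz hw
    tfae_have 3 → 2 := fun ⟨n, P, S, h, _⟩ => ⟨n, P, S, h⟩
    tfae_have 2 → 1 := fun h => by
      have := C.le_of_hasFlow hz hw h
      rw [hb] at this
      omega
    tfae_finish

end Coord

end VCG

namespace VCG

/-! ### Random access machine programs

Programs are put together from functions on states that are computed in constant time. The registers
`0` to `9` are visible, and the other ones are used for intermediate results. -/

/-- The states agree up to intermediate results. -/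
def Agree (s s' : State) : Prop := (∀ r < 10, s.reg r = s'.reg r) ∧ s.arr = s'.arr

theorem Agree.refl (s : State) : Agree s s := ⟨fun _ _ => rfl, rfl⟩

theorem Agree.trans {s s' s'' : State} (h : Agree s s') (h' : Agree s' s'') : Agree s s'' :=
  ⟨fun r hr => (h.1 r hr).trans (h'.1 r hr), h.2.trans h'.2⟩

theorem Agree.setReg {s s' : State} (h : Agree s s') (r v : ℕ) :
    Agree (s.setReg r v) (s'.setReg r v) := by
  refine ⟨fun i hi => ?_, h.2⟩
  by_cases hr : i = r
  · subst hr
    simp [State.setReg]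
  · simp [State.setReg, hr, h.1 i hi]

theorem Agree.setArr {s s' : State} (h : Agree s s') (a i v : ℕ) :
    Agree (s.setArr a i v) (s'.setArr a i v) := by
  refine ⟨h.1, ?_⟩
  simp [State.setArr, h.2]

/-- The function `f` is computed in constant time. -/
structure Comp (f : State → ℕ) : Prop where
  congr : ∀ s s', Agree s s' → f s = f s'
  exec : ∀ ρ, 10 ≤ ρ → ∃ p T, ∀ s, ∃ s' t, Exec p s s' t ∧ t ≤ T ∧ s'.reg ρ = f s ∧
    (∀ r < ρ, s'.reg r = s.reg r) ∧ s'.arr = s.arr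

namespace Comp

variable {f g c : State → ℕ}

theorem lit (n : ℕ) : Comp fun _ => n where
  congr _ _ _ := rfl
  exec ρ _ := ⟨.set ρ (.lit n), 2, fun s => ⟨_, _, .set s ρ _, le_rfl, by
    simp [State.setReg, Expr.eval], fun r hr => by simp [State.setReg, hr.ne], rfl⟩⟩

theorem reg {r : ℕ} (hr : r < 10) : Comp fun s => s.reg r where
  congr _ _ h := h.1 r hr
  exec ρ _ := ⟨.set ρ (.reg r), 2, fun s => ⟨_, _, .set s ρ _, le_rfl, by
    simp [State.setReg, Expr.eval], fun r hr => by simp [State.setReg, hr.ne], rfl⟩⟩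

theorem get (a : ℕ) (hf : Comp f) : Comp fun s => s.arr a (f s) where
  congr s s' h := by rw [hf.congr s s' h, h.2]
  exec ρ hρ := by
    obtain ⟨p, T, hp⟩ := hf.exec ρ hρ
    refine ⟨.seq p (.set ρ (.get a (.reg ρ))), T + 3, fun s => ?_⟩
    obtain ⟨s', t, h1, h2, h3, h4, h5⟩ := hp s
    refine ⟨_, _, .seq h1 (.set s' ρ _), by simp [Expr.cost]; omega, ?_, ?_, ?_⟩
    · simp [State.setReg, Expr.eval, h3, h5]
    · intro r hr
      simp [State.setReg, hr.ne, h4 r hr]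
    · simp [State.setReg, h5]

/-- The registers from ρ on act as a stack: the first value stays in ρ while the second one is
computed in ρ + 1. -/
theorem binary (hf : Comp f) (hg : Comp g) {op : ℕ → ℕ → ℕ} {x : ℕ → Expr}
    (hx : ∀ ρ s, (x ρ).eval s = op (s.reg ρ) (s.reg (ρ + 1))) : Comp fun s => op (f s) (g s) where
  congr s s' h := by rw [hf.congr s s' h, hg.congr s s' h]
  exec ρ hρ := by
    obtain ⟨p, T, hp⟩ := hf.exec ρ hρ
    obtain ⟨q, T', hq⟩ := hg.exec (ρ + 1) (by omega)
    refine ⟨.seq p (.seq q (.set ρ (x ρ))), T + (T' + ((x ρ).cost + 1)), fun s => ?_⟩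
    obtain ⟨s', t, h1, h2, h3, h4, h5⟩ := hp s
    obtain ⟨s'', t', k1, k2, k3, k4, k5⟩ := hq s'
    have hag : Agree s' s := ⟨fun r hr => h4 r (by omega), h5⟩
    refine ⟨_, _, .seq h1 (.seq k1 (.set s'' ρ _)), by omega, ?_, ?_, ?_⟩
    · simp only [State.setReg, Function.update_self]
      rw [hx, k4 ρ (by omega), k3, h3, hg.congr _ _ hag]
    · intro r hr
      simp [State.setReg, hr.ne, k4 r (by omega), h4 r hr]
    · simp [State.setReg, k5, h5]

theorem add (hf : Comp f) (hg : Comp g) : Comp fun s => f s + g s :=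
  hf.binary hg (op := fun a b => a + b) (x := fun ρ => .add (.reg ρ) (.reg (ρ + 1)))
    fun _ _ => rfl

theorem sub (hf : Comp f) (hg : Comp g) : Comp fun s => f s - g s :=
  hf.binary hg (op := fun a b => a - b) (x := fun ρ => .sub (.reg ρ) (.reg (ρ + 1)))
    fun _ _ => rfl

theorem cond (hc : Comp c) (hf : Comp f) (hg : Comp g) :
    Comp fun s => if c s ≠ 0 then f s else g s where
  congr s s' h := by rw [hc.congr s s' h, hf.congr s s' h, hg.congr s s' h]
  exec ρ hρ := by
    obtain ⟨p, T, hp⟩ := hc.exec ρ hρ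
    obtain ⟨q, T', hq⟩ := hf.exec ρ hρ
    obtain ⟨q', T'', hq'⟩ := hg.exec ρ hρ
    refine ⟨.seq p (.ite (.reg ρ) q q'), T + (2 + (T' + T'')), fun s => ?_⟩
    obtain ⟨s', t, h1, h2, h3, h4, h5⟩ := hp s
    have hag : Agree s' s := ⟨fun r hr => h4 r (by omega), h5⟩
    by_cases h : c s = 0
    · obtain ⟨s'', t', k1, k2, k3, k4, k5⟩ := hq' s'
      refine ⟨_, _, .seq h1 (.iteFalse (by rwa [Expr.eval, h3]) k1), ?_, ?_, ?_, k5.trans h5⟩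
      · simp only [Expr.cost]
        omega
      · rw [k3, hg.congr _ _ hag, if_neg (by simpa using h)]
      · exact fun r hr => (k4 r hr).trans (h4 r hr)
    · obtain ⟨s'', t', k1, k2, k3, k4, k5⟩ := hq s'
      refine ⟨_, _, .seq h1 (.iteTrue (by rwa [Expr.eval, h3]) k1), ?_, ?_, ?_, k5.trans h5⟩
      · simp only [Expr.cost]
        omega
      · rw [k3, hf.congr _ _ hag, if_pos h]
      · exact fun r hr => (k4 r hr).trans (h4 r hr)

end Comp

/-- The property `P` is decided in constant time. -/
def CompP (P : State → Prop) : Prop := Comp fun s => open Classical in if P s then 1 else 0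

theorem Comp.ite {P : State → Prop} [∀ s, Decidable (P s)] {f g : State → ℕ} (hP : CompP P)
    (hf : Comp f) (hg : Comp g) : Comp fun s => if P s then f s else g s := by
  have := hP.cond hf hg
  refine (congrArg Comp (funext fun s => ?_)).mp this
  by_cases h : P s <;> simp [h]

namespace CompP

variable {P Q : State → Prop} {f g : State → ℕ}

theorem of_cond (hf : Comp f) (h : ∀ s, P s ↔ f s ≠ 0) : CompP P := by
  refine (congrArg Comp (funext fun s => ?_)).mp (hf.cond (.lit 1) (.lit 0))
  simp only [h]

theorem lt (hf : Comp f) (hg : Comp g) : CompP fun s => f s < g s :=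
  of_cond (hg.sub hf) fun s => by omega

theorem le (hf : Comp f) (hg : Comp g) : CompP fun s => f s ≤ g s :=
  of_cond ((hg.add (.lit 1)).sub hf) fun s => by omega

theorem eq (hf : Comp f) (hg : Comp g) : CompP fun s => f s = g s :=
  -- With truncated subtraction, (g - f) + (f - g) is the distance of the two values.
  of_cond ((Comp.lit 1).sub ((hg.sub hf).add (hf.sub hg))) fun s => by omega

theorem and (hP : CompP P) (hQ : CompP Q) : CompP fun s => P s ∧ Q s := by
  classical
  refine of_cond (Comp.ite hP (Comp.ite hQ (.lit 1) (.lit 0)) (.lit 0)) fun s => ?_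
  by_cases h : P s <;> by_cases h' : Q s <;> simp [h, h']

theorem or (hP : CompP P) (hQ : CompP Q) : CompP fun s => P s ∨ Q s := by
  classical
  refine of_cond (Comp.ite hP (.lit 1) (Comp.ite hQ (.lit 1) (.lit 0))) fun s => ?_
  by_cases h : P s <;> by_cases h' : Q s <;> simp [h, h']

end CompP

/-- The function `F` on states is implemented, up to intermediate results, in constant time. -/
structure Code (F : State → State) : Prop where
  congr : ∀ s s', Agree s s' → Agree (F s) (F s')
  exec : ∃ p T, ∀ s, ∃ s' t, Exec p s s' t ∧ t ≤ T ∧ Agree (F s) s'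

namespace Code

variable {F F' : State → State} {f g : State → ℕ} {P : State → Prop}

theorem set {r : ℕ} (hf : Comp f) : Code fun s => s.setReg r (f s) where
  congr s s' h := by
    rw [hf.congr s s' h]
    exact h.setReg _ _
  exec := by
    obtain ⟨p, T, hp⟩ := hf.exec 10 le_rfl
    refine ⟨.seq p (.set r (.reg 10)), T + 2, fun s => ?_⟩
    obtain ⟨s', t, h1, h2, h3, h4, h5⟩ := hp s
    have hag : Agree s s' := ⟨fun r hr => (h4 r hr).symm, h5.symm⟩
    refine ⟨_, _, .seq h1 (.set s' r _), by simp only [Expr.cost]; omega, ?_⟩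
    simp only [Expr.eval, h3]
    exact hag.setReg _ _

theorem put (a : ℕ) (hf : Comp f) (hg : Comp g) : Code fun s => s.setArr a (f s) (g s) where
  congr s s' h := by
    rw [hf.congr s s' h, hg.congr s s' h]
    exact h.setArr _ _ _
  exec := by
    obtain ⟨p, T, hp⟩ := hf.exec 10 le_rfl
    obtain ⟨q, T', hq⟩ := hg.exec 11 (by omega)
    refine ⟨.seq p (.seq q (.put a (.reg 10) (.reg 11))), T + (T' + 3), fun s => ?_⟩
    obtain ⟨s', t, h1, h2, h3, h4, h5⟩ := hp s
    obtain ⟨s'', t', k1, k2, k3, k4, k5⟩ := hq s'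
    have hag : Agree s s' := ⟨fun r hr => (h4 r (by omega)).symm, h5.symm⟩
    have hag' : Agree s s'' := hag.trans ⟨fun r hr => (k4 r (by omega)).symm, k5.symm⟩
    refine ⟨_, _, .seq h1 (.seq k1 (.put s'' a _ _)), by simp only [Expr.cost]; omega, ?_⟩
    simp only [Expr.eval, k3, k4 10 (by omega), h3]
    rw [← hg.congr _ _ hag]
    exact hag'.setArr _ _ _

theorem seq (hF : Code F) (hF' : Code F') : Code fun s => F' (F s) where
  congr s s' h := hF'.congr _ _ (hF.congr _ _ h)
  exec := by
    obtain ⟨p, T, hp⟩ := hF.exec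
    obtain ⟨q, T', hq⟩ := hF'.exec
    refine ⟨.seq p q, T + T', fun s => ?_⟩
    obtain ⟨s', t, h1, h2, h3⟩ := hp s
    obtain ⟨s'', t', k1, k2, k3⟩ := hq s'
    exact ⟨_, _, .seq h1 k1, by omega, (hF'.congr _ _ h3).trans k3⟩

theorem ite [∀ s, Decidable (P s)] (hP : CompP P) (hF : Code F) (hF' : Code F') :
    Code fun s => if P s then F s else F' s where
  congr s s' h := by
    have h1 := hP.congr s s' h
    have h2 : P s ↔ P s' := by
      by_cases hs : P s <;> by_cases hs' : P s' <;> simp [hs, hs'] at h1 ⊢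
    by_cases hs : P s
    · rw [if_pos hs, if_pos (h2.1 hs)]
      exact hF.congr s s' h
    · rw [if_neg hs, if_neg fun h => hs (h2.2 h)]
      exact hF'.congr s s' h
  exec := by
    obtain ⟨p, T, hp⟩ := hP.exec 10 le_rfl
    obtain ⟨q, T', hq⟩ := hF.exec
    obtain ⟨q', T'', hq'⟩ := hF'.exec
    refine ⟨.seq p (.ite (.reg 10) q q'), T + (2 + (T' + T'')), fun s => ?_⟩
    obtain ⟨s', t, h1, h2, h3, h4, h5⟩ := hp s
    have hag : Agree s s' := ⟨fun r hr => (h4 r hr).symm, h5.symm⟩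
    by_cases h : P s
    · obtain ⟨s'', t', k1, k2, k3⟩ := hq s'
      refine ⟨_, _, .seq h1 (.iteTrue (by simp [Expr.eval, h3, h]) k1), ?_, ?_⟩
      · simp only [Expr.cost]
        omega
      · rw [if_pos h]
        exact (hF.congr _ _ hag).trans k3
    · obtain ⟨s'', t', k1, k2, k3⟩ := hq' s'
      refine ⟨_, _, .seq h1 (.iteFalse (by simp [Expr.eval, h3, h]) k1), ?_, ?_⟩
      · simp only [Expr.cost]
        omega
      · rw [if_neg h]
        exact (hF'.congr _ _ hag).trans k3

theorem id : Code fun s => s where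
  congr _ _ h := h
  exec := ⟨.skip, 1, fun s => ⟨_, _, .skip s, le_rfl, .refl s⟩⟩

end Code

/-- One program leads from states with the property `P` to states with the property `Q`, for all
values of the parameter, within a constant times the time bound. -/
def Task {ι : Type} (bound : ι → ℕ) (P Q : ι → State → Prop) : Prop :=
  ∃ p C, ∀ i s, P i s → ∃ s' t, Exec p s s' t ∧ t ≤ C * bound i ∧ Q i s'

namespace Task

variable {ι : Type} {bound : ι → ℕ} {P Q R : ι → State → Prop}

theorem seq (h : Task bound P Q) (h' : Task bound Q R) : Task bound P R := by
  obtain ⟨p, C, hp⟩ := h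
  obtain ⟨q, C', hq⟩ := h'
  refine ⟨.seq p q, C + C', fun i s hs => ?_⟩
  obtain ⟨s', t, h1, h2, h3⟩ := hp i s hs
  obtain ⟨s'', t', k1, k2, k3⟩ := hq i s' h3
  exact ⟨s'', _, .seq h1 k1, by rw [add_mul]; omega, k3⟩

theorem of_code {F : State → State} (hF : Code F) (hb : ∀ i, 1 ≤ bound i)
    (hQ : ∀ i s s', Agree s s' → Q i s → Q i s') (h : ∀ i s, P i s → Q i (F s)) :
    Task bound P Q := by
  obtain ⟨p, T, hp⟩ := hF.exec
  refine ⟨p, T, fun i s hs => ?_⟩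
  obtain ⟨s', t, h1, h2, h3⟩ := hp s
  exact ⟨s', t, h1, h2.trans (Nat.le_mul_of_pos_right _ (hb i)), hQ i _ _ h3 (h i s hs)⟩

/-- A loop in which register `6` runs from `0` to the content of register `7`. -/
theorem loop {F : State → State} (hF : Code F) (hreg : ∀ s, (F s).reg = s.reg)
    (Inv : ι → ℕ → State → Prop) (N : ι → ℕ) (hN : ∀ i, N i + 1 ≤ bound i)
    (hInv : ∀ i j s s', (∀ r < 10, r ≠ 6 → s.reg r = s'.reg r) → s.arr = s'.arr →
      Inv i j s → Inv i j s')
    (hbound : ∀ i j s, Inv i j s → s.reg 7 = N i)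
    (hstep : ∀ i j s, j < N i → s.reg 6 = j → Inv i j s → Inv i (j + 1) (F s)) :
    Task bound (fun i => Inv i 0) (fun i => Inv i (N i)) := by
  obtain ⟨p, T, hp⟩ := hF.exec
  set q : Prog := .loop (.sub (.reg 7) (.reg 6)) (.seq p (.set 6 (.add (.reg 6) (.lit 1))))
  -- A round costs 4 steps for the test, at most T for the body and 4 for the increment; the last
  -- test costs another 4.
  have key : ∀ i n j s, j + n = N i → s.reg 6 = j → Inv i j s →
      ∃ s' t, Exec q s s' t ∧ t ≤ 4 + n * (T + 8) ∧ Inv i (N i) s' := by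
    intro i n
    induction n with
    | zero =>
      intro j s hj h6 hs
      refine ⟨s, _, .loopDone (by simp [Expr.eval, h6, hbound i j s hs]; omega), by
        simp [Expr.cost], ?_⟩
      rwa [show N i = j by omega]
    | succ n ih =>
      intro j s hj h6 hs
      obtain ⟨s', t, h1, h2, h3⟩ := hp s
      have h7 : s'.reg 6 = j := by rw [← h3.1 6 (by omega), hreg, h6]
      have hs' : Inv i (j + 1) (s'.setReg 6 (j + 1)) := by
        refine hInv i _ _ _ ?_ (?_ : (F s).arr = _) (hstep i j s (by omega) h6 hs)
        · intro r hr hr6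
          simp [State.setReg, hr6, h3.1 r hr]
        · exact h3.2
      obtain ⟨s'', t', k1, k2, k3⟩ := ih (j + 1) _ (by omega) (by simp [State.setReg]) hs'
      have hex : Exec (.seq p (.set 6 (.add (.reg 6) (.lit 1)))) s (s'.setReg 6 (j + 1)) (t + 4) := by
        have := Exec.seq h1 (.set s' 6 (.add (.reg 6) (.lit 1)))
        simpa [Expr.eval, Expr.cost, h7] using this
      refine ⟨s'', _, .loopStep (by simp [Expr.eval, h6, hbound i j s hs]; omega) hex k1, ?_, k3⟩
      simp only [Expr.cost, add_mul]
      omega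
  refine ⟨.seq (.set 6 (.lit 0)) q, T + 8, fun i s hs => ?_⟩
  obtain ⟨s', t, h1, h2, h3⟩ := key i (N i) 0 (s.setReg 6 0) (by omega) (by simp [State.setReg])
    (hInv i 0 s _ (fun r _ hr => by simp [State.setReg, hr]) rfl hs)
  refine ⟨s', _, .seq (.set s 6 (.lit 0)) h1, ?_, h3⟩
  simp only [Expr.cost]
  have := Nat.mul_le_mul_left (T + 8) (hN i)
  rw [mul_add, mul_comm] at this
  omega

end Task

end VCG

namespace VCG

open VCG.Bundle

/-! ### Numbering by counting -/

/-- The number of elements below `n`. -/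
noncomputable def rankOf (p : ℕ → Prop) (n : ℕ) : ℕ := open Classical in Nat.count p n

theorem rankOf_zero (p : ℕ → Prop) : rankOf p 0 = 0 := by
  classical
  exact Nat.count_zero _

theorem rankOf_succ (p : ℕ → Prop) [DecidablePred p] (n : ℕ) :
    rankOf p (n + 1) = rankOf p n + if p n then 1 else 0 := by
  classical
  rw [rankOf, Nat.count_succ]
  congr

theorem rankOf_le (p : ℕ → Prop) (n : ℕ) : rankOf p n ≤ n := by
  classical
  exact Nat.count_le _

/-- Counting the valid keys below a key numbers the objects without gaps, and the count can be
accumulated in one pass over all numbers below N. -/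
theorem exists_rankEquiv {Y : Type} {key : Y → ℕ} (hinj : Function.Injective key) {p : ℕ → Prop}
    {N : ℕ} (hN : ∀ y, key y < N) (hp : ∀ n, p n ↔ ∃ y, key y = n) :
    ∃ e : Y ≃ Fin (rankOf p N), ∀ y, (e y : ℕ) = rankOf p (key y) := by
  classical
  have hlt : ∀ y, rankOf p (key y) < rankOf p N := fun y =>
    Nat.count_strict_mono ((hp _).2 ⟨y, rfl⟩) (hN y)
  refine ⟨Equiv.ofBijective (fun y => ⟨rankOf p (key y), hlt y⟩) ⟨?_, ?_⟩, fun y => rfl⟩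
  · intro y y' h
    exact hinj (Nat.count_injective ((hp _).2 ⟨y, rfl⟩) ((hp _).2 ⟨y', rfl⟩) (Fin.mk.inj h))
  · rintro ⟨i, hi⟩
    obtain ⟨n, hn, hpn, hni⟩ : ∃ n < N, p n ∧ rankOf p n = i := by
      clear hlt hN
      induction N with
      | zero => rw [rankOf_zero] at hi; omega
      | succ N ih =>
        rw [rankOf_succ] at hi
        by_cases hi' : i < rankOf p N
        · obtain ⟨n, h1, h2⟩ := ih hi'
          exact ⟨n, by omega, h2⟩
        · split_ifs at hi with h
          · exact ⟨N, by omega, h, by omega⟩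
          · omega
    obtain ⟨y, rfl⟩ := (hp n).1 hpn
    exact ⟨y, Fin.ext hni⟩

/-! ### Arithmetic descriptions of the gadget -/

/-- The number of an edge before compression. -/
def unitCode (R : ℕ) (e : Bundle × ℕ) : ℕ := bundleCode R e.1 * R + e.2

/-- A function of the numbers that describe a bundle and a direction. -/
def bundleArgs (φ : ℕ → ℕ → ℕ → ℕ → ℕ → ℕ) : Bundle × Bool → ℕ
  | (D r u, x) => φ 0 r u 0 x.toNat
  | (A r s t, x) => φ 1 r s t x.toNat
  | (B r s t, x) => φ 2 r s t x.toNat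

/-- An arithmetic description of `bundleNext`. -/
def numBundleNext (φ : ℕ → ℕ → ℕ → ℕ → ℕ → ℕ) (pw : ℕ → ℕ) (k a r s t x : ℕ) : ℕ :=
  if a = 1 then
    if x = 0 then if s = 0 then φ 0 (r + 1) t 0 0 else φ 2 r s t 0
    else if s + 1 < t then φ 2 r (s + 1) (t - 1) 1 else φ 0 r (t - 1) 0 1
  else if a = 2 then
    if x = 0 then φ 1 r (s - 1) t 1
    else if t + 1 < pw r then φ 1 r s (t + 1) 0 else φ 0 (r + 1) (pw r + s) 0 0
  else if x = 0 then
    if s = 0 then if r < k then φ 0 (r + 1) 0 0 0 else φ 0 0 0 0 0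
    else if r < k then φ 2 r s s 0 else φ 0 r (s - 1) 0 1
  else if r = 0 then φ 0 k (pw k - 1) 0 1
  else if s + 1 = pw r then φ 0 (r - 1) (pw (r - 1) - 1) 0 1
  else if s + 1 < pw (r - 1) then φ 1 (r - 1) 0 (s + 1) 0
  else if s + 1 = pw (r - 1) then φ 0 r (s + 1) 0 0
  else φ 2 (r - 1) (s + 1 - pw (r - 1)) (pw (r - 1) - 1) 1

/-- The continuation φ receives the digits of the new dart, so no tuple has to be stored. The
function `pw` is a table, correct only in a finite range. -/
theorem numBundleNext_eq {φ : ℕ → ℕ → ℕ → ℕ → ℕ → ℕ} {pw : ℕ → ℕ} {k : ℕ}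
    (hpw : ∀ r ≤ k, pw r = 2 ^ r) {d : Bundle × Bool} (hd : d.1.Valid k) :
    bundleArgs (numBundleNext φ pw k) d = bundleArgs φ (bundleNext k d) := by
  obtain ⟨⟨_ | r, u⟩ | ⟨r, s, t⟩ | ⟨r, s, t⟩, _ | _⟩ := d <;> simp only [Bundle.Valid] at hd <;>
    simp only [bundleArgs, numBundleNext, bundleNext, hpw k le_rfl, Bool.toNat_false,
      Bool.toNat_true, if_true, if_false, OfNat.zero_ne_ofNat, zero_ne_one, one_ne_zero,
      OfNat.ofNat_ne_one, Nat.add_eq_zero_iff, and_false, Nat.add_sub_cancel] <;>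
    (try rw [hpw r (by omega)]) <;> (try rw [hpw (r + 1) (by omega)]) <;>
    (try split_ifs) <;> rfl

/-- An arithmetic description of `mult`. -/
def numMult (pw ζ : ℕ → ℕ) (k a r s : ℕ) : ℕ :=
  if a = 0 then (if r = 0 then 1 else pw (k + 1)) + if r = k then ζ s else 0 else pw (k - 1 - r)

theorem numMult_eq {pw ζ : ℕ → ℕ} {k : ℕ} (hpw : ∀ r ≤ k + 1, pw r = 2 ^ r) (b : Bundle) (x : Bool) :
    bundleArgs (fun a r s _ _ => numMult pw ζ k a r s) (b, x) = mult k ζ b := by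
  have h : ∀ r, pw (k - 1 - r) = 2 ^ (k - 1 - r) := fun r => hpw _ (by omega)
  cases b <;> simp [bundleArgs, numMult, mult, hpw (k + 1) le_rfl, h]

/-- Five digits, where `mul` is the multiplication by the base. -/
def numUnitCode (mul : ℕ → ℕ) (a r s t c : ℕ) : ℕ := mul (mul (mul (mul a + r) + s) + t) + c

/-- An arithmetic description of `unitFirst`. -/
def numFirst (pw ζ mul rk : ℕ → ℕ) (k a r s t x : ℕ) : ℕ :=
  rk (numUnitCode mul a r s t (if x = 0 then 0 else numMult pw ζ k a r s - 1)) +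
    rk (numUnitCode mul a r s t (if x = 0 then 0 else numMult pw ζ k a r s - 1)) + x

/-- An arithmetic description of `unitNext`. -/
def numNext (pw ζ mul rk : ℕ → ℕ) (k a r s t c x : ℕ) : ℕ :=
  if x = 0 then
    if c + 1 < numMult pw ζ k a r s then
      rk (numUnitCode mul a r s t (c + 1)) + rk (numUnitCode mul a r s t (c + 1)) + x
    else numBundleNext (numFirst pw ζ mul rk k) pw k a r s t x
  else if 0 < c then
    rk (numUnitCode mul a r s t (c - 1)) + rk (numUnitCode mul a r s t (c - 1)) + x
  else numBundleNext (numFirst pw ζ mul rk k) pw k a r s t x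

/-- An arithmetic description of `point`. -/
def numPoint (pw mul : ℕ → ℕ) (r s t : ℕ) : ℕ :=
  if s = t then if s = 0 then 0 else if s = pw r then 1 else mul (mul r + s) + t
  else if s = 0 then mul (mul (r + 1) + t) + t
  else if t = pw r then mul (mul (r + 1) + (pw r + s)) + (pw r + s)
  else mul (mul r + s) + t

/-- An arithmetic description of `bundleSrc`. -/
def numSrc (pw mul : ℕ → ℕ) (a r s t x : ℕ) : ℕ :=
  if a = 0 then numPoint pw mul r (s + x) (s + x)
  else if a = 1 then numPoint pw mul r (s + x) t
  else numPoint pw mul r s (t + x)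

/-- An arithmetic description of the edges. -/
def NumEdge (pw ζ : ℕ → ℕ) (k a r s t c : ℕ) : Prop :=
  c < numMult pw ζ k a r s ∧
    ((a = 0 ∧ t = 0 ∧ r ≤ k ∧ s < pw r) ∨ (a = 1 ∧ r < k ∧ s < t ∧ t < pw r) ∨
      (a = 2 ∧ r < k ∧ 1 ≤ s ∧ s ≤ t ∧ t < pw r))

/-- An arithmetic description of the vertices. -/
def NumVertex (pw : ℕ → ℕ) (k a r s t : ℕ) : Prop :=
  a = 0 ∧ ((r = 0 ∧ s = 0 ∧ t < 2) ∨
    (1 ≤ s ∧ s ≤ t ∧ r ≤ k ∧ t < pw r ∧ (r < k ∨ s = t)))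

/-! ### Codes in base 2^(k+2) and their decoding -/

section Base

variable {k : ℕ} {pw ζ mul rk : ℕ → ℕ}

/-- The base of the codes. -/
def radix (k : ℕ) : ℕ := 2 ^ (k + 2)

theorem radix_bounds (k : ℕ) : 4 ≤ radix k ∧ k + 2 < radix k ∧ radix k = 4 * 2 ^ k := by
  have h1 : radix k = 4 * 2 ^ k := by rw [radix, pow_add]; ring
  have h2 := Nat.lt_two_pow_self (n := k)
  omega

theorem mul_add_lt {R x s n : ℕ} (hx : x < n) (hs : s < R) : x * R + s < n * R := by
  have : (x + 1) * R ≤ n * R := Nat.mul_le_mul_right _ hx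
  rw [add_mul] at this
  omega

/-- Bundles have up to 2^(k+1) + 1 edges. The base is chosen so that the number of an edge in its
bundle is a single digit. -/
theorem mult_lt_radix (hζ : ∀ u, ζ u ≤ 1) (b : Bundle) : mult k ζ b < radix k := by
  obtain ⟨h1, h2, h3⟩ := radix_bounds k
  have h5 : 2 ^ (k + 1) = 2 * 2 ^ k := by rw [pow_succ]; ring
  rcases b with ⟨r, u⟩ | ⟨r, s, t⟩ | ⟨r, s, t⟩ <;> simp only [mult]
  · have := hζ u
    split_ifs <;> omega
  · have := pow_le_of_le (show k - 1 - r ≤ k by omega)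
    omega
  · have := pow_le_of_le (show k - 1 - r ≤ k by omega)
    omega

theorem Bundle.Valid.lt_radix {b : Bundle} (hb : b.Valid k) :
    match b with
    | D r u => r < radix k ∧ u < radix k
    | A r s t => r < radix k ∧ s < radix k ∧ t < radix k
    | B r s t => r < radix k ∧ s < radix k ∧ t < radix k := by
  have h3 := (radix_bounds k).2.2
  have h4 := hb.bounds
  have h5 : 2 ^ (k + 1) = 2 * 2 ^ k := by rw [pow_succ]; ring
  cases b <;> simp only at h4 ⊢ <;> omega

theorem unitCode_lt (hζ : ∀ u, ζ u ≤ 1) {b : Bundle} {c : ℕ} (hb : b.Valid k)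
    (hc : c < mult k ζ b) :
    unitCode (radix k) (b, c) < radix k * radix k * radix k * radix k * radix k := by
  obtain ⟨h1, -⟩ := radix_bounds k
  have h2 := hb.lt_radix
  refine mul_add_lt ?_ (hc.trans (mult_lt_radix hζ b))
  cases b <;> simp only at h2 <;>
    exact pack_lt (by omega) (by omega) (by omega) (by omega)

theorem unitCode_inj (hζ : ∀ u, ζ u ≤ 1) {b b' : Bundle} {c c' : ℕ} (hb : b.Valid k)
    (hc : c < mult k ζ b) (hb' : b'.Valid k) (hc' : c' < mult k ζ b')
    (h : unitCode (radix k) (b, c) = unitCode (radix k) (b', c')) : b = b' ∧ c = c' := by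
  obtain ⟨h0, -⟩ := radix_bounds k
  have h1 := hc.trans (mult_lt_radix hζ b)
  have h2 := hc'.trans (mult_lt_radix hζ b')
  have h3 := hb.lt_radix
  have h4 := hb'.lt_radix
  have h5 := congrArg (· / radix k) h
  have h6 := congrArg (· % radix k) h
  simp only [unitCode, mul_add_div_eq h1, mul_add_div_eq h2, mul_add_mod_eq h1,
    mul_add_mod_eq h2] at h5 h6
  refine ⟨?_, h6⟩
  cases b <;> cases b' <;> simp only [bundleCode] at h3 h4 h5 <;>
    have := pack_inj (by omega) (by omega) (by omega) (by omega) (by omega) (by omega) h5 <;>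
    simp_all

theorem pointCode_radix_lt {v : Point} (h : v.Valid k) :
    pointCode (radix k) v < 1 * radix k * radix k * radix k := by
  obtain ⟨h1, -, h3⟩ := radix_bounds k
  rcases v with c | ⟨r, s, t⟩
  · exact pack_lt (by omega) (by omega) (by omega) (by cases c <;> simp <;> omega)
  · have h4 := h.bounds
    have h5 : 2 ^ (k + 1) = 2 * 2 ^ k := by rw [pow_succ]; ring
    exact pack_lt (by omega) (by omega) (by omega) (by omega)

theorem pointCode_radix_inj {v v' : Point} (h : v.Valid k) (h' : v'.Valid k)
    (hv : pointCode (radix k) v = pointCode (radix k) v') : v = v' := by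
  obtain ⟨h1, -, h3⟩ := radix_bounds k
  have h5 : 2 ^ (k + 1) = 2 * 2 ^ k := by rw [pow_succ]; ring
  have hc : ∀ c : Bool, c.toNat < radix k := fun c => by cases c <;> simp <;> omega
  rcases v with c | ⟨r, s, t⟩ <;> rcases v' with c' | ⟨r', s', t'⟩ <;> simp only [pointCode] at hv
  · have := pack_inj (by omega) (by omega) (hc c) (by omega) (by omega) (hc c') hv
    cases c <;> cases c' <;> simp_all
  · have h2 := h'.bounds
    have := pack_inj (by omega) (by omega) (hc c) (by omega) (by omega) (by omega) hv
    simp only [Point.Valid] at h'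
    omega
  · have h4 := h.bounds
    have := pack_inj (by omega) (by omega) (by omega) (by omega) (by omega) (hc c') hv
    simp only [Point.Valid] at h
    omega
  · have h4 := h.bounds
    have h2 := h'.bounds
    have := pack_inj (by omega) (by omega) (by omega) (by omega) (by omega) (by omega) hv
    simp_all

/-- The number `y` is the code of an edge. -/
def IsEdge (k : ℕ) (ζ : ℕ → ℕ) (y : ℕ) : Prop :=
  ∃ b c, b.Valid k ∧ c < mult k ζ b ∧ unitCode (radix k) (b, c) = y

/-- The number `y` is the code of a vertex. -/
def IsVertex (k y : ℕ) : Prop := ∃ v, v.Valid k ∧ pointCode (radix k) v = y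

theorem pack_digits (R y : ℕ) : pack R (y / R / R / R) (y / R / R % R) (y / R % R) (y % R) = y := by
  rw [pack, Nat.div_add_mod', Nat.div_add_mod', Nat.div_add_mod']

theorem isEdge_iff (hζ : ∀ u, ζ u ≤ 1) (hpw : ∀ r ≤ k + 1, pw r = 2 ^ r) {R : ℕ} (hR : R = radix k)
    (y : ℕ) :
    IsEdge k ζ y ↔
      NumEdge pw ζ k (y / R / R / R / R) (y / R / R / R % R) (y / R / R % R) (y / R % R) (y % R) := by
  obtain ⟨h0, -⟩ := radix_bounds k
  rw [← hR] at h0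
  constructor
  · rintro ⟨b, c, hb, hc, rfl⟩
    have h1 := hc.trans (mult_lt_radix hζ b)
    have h2 := hb.lt_radix
    have h3 := numMult_eq (ζ := ζ) hpw b false
    rw [← hR] at h1 h2 ⊢
    simp only [unitCode, mul_add_div_eq h1, mul_add_mod_eq h1]
    rcases b with ⟨r, u⟩ | ⟨r, s, t⟩ | ⟨r, s, t⟩ <;> simp only [bundleCode, bundleArgs] at h2 h3 hb ⊢ <;>
      rw [pack_mod (by omega), pack_div_mod (by omega) (by omega),
        pack_div_div_mod (by omega) (by omega) (by omega),
        pack_div_div_div (by omega) (by omega) (by omega)] <;>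
      refine ⟨by rwa [h3], ?_⟩ <;> simp only [Bundle.Valid] at hb <;> rw [hpw r (by omega)] <;> omega
  · rintro ⟨hc, h⟩
    have hy := Nat.div_add_mod' y R
    have hp := pack_digits R (y / R)
    have h3 := fun b => numMult_eq (ζ := ζ) hpw b false
    generalize y / R / R / R / R = a at *
    generalize y / R / R / R % R = r at *
    generalize y / R / R % R = s at *
    generalize y / R % R = t at *
    rcases h with ⟨rfl, rfl, h1, h2⟩ | ⟨rfl, h1, h2⟩ | ⟨rfl, h1, h2⟩ <;> rw [hpw r (by omega)] at h2
    · exact ⟨D r s, y % R, ⟨h1, h2⟩, h3 (D r s) ▸ hc, by rw [unitCode, bundleCode, ← hR, hp, hy]⟩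
    · exact ⟨A r s t, y % R, ⟨h1, h2⟩, h3 (A r s t) ▸ hc, by rw [unitCode, bundleCode, ← hR, hp, hy]⟩
    · exact ⟨B r s t, y % R, ⟨h1, h2⟩, h3 (B r s t) ▸ hc, by rw [unitCode, bundleCode, ← hR, hp, hy]⟩

theorem isVertex_iff (hpw : ∀ r ≤ k + 1, pw r = 2 ^ r) {R : ℕ} (hR : R = radix k) (y : ℕ) :
    IsVertex k y ↔ NumVertex pw k (y / R / R / R) (y / R / R % R) (y / R % R) (y % R) := by
  obtain ⟨h0, -, h3⟩ := radix_bounds k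
  rw [← hR] at h0
  constructor
  · rintro ⟨c | ⟨r, s, t⟩, hv, rfl⟩
    · have hc : c.toNat < 2 := by cases c <;> simp
      rw [← hR, pointCode, pack_mod (by omega), pack_div_mod (by omega) (by omega),
        pack_div_div_mod (by omega) (by omega) (by omega),
        pack_div_div_div (by omega) (by omega) (by omega)]
      exact ⟨rfl, Or.inl ⟨rfl, rfl, hc⟩⟩
    · have h4 := hv.bounds
      have h5 : 2 ^ (k + 1) = 2 * 2 ^ k := by rw [pow_succ]; ring
      rw [← hR, pointCode, pack_mod (by omega), pack_div_mod (by omega) (by omega),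
        pack_div_div_mod (by omega) (by omega) (by omega),
        pack_div_div_div (by omega) (by omega) (by omega)]
      simp only [Point.Valid] at hv
      refine ⟨rfl, Or.inr ?_⟩
      rw [hpw r (by omega)]
      omega
  · rintro ⟨h1, h⟩
    have hp := pack_digits R y
    rw [h1] at hp
    generalize y / R / R % R = r at *
    generalize y / R % R = s at *
    generalize y % R = t at *
    rcases h with ⟨rfl, rfl, ht⟩ | h
    · refine ⟨.w (decide (t = 1)), trivial, ?_⟩
      rw [pointCode, ← hR, ← hp]
      congr 1
      rcases (show t = 0 ∨ t = 1 by omega) with rfl | rfl <;> rfl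
    · rw [hpw r (by omega)] at h
      exact ⟨.p r s t, by simp only [Point.Valid]; omega, by rw [pointCode, ← hR, hp]⟩

/-- In Horner's scheme every number multiplied by the base has at most four digits, so a table of
this size suffices. -/
theorem numUnitCode_eq {R : ℕ} (hmul : ∀ x < R * R * R * R, mul x = x * R) {a r s t : ℕ}
    (ha : a < R) (hr : r < R) (hs : s < R) (ht : t < R) (c : ℕ) :
    numUnitCode mul a r s t c = pack R a r s t * R + c := by
  have h1 := mul_add_lt ha hr
  have h2 := mul_add_lt h1 hs
  have h3 := mul_add_lt h2 ht
  have h4 : R ≤ R * R := Nat.le_mul_of_pos_right _ (by omega)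
  have h5 : R * R ≤ R * R * R := Nat.le_mul_of_pos_right _ (by omega)
  have h6 : R * R * R ≤ R * R * R * R := Nat.le_mul_of_pos_right _ (by omega)
  rw [numUnitCode, hmul a (by omega), hmul (a * R + r) (by omega),
    hmul ((a * R + r) * R + s) (by omega), hmul _ h3, pack]

theorem numPoint_eq (hpw : ∀ r ≤ k + 1, pw r = 2 ^ r)
    (hmul : ∀ x < radix k * radix k * radix k * radix k, mul x = x * radix k) {r s t : ℕ}
    (hr : r < k ∨ r = k ∧ s = t) (hst : s ≤ t) (ht : t ≤ 2 ^ r) :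
    numPoint pw mul r s t = pointCode (radix k) (point r s t) := by
  obtain ⟨h1, h2, h3⟩ := radix_bounds k
  have hp := pow_le_of_le (show r ≤ k by omega)
  have hcode : ∀ {r s t : ℕ}, r < radix k → s < radix k → mul (mul r + s) + t =
      pack (radix k) 0 r s t := by
    intro r s t hr hs
    have h6 := mul_add_lt hr hs
    have h4 : radix k ≤ radix k * radix k := Nat.le_mul_of_pos_right _ (by omega)
    have h5 : radix k * radix k ≤ radix k * radix k * radix k * radix k := by
      rw [mul_assoc (radix k * radix k)]
      exact Nat.le_mul_of_pos_right _ (by positivity)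
    rw [hmul r (by omega), hmul _ (by omega), pack, zero_mul, zero_add]
  simp only [numPoint, point, hpw r (by omega)]
  split_ifs
  · simp [pointCode, pack]
  · simp [pointCode, pack]
  · exact hcode (by omega) (by omega)
  · exact hcode (by omega) (by omega)
  · exact hcode (by omega) (by omega)
  · exact hcode (by omega) (by omega)

theorem numSrc_eq (hpw : ∀ r ≤ k + 1, pw r = 2 ^ r)
    (hmul : ∀ x < radix k * radix k * radix k * radix k, mul x = x * radix k) {d : Bundle × Bool}
    (hd : d.1.Valid k) :
    bundleArgs (numSrc pw mul) d = pointCode (radix k) (bundleSrc d) := by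
  obtain ⟨⟨r, u⟩ | ⟨r, s, t⟩ | ⟨r, s, t⟩, _ | _⟩ := d <;> simp only [Bundle.Valid] at hd <;>
    simp only [bundleArgs, numSrc, bundleSrc, Bool.toNat_false, Bool.toNat_true, add_zero, if_true,
      one_ne_zero, if_false, OfNat.ofNat_ne_zero, OfNat.ofNat_ne_one] <;>
    exact numPoint_eq hpw hmul (by omega) (by omega) (by omega)

/-- The number of a dart, where `rk` is the numbering of the edges. -/
def unitNumber (R : ℕ) (rk : ℕ → ℕ) (d : UnitDart) : ℕ := 2 * rk (unitCode R d.1) + d.2.toNat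

theorem numUnitCode_bundle
    (hmul : ∀ x < radix k * radix k * radix k * radix k, mul x = x * radix k)
    {b : Bundle} (hb : b.Valid k) (x : Bool) (c : ℕ) :
    bundleArgs (fun a r s t _ => numUnitCode mul a r s t c) (b, x) = unitCode (radix k) (b, c) := by
  obtain ⟨h1, -⟩ := radix_bounds k
  have h2 := hb.lt_radix
  cases b <;> simp only at h2 <;>
    exact numUnitCode_eq hmul (by omega) (by omega) (by omega) (by omega) _

theorem numFirst_eq (hpw : ∀ r ≤ k + 1, pw r = 2 ^ r)
    (hmul : ∀ x < radix k * radix k * radix k * radix k, mul x = x * radix k) {d : Bundle × Bool}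
    (hd : d.1.Valid k) :
    bundleArgs (numFirst pw ζ mul rk k) d = unitNumber (radix k) rk (unitFirst k ζ d) := by
  obtain ⟨b, x⟩ := d
  have h1 := fun c => numUnitCode_bundle hmul hd x c
  have h2 := numMult_eq (ζ := ζ) hpw b x
  cases b <;> cases x <;> simp only [bundleArgs] at h1 h2 <;>
    simp [bundleArgs, numFirst, h1, h2, unitFirst, unitNumber, two_mul]

theorem numNext_eq (hpw : ∀ r ≤ k + 1, pw r = 2 ^ r)
    (hmul : ∀ x < radix k * radix k * radix k * radix k, mul x = x * radix k) {d : UnitDart}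
    (hd : d.1.1.Valid k) :
    bundleArgs (fun a r s t x => numNext pw ζ mul rk k a r s t d.1.2 x) (d.1.1, d.2) =
      unitNumber (radix k) rk (unitNext k ζ d) := by
  obtain ⟨⟨b, c⟩, x⟩ := d
  simp only at hd
  have h1 := fun c => numUnitCode_bundle hmul hd x c
  have h2 := numMult_eq (ζ := ζ) hpw b x
  have h3 := numBundleNext_eq (φ := numFirst pw ζ mul rk k) (fun r hr => hpw r (by omega))
    (d := (b, x)) hd
  rw [numFirst_eq hpw hmul (bundleNext_valid hd)] at h3
  cases b <;> cases x <;> simp only [bundleArgs, Bool.toNat_false, Bool.toNat_true] at h1 h2 h3 <;>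
    simp only [bundleArgs, numNext, h1, h2, h3, unitNext, Bool.toNat_false, Bool.toNat_true, if_true,
      one_ne_zero, if_false] <;> split_ifs <;> simp [unitNumber, two_mul]

/-- Quantifying over φ allows the same decoding to be used for starts and for successors of darts.
-/
theorem unitCode_digits (hζ : ∀ u, ζ u ≤ 1) {b : Bundle} {c : ℕ} (hb : b.Valid k)
    (hc : c < mult k ζ b) {R y : ℕ} (hR : R = radix k) (hy : unitCode R (b, c) = y) :
    y % R = c ∧ ∀ (φ : ℕ → ℕ → ℕ → ℕ → ℕ → ℕ) (x : Bool),
      φ (y / R / R / R / R) (y / R / R / R % R) (y / R / R % R) (y / R % R) x.toNat =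
        bundleArgs φ (b, x) := by
  obtain ⟨h0, -⟩ := radix_bounds k
  have h1 := hc.trans (mult_lt_radix hζ b)
  have h2 := hb.lt_radix
  rw [← hR] at h0 h1 h2
  subst hy
  simp only [unitCode, mul_add_div_eq h1, mul_add_mod_eq h1, true_and]
  intro φ x
  rcases b with ⟨r, u⟩ | ⟨r, s, t⟩ | ⟨r, s, t⟩ <;> simp only [bundleCode, bundleArgs] at h2 ⊢ <;>
    rw [pack_mod (by omega), pack_div_mod (by omega) (by omega),
      pack_div_div_mod (by omega) (by omega) (by omega),
      pack_div_div_div (by omega) (by omega) (by omega)]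

end Base

end VCG

namespace VCG

open VCG.Bundle

/-! ### The program -/

section Computations

variable {a r s t c x : State → ℕ}

/-- In these computations array 0 holds ζ, array 4 the powers of two, array 7 the multiples of the
base and array 8 the numbering of the edges. The proof terms mirror the arithmetic descriptions. -/
theorem comp_numMult (ha : Comp a) (hr : Comp r) (hs : Comp s) :
    Comp fun σ => numMult (σ.arr 4) (σ.arr 0) (σ.reg 0) (a σ) (r σ) (s σ) := by
  have hk : Comp fun σ => σ.reg 0 := .reg (by omega)
  exact .ite (.eq ha (.lit 0))
    (.add (.ite (.eq hr (.lit 0)) (.lit 1) (.get 4 (.add hk (.lit 1))))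
      (.ite (.eq hr hk) (.get 0 hs) (.lit 0)))
    (.get 4 (.sub (.sub hk (.lit 1)) hr))

theorem comp_numUnitCode (ha : Comp a) (hr : Comp r) (hs : Comp s) (ht : Comp t) (hc : Comp c) :
    Comp fun σ => numUnitCode (σ.arr 7) (a σ) (r σ) (s σ) (t σ) (c σ) :=
  .add (.get 7 (.add (.get 7 (.add (.get 7 (.add (.get 7 ha) hr)) hs)) ht)) hc

theorem comp_numFirst (ha : Comp a) (hr : Comp r) (hs : Comp s) (ht : Comp t) (hx : Comp x) :
    Comp fun σ => numFirst (σ.arr 4) (σ.arr 0) (σ.arr 7) (σ.arr 8) (σ.reg 0) (a σ) (r σ) (s σ) (t σ)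
      (x σ) := by
  have h := Comp.get 8 (comp_numUnitCode ha hr hs ht
    (.ite (.eq hx (.lit 0)) (.lit 0) (.sub (comp_numMult ha hr hs) (.lit 1))))
  exact .add (.add h h) hx

theorem comp_numBundleNext {φ : State → ℕ → ℕ → ℕ → ℕ → ℕ → ℕ}
    (hφ : ∀ {a r s t x : State → ℕ}, Comp a → Comp r → Comp s → Comp t → Comp x →
      Comp fun σ => φ σ (a σ) (r σ) (s σ) (t σ) (x σ))
    (ha : Comp a) (hr : Comp r) (hs : Comp s) (ht : Comp t) (hx : Comp x) :
    Comp fun σ => numBundleNext (φ σ) (σ.arr 4) (σ.reg 0) (a σ) (r σ) (s σ) (t σ) (x σ) := by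
  have hk : Comp fun σ => σ.reg 0 := .reg (by omega)
  have h0 := Comp.lit 0
  have h1 := Comp.lit 1
  have h2 := Comp.lit 2
  have hr1 := hr.sub h1
  have hs1 := hs.add h1
  have hp := Comp.get 4 hr
  have hp1 := Comp.get 4 hr1
  exact .ite (.eq ha h1)
    (.ite (.eq hx h0) (.ite (.eq hs h0) (hφ h0 (.add hr h1) ht h0 h0) (hφ h2 hr hs ht h0))
      (.ite (.lt hs1 ht) (hφ h2 hr hs1 (.sub ht h1) h1) (hφ h0 hr (.sub ht h1) h0 h1)))
    (.ite (.eq ha h2)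
      (.ite (.eq hx h0) (hφ h1 hr (.sub hs h1) ht h1)
        (.ite (.lt (.add ht h1) hp) (hφ h1 hr hs (.add ht h1) h0)
          (hφ h0 (.add hr h1) (.add hp hs) h0 h0)))
      (.ite (.eq hx h0)
        (.ite (.eq hs h0) (.ite (.lt hr hk) (hφ h0 (.add hr h1) h0 h0 h0) (hφ h0 h0 h0 h0 h0))
          (.ite (.lt hr hk) (hφ h2 hr hs hs h0) (hφ h0 hr (.sub hs h1) h0 h1)))
        (.ite (.eq hr h0) (hφ h0 hk (.sub (.get 4 hk) h1) h0 h1)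
          (.ite (.eq hs1 hp) (hφ h0 hr1 (.sub hp1 h1) h0 h1)
            (.ite (.lt hs1 hp1) (hφ h1 hr1 h0 hs1 h0)
              (.ite (.eq hs1 hp1) (hφ h0 hr hs1 h0 h0)
                (hφ h2 hr1 (.sub hs1 hp1) (.sub hp1 h1) h1)))))))

theorem comp_numNext (ha : Comp a) (hr : Comp r) (hs : Comp s) (ht : Comp t) (hc : Comp c)
    (hx : Comp x) :
    Comp fun σ => numNext (σ.arr 4) (σ.arr 0) (σ.arr 7) (σ.arr 8) (σ.reg 0) (a σ) (r σ) (s σ) (t σ)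
      (c σ) (x σ) := by
  have h0 := Comp.get 8 (comp_numUnitCode ha hr hs ht (.add hc (.lit 1)))
  have h1 := Comp.get 8 (comp_numUnitCode ha hr hs ht (.sub hc (.lit 1)))
  have h2 := comp_numBundleNext
    (φ := fun σ => numFirst (σ.arr 4) (σ.arr 0) (σ.arr 7) (σ.arr 8) (σ.reg 0))
    comp_numFirst ha hr hs ht hx
  exact .ite (.eq hx (.lit 0))
    (.ite (.lt (.add hc (.lit 1)) (comp_numMult ha hr hs)) (.add (.add h0 h0) hx) h2)
    (.ite (.lt (.lit 0) hc) (.add (.add h1 h1) hx) h2)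

theorem comp_numPoint (hr : Comp r) (hs : Comp s) (ht : Comp t) :
    Comp fun σ => numPoint (σ.arr 4) (σ.arr 7) (r σ) (s σ) (t σ) := by
  have hcode : ∀ {r s t : State → ℕ}, Comp r → Comp s → Comp t →
      Comp fun σ => σ.arr 7 (σ.arr 7 (r σ) + s σ) + t σ := fun hr hs ht =>
    .add (.get 7 (.add (.get 7 hr) hs)) ht
  have hr1 := hr.add (.lit 1)
  have hp := Comp.get 4 hr
  exact .ite (.eq hs ht)
    (.ite (.eq hs (.lit 0)) (.lit 0) (.ite (.eq hs hp) (.lit 1) (hcode hr hs ht)))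
    (.ite (.eq hs (.lit 0)) (hcode hr1 ht ht)
      (.ite (.eq ht hp) (hcode hr1 (.add hp hs) (.add hp hs)) (hcode hr hs ht)))

theorem comp_numSrc (ha : Comp a) (hr : Comp r) (hs : Comp s) (ht : Comp t) (hx : Comp x) :
    Comp fun σ => numSrc (σ.arr 4) (σ.arr 7) (a σ) (r σ) (s σ) (t σ) (x σ) :=
  .ite (.eq ha (.lit 0)) (comp_numPoint hr (.add hs hx) (.add hs hx))
    (.ite (.eq ha (.lit 1)) (comp_numPoint hr (.add hs hx) ht) (comp_numPoint hr hs (.add ht hx)))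

theorem compP_numEdge (ha : Comp a) (hr : Comp r) (hs : Comp s) (ht : Comp t) (hc : Comp c) :
    CompP fun σ => NumEdge (σ.arr 4) (σ.arr 0) (σ.reg 0) (a σ) (r σ) (s σ) (t σ) (c σ) := by
  have hk : Comp fun σ => σ.reg 0 := .reg (by omega)
  have hp := Comp.get 4 hr
  exact .and (.lt hc (comp_numMult ha hr hs))
    (.or (.and (.eq ha (.lit 0)) (.and (.eq ht (.lit 0)) (.and (.le hr hk) (.lt hs hp))))
      (.or (.and (.eq ha (.lit 1)) (.and (.lt hr hk) (.and (.lt hs ht) (.lt ht hp))))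
        (.and (.eq ha (.lit 2)) (.and (.lt hr hk)
          (.and (.le (.lit 1) hs) (.and (.le hs ht) (.lt ht hp)))))))

theorem compP_numVertex (ha : Comp a) (hr : Comp r) (hs : Comp s) (ht : Comp t) :
    CompP fun σ => NumVertex (σ.arr 4) (σ.reg 0) (a σ) (r σ) (s σ) (t σ) := by
  have hk : Comp fun σ => σ.reg 0 := .reg (by omega)
  exact .and (.eq ha (.lit 0))
    (.or (.and (.eq hr (.lit 0)) (.and (.eq hs (.lit 0)) (.lt ht (.lit 2))))
      (.and (.le (.lit 1) hs) (.and (.le hs ht) (.and (.le hr hk)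
        (.and (.lt ht (.get 4 hr)) (.or (.lt hr hk) (.eq hs ht)))))))

end Computations

/-- An instance of the construction problem. -/
abbrev Instance : Type := (k : ℕ) × Finset (BitVector k)

/-- The number of codes. -/
def codeBound (k : ℕ) : ℕ := 2 ^ (5 * k + 10)

theorem codeBound_eq (k : ℕ) :
    codeBound k = radix k * radix k * radix k * radix k * radix k := by
  simp only [codeBound, radix, ← pow_add]
  congr 1
  omega

/-- The running time up to a constant factor. -/
def timeBound (i : Instance) : ℕ := codeBound i.1 + 1

/-- The tables of the powers of two and of the arithmetic operations. -/
structure Tables (i : Instance) (s : State) : Prop where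
  k : s.reg 0 = i.1
  zeta : s.arr 0 = charFun i.2
  pow : ∀ x ≤ 5 * i.1 + 10, s.arr 4 x = 2 ^ x
  div : ∀ y ≤ codeBound i.1, s.arr 5 y = y / radix i.1
  mod : ∀ y ≤ codeBound i.1, s.arr 6 y = y % radix i.1
  mul : ∀ y ≤ codeBound i.1, s.arr 7 y = y * radix i.1

theorem Tables.congr {i : Instance} {s s' : State} (h : Tables i s) (hk : s'.reg 0 = s.reg 0)
    (ha : ∀ a, a = 0 ∨ 4 ≤ a ∧ a ≤ 7 → s'.arr a = s.arr a) : Tables i s' where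
  k := by rw [hk, h.k]
  zeta := by rw [ha 0 (by omega), h.zeta]
  pow := by rw [ha 4 (by omega)]; exact h.pow
  div := by rw [ha 5 (by omega)]; exact h.div
  mod := by rw [ha 6 (by omega)]; exact h.mod
  mul := by rw [ha 7 (by omega)]; exact h.mul

/-- The tables are complete up to `j`. -/
structure TablesUpTo (i : Instance) (j : ℕ) (s : State) : Prop where
  k : s.reg 0 = i.1
  bound : s.reg 7 = codeBound i.1
  radix : s.reg 8 = radix i.1
  zeta : s.arr 0 = charFun i.2
  pow : ∀ x ≤ 5 * i.1 + 10, s.arr 4 x = 2 ^ x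
  div : ∀ y ≤ j, s.arr 5 y = y / VCG.radix i.1
  mod : ∀ y ≤ j, s.arr 6 y = y % VCG.radix i.1
  mul : ∀ y ≤ j, s.arr 7 y = y * VCG.radix i.1
  zeros : s.arr 8 0 = 0 ∧ s.arr 9 0 = 0

/-- The powers of two are complete up to `j`. -/
structure PowersUpTo (i : Instance) (j : ℕ) (s : State) : Prop where
  k : s.reg 0 = i.1
  bound : s.reg 7 = 5 * i.1 + 10
  zeta : s.arr 0 = charFun i.2
  pow : ∀ x ≤ j, s.arr 4 x = 2 ^ x
  zeros : s.arr 5 0 = 0 ∧ s.arr 6 0 = 0 ∧ s.arr 7 0 = 0 ∧ s.arr 8 0 = 0 ∧ s.arr 9 0 = 0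

theorem one_le_timeBound (i : Instance) : 1 ≤ timeBound i := Nat.le_add_left _ _

theorem comp_bound : Comp fun σ => σ.reg 0 + σ.reg 0 + σ.reg 0 + σ.reg 0 + σ.reg 0 + 10 := by
  have hk : Comp fun σ => σ.reg 0 := .reg (by omega)
  exact .add (.add (.add (.add (.add hk hk) hk) hk) hk) (.lit 10)

theorem task_powers_init :
    Task timeBound (fun i s => s = inputState i.1 i.2) (fun i => PowersUpTo i 0) := by
  refine Task.of_code ((Code.put 4 (.lit 0) (.lit 1)).seq (Code.set (r := 7) comp_bound))
    one_le_timeBound (fun i s s' hs h => ?_) ?_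
  · obtain ⟨h1, h2, h3, h4, h5⟩ := h
    rw [hs.1 0 (by omega)] at h1
    rw [hs.1 7 (by omega)] at h2
    rw [hs.2] at h3 h4 h5
    exact ⟨h1, h2, h3, h4, h5⟩
  · rintro ⟨k, Z⟩ s rfl
    refine ⟨by simp [State.setReg, State.setArr, inputState], ?_, ?_, ?_, ?_⟩
    · simp [State.setReg, State.setArr, inputState]
      omega
    · funext u
      simp [State.setReg, State.setArr, inputState, charFun]
    · intro x hx
      obtain rfl : x = 0 := by omega
      simp [State.setReg, State.setArr]
    · simp [State.setReg, State.setArr, inputState]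

/-- Powers arise by doubling. The table extends to the exponent 5k + 10, so that `codeBound` can be
looked up. -/
theorem task_powers : Task timeBound (fun i => PowersUpTo i 0)
    (fun i => PowersUpTo i (5 * i.1 + 10)) := by
  have h6 : Comp fun σ => σ.reg 6 := .reg (by omega)
  refine Task.loop (Code.put 4 (h6.add (.lit 1)) ((Comp.get 4 h6).add (.get 4 h6)))
    (fun s => rfl) PowersUpTo (fun i => 5 * i.1 + 10) ?_ ?_ (fun i j s h => h.bound) ?_
  · intro i
    have := Nat.lt_two_pow_self (n := 5 * i.1 + 10)
    rw [timeBound, codeBound]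
    omega
  · rintro i j s s' hr ha ⟨h1, h2, h3, h4, h5⟩
    rw [hr 0 (by omega) (by omega)] at h1
    rw [hr 7 (by omega) (by omega)] at h2
    rw [ha] at h3 h4 h5
    exact ⟨h1, h2, h3, h4, h5⟩
  · rintro i j s hj hs ⟨h1, h2, h3, h4, h5⟩
    refine ⟨h1, h2, by simpa [State.setArr] using h3, ?_, by simpa [State.setArr] using h5⟩
    intro x hx
    rcases Nat.lt_or_ge j x with h | h
    · obtain rfl : x = j + 1 := by omega
      simp only [State.setArr, Function.update_self, hs, h4 j le_rfl]
      ring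
    · simp only [State.setArr, Function.update_self, hs]
      rw [Function.update_of_ne (by omega), h4 x h]

theorem task_tables_init : Task timeBound (fun i => PowersUpTo i (5 * i.1 + 10))
    (fun i => TablesUpTo i 0) := by
  refine Task.of_code ((Code.set (r := 7) (.get 4 comp_bound)).seq
    (Code.set (r := 8) (.get 4 (.add (.reg (r := 0) (by omega)) (.lit 2)))))
    one_le_timeBound (fun i s s' hs h => ?_) ?_
  · obtain ⟨h1, h2, h3, h4, h5, h6, h7, h8, h9⟩ := h
    rw [hs.1 0 (by omega)] at h1
    rw [hs.1 7 (by omega)] at h2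
    rw [hs.1 8 (by omega)] at h3
    rw [hs.2] at h4 h5 h6 h7 h8 h9
    exact ⟨h1, h2, h3, h4, h5, h6, h7, h8, h9⟩
  · rintro i s ⟨h1, h2, h3, h4, h5, h6, h7, h8⟩
    have hz : ∀ y ≤ 0, y = 0 := fun y hy => by omega
    refine ⟨by simpa [State.setReg] using h1, ?_, ?_, h3, h4, ?_, ?_, ?_, h8⟩
    · simp only [State.setReg, h1]
      rw [Function.update_of_ne (by omega), Function.update_self, h4 _ (by omega), codeBound]
      congr 1
      omega
    · simp only [State.setReg, Function.update_self]
      rw [Function.update_of_ne (by omega), h1, h4 _ (by omega), radix]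
    all_goals
      intro y hy
      obtain rfl := hz y hy
      simp [State.setReg, h5, h6, h7]

/-- Counting with a carry: quotients and remainders are tabulated successively, without division. -/
theorem succ_div_mod {R y : ℕ} (hR : 0 < R) :
    (y + 1) / R = (if y % R + 1 < R then y / R else y / R + 1) ∧
      (y + 1) % R = if y % R + 1 < R then y % R + 1 else 0 := by
  have h1 := Nat.div_add_mod' y R
  have h2 := Nat.mod_lt y hR
  split_ifs with h
  · rw [show y + 1 = y / R * R + (y % R + 1) by omega]
    exact ⟨mul_add_div_eq h, mul_add_mod_eq h⟩
  · rw [show y + 1 = (y / R + 1) * R + 0 by rw [add_mul]; omega]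
    exact ⟨mul_add_div_eq hR, mul_add_mod_eq hR⟩

theorem task_tables : Task timeBound (fun i => TablesUpTo i 0)
    (fun i => TablesUpTo i (codeBound i.1)) := by
  have h6 : Comp fun σ => σ.reg 6 := .reg (by omega)
  have h8 : Comp fun σ => σ.reg 8 := .reg (by omega)
  have hc : CompP fun σ => σ.arr 6 (σ.reg 6) + 1 < σ.reg 8 := .lt (.add (.get 6 h6) (.lit 1)) h8
  refine Task.loop ((Code.put 7 (h6.add (.lit 1)) ((Comp.get 7 h6).add h8)).seq
    ((Code.put 5 (h6.add (.lit 1)) (.ite hc (.get 5 h6) (.add (.get 5 h6) (.lit 1)))).seq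
      (Code.put 6 (h6.add (.lit 1)) (.ite hc (.add (.get 6 h6) (.lit 1)) (.lit 0)))))
    (fun s => rfl) TablesUpTo (fun i => codeBound i.1) (fun i => le_rfl) ?_
    (fun i j s h => h.bound) ?_
  · rintro i j s s' hr ha ⟨h1, h2, h3, h4, h5, h6, h7, h8, h9⟩
    rw [hr 0 (by omega) (by omega)] at h1
    rw [hr 7 (by omega) (by omega)] at h2
    rw [hr 8 (by omega) (by omega)] at h3
    rw [ha] at h4 h5 h6 h7 h8 h9
    exact ⟨h1, h2, h3, h4, h5, h6, h7, h8, h9⟩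
  · rintro i j s hj hs ⟨h1, h2, h3, h4, h5, h6, h7, h8, h9⟩
    have hR := (radix_bounds i.1).1
    obtain ⟨hd, hm⟩ := succ_div_mod (R := radix i.1) (y := j) (by omega)
    refine ⟨h1, h2, h3, by simpa [State.setArr] using h4, by simpa [State.setArr] using h5,
      ?_, ?_, ?_, by simpa [State.setArr] using h9⟩
    all_goals
      intro x hx
      rcases Nat.lt_or_ge j x with h | h
      · obtain rfl : x = j + 1 := by omega
        simp [State.setArr, hs, h3, h6 j le_rfl, h7 j le_rfl, h8 j le_rfl, hd, hm, add_mul]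
      · simp [State.setArr, hs, show x ≠ j + 1 by omega, h6 x h, h7 x h, h8 x h]

end VCG

/-! ### Numbering the edges and vertices, and writing the darts -/

namespace VCG

open VCG.Bundle

/-- The number in register `6`, divided `n` times by the base. -/
def quo : ℕ → State → ℕ
  | 0, σ => σ.reg 6
  | n + 1, σ => σ.arr 5 (quo n σ)

/-- A digit of the number in register `6`. -/
def dig (n : ℕ) (σ : State) : ℕ := σ.arr 6 (quo n σ)

theorem comp_quo : ∀ n, Comp (quo n)
  | 0 => .reg (by omega)
  | n + 1 => .get 5 (comp_quo n)

theorem comp_dig (n : ℕ) : Comp (dig n) := .get 6 (comp_quo n)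

/-- The number in register `6` is the code of an edge. -/
def EdgeTest (σ : State) : Prop :=
  NumEdge (σ.arr 4) (σ.arr 0) (σ.reg 0) (quo 4 σ) (dig 3 σ) (dig 2 σ) (dig 1 σ) (dig 0 σ)

/-- The number in register `6` is the code of a vertex. -/
def VertexTest (σ : State) : Prop :=
  NumVertex (σ.arr 4) (σ.reg 0) (quo 3 σ) (dig 2 σ) (dig 1 σ) (dig 0 σ)

theorem compP_edgeTest : CompP EdgeTest :=
  compP_numEdge (comp_quo 4) (comp_dig 3) (comp_dig 2) (comp_dig 1) (comp_dig 0)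

theorem compP_vertexTest : CompP VertexTest :=
  compP_numVertex (comp_quo 3) (comp_dig 2) (comp_dig 1) (comp_dig 0)

namespace Tables

variable {i : Instance} {s : State} {y : ℕ}

theorem quo_eq (h : Tables i s) (hs : s.reg 6 = y) (hy : y ≤ codeBound i.1) (n : ℕ) :
    quo n s = (· / radix i.1)^[n] y ∧ quo n s ≤ codeBound i.1 := by
  induction n with
  | zero => exact ⟨hs, by rwa [quo, hs]⟩
  | succ n ih =>
    rw [Function.iterate_succ_apply', ← ih.1, quo, h.div _ ih.2]
    exact ⟨rfl, (Nat.div_le_self _ _).trans ih.2⟩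

theorem dig_eq (h : Tables i s) (hs : s.reg 6 = y) (hy : y ≤ codeBound i.1) (n : ℕ) :
    dig n s = (· / radix i.1)^[n] y % radix i.1 := by
  rw [dig, h.mod _ (h.quo_eq hs hy n).2, (h.quo_eq hs hy n).1]

theorem pow' (h : Tables i s) : ∀ r ≤ i.1 + 1, s.arr 4 r = 2 ^ r := fun r hr => h.pow r (by omega)

theorem mul' (h : Tables i s) :
    ∀ x < radix i.1 * radix i.1 * radix i.1 * radix i.1, s.arr 7 x = x * radix i.1 := by
  intro x hx
  refine h.mul x (hx.le.trans ?_)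
  rw [codeBound_eq]
  exact Nat.le_mul_of_pos_right _ (by have := (radix_bounds i.1).1; omega)

theorem edgeTest_iff (h : Tables i s) (hs : s.reg 6 = y) (hy : y ≤ codeBound i.1) :
    EdgeTest s ↔ IsEdge i.1 (charFun i.2) y := by
  rw [EdgeTest, isEdge_iff (charFun_le_one _) h.pow' rfl, h.zeta, h.k, (h.quo_eq hs hy 4).1,
    h.dig_eq hs hy, h.dig_eq hs hy, h.dig_eq hs hy, h.dig_eq hs hy]
  rfl

theorem vertexTest_iff (h : Tables i s) (hs : s.reg 6 = y) (hy : y ≤ codeBound i.1) :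
    VertexTest s ↔ IsVertex i.1 y := by
  rw [VertexTest, isVertex_iff h.pow' rfl, h.k, (h.quo_eq hs hy 3).1,
    h.dig_eq hs hy, h.dig_eq hs hy, h.dig_eq hs hy]
  rfl

theorem setArr (h : Tables i s) {a : ℕ} (ha : a ≠ 0 ∧ (a < 4 ∨ 7 < a)) (j v : ℕ) :
    Tables i (s.setArr a j v) := by
  refine h.congr rfl fun a' ha' => ?_
  simp only [State.setArr]
  rw [Function.update_of_ne (by omega)]

end Tables

/-- The numbering of the edges. -/
noncomputable def edgeRank (i : Instance) : ℕ → ℕ := rankOf (IsEdge i.1 (charFun i.2))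

/-- The numbering of the vertices. -/
noncomputable def vertexRank (i : Instance) : ℕ → ℕ := rankOf (IsVertex i.1)

/-- The numberings are complete up to `j`. -/
structure Ranks (i : Instance) (j : ℕ) (s : State) : Prop extends Tables i s where
  edge : ∀ y ≤ j, s.arr 8 y = edgeRank i y
  vertex : ∀ y ≤ j, s.arr 9 y = vertexRank i y

theorem Ranks.congr {i : Instance} {j : ℕ} {s s' : State} (h : Ranks i j s)
    (hk : s'.reg 0 = s.reg 0) (ha : ∀ a, a = 0 ∨ 4 ≤ a → s'.arr a = s.arr a) : Ranks i j s' where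
  toTables := h.toTables.congr hk fun a h => ha a (by omega)
  edge := by rw [ha 8 (by omega)]; exact h.edge
  vertex := by rw [ha 9 (by omega)]; exact h.vertex

theorem Ranks.setArr {i : Instance} {j : ℕ} {s : State} (h : Ranks i j s) {a : ℕ} (h0 : a ≠ 0)
    (h4 : a < 4) (x v : ℕ) : Ranks i j (s.setArr a x v) := by
  refine h.congr rfl fun a' ha' => ?_
  simp only [State.setArr]
  rw [Function.update_of_ne (by omega)]

theorem Task.imp {ι : Type} {bound : ι → ℕ} {P Q Q' : ι → State → Prop} (h : Task bound P Q)
    (h' : ∀ i s, Q i s → Q' i s) : Task bound P Q' := by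
  obtain ⟨p, C, hp⟩ := h
  refine ⟨p, C, fun i s hs => ?_⟩
  obtain ⟨s', t, h1, h2, h3⟩ := hp i s hs
  exact ⟨s', t, h1, h2, h' i s' h3⟩

/-- Register `7` contains the bound `N` and the property `A` holds. -/
def Bounded (N : Instance → ℕ) (A : Instance → ℕ → State → Prop) (i : Instance) (j : ℕ)
    (s : State) : Prop := s.reg 7 = N i ∧ A i j s

theorem TablesUpTo.ranks {i : Instance} {s : State} (h : TablesUpTo i (codeBound i.1) s) :
    Bounded (fun i => codeBound i.1) Ranks i 0 s := by
  refine ⟨h.bound, ⟨h.k, h.zeta, h.pow, h.div, h.mod, h.mul⟩, ?_, ?_⟩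
  · intro y hy
    obtain rfl : y = 0 := by omega
    rw [h.zeros.1, edgeRank, rankOf_zero]
  · intro y hy
    obtain rfl : y = 0 := by omega
    rw [h.zeros.2, vertexRank, rankOf_zero]

open Classical in
/-- Extend the numbering of the edges by one entry. -/
noncomputable def putEdgeRank (σ : State) : State :=
  σ.setArr 8 (σ.reg 6 + 1) (σ.arr 8 (σ.reg 6) + if EdgeTest σ then 1 else 0)

open Classical in
/-- Extend the numbering of the vertices by one entry. -/
noncomputable def putVertexRank (σ : State) : State :=
  σ.setArr 9 (σ.reg 6 + 1) (σ.arr 9 (σ.reg 6) + if VertexTest σ then 1 else 0)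

theorem code_putEdgeRank : Code putEdgeRank :=
  have h6 : Comp fun σ => σ.reg 6 := .reg (by omega)
  .put 8 (h6.add (.lit 1)) ((Comp.get 8 h6).add compP_edgeTest)

theorem code_putVertexRank : Code putVertexRank :=
  have h6 : Comp fun σ => σ.reg 6 := .reg (by omega)
  .put 9 (h6.add (.lit 1)) ((Comp.get 9 h6).add compP_vertexTest)

theorem task_ranks : Task timeBound (fun i => Bounded (fun i => codeBound i.1) Ranks i 0)
    (fun i => Bounded (fun i => codeBound i.1) Ranks i (codeBound i.1)) := by
  classical
  refine Task.loop (code_putEdgeRank.seq code_putVertexRank) (fun s => rfl)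
    (Bounded (fun i => codeBound i.1) Ranks) (fun i => codeBound i.1)
    (fun i => le_rfl) ?_ (fun i j s h => h.1) ?_
  · rintro i j s s' hr ha ⟨h1, h2⟩
    exact ⟨by rw [← hr 7 (by omega) (by omega), h1],
      h2.congr (hr 0 (by omega) (by omega)).symm fun a _ => by rw [ha]⟩
  · rintro i j s hj hs ⟨h1, h2⟩
    refine ⟨h1, ?_⟩
    rw [putVertexRank, putEdgeRank]
    have hT := h2.toTables.setArr (a := 8) (by omega) (s.reg 6 + 1)
      (s.arr 8 (s.reg 6) + if EdgeTest s then 1 else 0)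
    have hT' := hT.setArr (a := 9) (by omega)
    refine ⟨hT' _ _, ?_, ?_⟩
    · intro x hx
      have he := h2.edgeTest_iff hs hj.le
      rcases Nat.lt_or_ge j x with h | h
      · obtain rfl : x = j + 1 := by omega
        simp [State.setArr, hs, h2.edge j le_rfl, edgeRank, rankOf_succ, he]
      · simp [State.setArr, hs, show x ≠ j + 1 by omega, h2.edge x h]
    · intro x hx
      have he := hT.vertexTest_iff hs hj.le
      rcases Nat.lt_or_ge j x with h | h
      · obtain rfl : x = j + 1 := by omega
        have h3 := h2.vertex j le_rfl
        simp only [he]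
        simp [State.setArr, hs, h3, vertexRank, rankOf_succ]
      · simp [State.setArr, hs, show x ≠ j + 1 by omega, h2.vertex x h]

/-! ### The darts -/

/-- Write the start of a dart of the edge with the code in register `6`. -/
def putSrc (x : ℕ) (σ : State) : State :=
  σ.setArr 1 (σ.arr 8 (σ.reg 6) + σ.arr 8 (σ.reg 6) + x)
    (σ.arr 9 (numSrc (σ.arr 4) (σ.arr 7) (quo 4 σ) (dig 3 σ) (dig 2 σ) (dig 1 σ) x))

/-- Write the successor of a dart of the edge with the code in register `6`. -/
def putNext (x : ℕ) (σ : State) : State :=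
  σ.setArr 2 (σ.arr 8 (σ.reg 6) + σ.arr 8 (σ.reg 6) + x)
    (numNext (σ.arr 4) (σ.arr 0) (σ.arr 7) (σ.arr 8) (σ.reg 0) (quo 4 σ) (dig 3 σ) (dig 2 σ)
      (dig 1 σ) (dig 0 σ) x)

theorem code_putSrc (x : ℕ) : Code (putSrc x) := by
  have h := Comp.get 8 (Comp.reg (r := 6) (by omega))
  exact .put 1 (.add (.add h h) (.lit x))
    (.get 9 (comp_numSrc (comp_quo 4) (comp_dig 3) (comp_dig 2) (comp_dig 1) (.lit x)))

theorem code_putNext (x : ℕ) : Code (putNext x) := by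
  have h := Comp.get 8 (Comp.reg (r := 6) (by omega))
  exact .put 2 (.add (.add h h) (.lit x))
    (comp_numNext (comp_quo 4) (comp_dig 3) (comp_dig 2) (comp_dig 1) (comp_dig 0) (.lit x))

theorem unitNext_valid {k : ℕ} {ζ : ℕ → ℕ} {d : UnitDart} (hb : d.1.1.Valid k)
    (hc : d.1.2 < mult k ζ d.1.1) : (unitNext k ζ d).1.1.Valid k ∧
      (unitNext k ζ d).1.2 < mult k ζ (unitNext k ζ d).1.1 := by
  have hfirst : ∀ x : Bundle × Bool, x.1.Valid k → (unitFirst k ζ x).1.1.Valid k ∧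
      (unitFirst k ζ x).1.2 < mult k ζ (unitFirst k ζ x).1.1 := by
    rintro ⟨b, _ | _⟩ hb
    · exact ⟨hb, mult_pos k ζ b⟩
    · exact ⟨hb, Nat.sub_lt (mult_pos k ζ b) one_pos⟩
  obtain ⟨⟨b, c⟩, _ | _⟩ := d <;> simp only [unitNext] <;> split_ifs with h
  · exact ⟨hb, h⟩
  · exact hfirst _ (bundleNext_valid hb)
  · simp only at hc
    exact ⟨hb, by simp only; omega⟩
  · exact hfirst _ (bundleNext_valid hb)

section Put

variable {i : Instance} {s : State} {b : Bundle} {c : ℕ}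

/-- All indices looked up stay within the ranges in which the tables are correct, so the arithmetic
description gives the true value. -/
theorem putSrc_eq (h : Ranks i (codeBound i.1) s) (hb : b.Valid i.1)
    (hc : c < mult i.1 (charFun i.2) b) (hs : s.reg 6 = unitCode (radix i.1) (b, c)) (x : Bool) :
    putSrc x.toNat s = s.setArr 1 (unitNumber (radix i.1) (edgeRank i) ((b, c), x))
      (vertexRank i (pointCode (radix i.1) (bundleSrc (b, x)))) := by
  have hζ := charFun_le_one i.2
  have hy := unitCode_lt hζ hb hc
  rw [← codeBound_eq] at hy
  obtain ⟨-, h2⟩ := unitCode_digits hζ hb hc rfl rfl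
  have h3 := h.vertex (pointCode (radix i.1) (bundleSrc (b, x))) (by
    refine (pointCode_radix_lt (bundleSrc_valid hb)).le.trans ?_
    have hR := (radix_bounds i.1).1
    rw [codeBound_eq, one_mul, mul_assoc (_ * _ * _) (radix i.1) (radix i.1)]
    exact Nat.le_mul_of_pos_right _ (Nat.mul_pos (by omega) (by omega)))
  rw [putSrc, (h.quo_eq hs hy.le 4).1, h.dig_eq hs hy.le, h.dig_eq hs hy.le, h.dig_eq hs hy.le]
  have h4 := h2 (numSrc (s.arr 4) (s.arr 7)) x
  simp only [Function.iterate_succ_apply', Function.iterate_zero, id]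
  rw [h4, numSrc_eq h.pow' h.mul' hb, h3, hs, h.edge _ hy.le, unitNumber, two_mul]

theorem putNext_eq (h : Ranks i (codeBound i.1) s) (hb : b.Valid i.1)
    (hc : c < mult i.1 (charFun i.2) b) (hs : s.reg 6 = unitCode (radix i.1) (b, c)) (x : Bool) :
    putNext x.toNat s = s.setArr 2 (unitNumber (radix i.1) (edgeRank i) ((b, c), x))
      (unitNumber (radix i.1) (edgeRank i) (unitNext i.1 (charFun i.2) ((b, c), x))) := by
  have hζ := charFun_le_one i.2
  have hy := unitCode_lt hζ hb hc
  rw [← codeBound_eq] at hy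
  obtain ⟨h1, h2⟩ := unitCode_digits hζ hb hc rfl rfl
  obtain ⟨hb', hc'⟩ := unitNext_valid (d := ((b, c), x)) hb hc
  have hy' := unitCode_lt hζ hb' hc'
  rw [← codeBound_eq] at hy'
  have h3 := numNext_eq (ζ := charFun i.2) (rk := s.arr 8) h.pow' h.mul' (d := ((b, c), x)) hb
  rw [putNext, (h.quo_eq hs hy.le 4).1, h.dig_eq hs hy.le, h.dig_eq hs hy.le, h.dig_eq hs hy.le,
    h.dig_eq hs hy.le, h.zeta, h.k]
  have h4 := h2 (fun a r s' t x => numNext (s.arr 4) (charFun i.2) (s.arr 7) (s.arr 8) i.1 a r s' t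
    (unitCode (radix i.1) (b, c) % radix i.1) x) x
  simp only [Function.iterate_succ_apply', Function.iterate_zero, id]
  rw [h4, h1, h3, unitNumber, h.edge _ hy'.le, hs, h.edge _ hy.le, unitNumber, unitNumber, two_mul,
    two_mul]

end Put

/-- The darts of the edges with codes below `j` are described. -/
structure DartsUpTo (i : Instance) (j : ℕ) (s : State) : Prop where
  ranks : Ranks i (codeBound i.1) s
  src : ∀ b c x, b.Valid i.1 → c < mult i.1 (charFun i.2) b → unitCode (radix i.1) (b, c) < j →
    s.arr 1 (unitNumber (radix i.1) (edgeRank i) ((b, c), x)) =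
      vertexRank i (pointCode (radix i.1) (bundleSrc (b, x)))
  next : ∀ b c x, b.Valid i.1 → c < mult i.1 (charFun i.2) b → unitCode (radix i.1) (b, c) < j →
    s.arr 2 (unitNumber (radix i.1) (edgeRank i) ((b, c), x)) =
      unitNumber (radix i.1) (edgeRank i) (unitNext i.1 (charFun i.2) ((b, c), x))

theorem DartsUpTo.congr {i : Instance} {j : ℕ} {s s' : State} (h : DartsUpTo i j s)
    (hk : s'.reg 0 = s.reg 0) (ha : ∀ a ≠ 3, s'.arr a = s.arr a) : DartsUpTo i j s' where
  ranks := h.ranks.congr hk fun a h => ha a (by omega)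
  src := by rw [ha 1 (by omega)]; exact h.src
  next := by rw [ha 2 (by omega)]; exact h.next

/-- The numbering is strictly increasing on codes of edges, so later writes do not overwrite earlier
entries. -/
theorem unitNumber_ne {i : Instance} {b b' : Bundle} {c c' : ℕ} (hb : b.Valid i.1)
    (hc : c < mult i.1 (charFun i.2) b)
    (h : unitCode (radix i.1) (b, c) < unitCode (radix i.1) (b', c')) (x x' : Bool) :
    unitNumber (radix i.1) (edgeRank i) ((b, c), x) ≠
      unitNumber (radix i.1) (edgeRank i) ((b', c'), x') := by
  classical
  have : edgeRank i (unitCode (radix i.1) (b, c)) < edgeRank i (unitCode (radix i.1) (b', c')) :=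
    Nat.count_strict_mono ⟨b, c, hb, hc, rfl⟩ h
  simp only [unitNumber]
  cases x <;> cases x' <;> simp <;> omega

open Classical in
/-- Write the darts of the edge with the code in register `6`. -/
noncomputable def putDarts (σ : State) : State :=
  if EdgeTest σ then putNext 1 (putNext 0 (putSrc 1 (putSrc 0 σ))) else σ

theorem code_putDarts : Code putDarts := by
  classical
  exact Code.ite compP_edgeTest ((((code_putSrc 0).seq (code_putSrc 1)).seq (code_putNext 0)).seq
    (code_putNext 1)) Code.id

theorem putDarts_reg (σ : State) : (putDarts σ).reg = σ.reg := by
  rw [putDarts]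
  split_ifs <;> rfl

theorem task_darts : Task timeBound
    (fun i => Bounded (fun i => codeBound i.1) DartsUpTo i 0)
    (fun i => Bounded (fun i => codeBound i.1) DartsUpTo i (codeBound i.1)) := by
  refine Task.loop code_putDarts putDarts_reg (Bounded (fun i => codeBound i.1) DartsUpTo)
    (fun i => codeBound i.1) (fun i => le_rfl) ?_ (fun i j s h => h.1) ?_
  · rintro i j s s' hr ha ⟨h1, h2⟩
    exact ⟨by rw [← hr 7 (by omega) (by omega), h1],
      h2.congr (hr 0 (by omega) (by omega)).symm fun a _ => by rw [ha]⟩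
  · rintro i j s hj hs ⟨h1, h2⟩
    have htest := h2.ranks.edgeTest_iff hs hj.le
    have hζ := charFun_le_one i.2
    by_cases hE : EdgeTest s
    · rw [putDarts, if_pos hE]
      obtain ⟨b, c, hb, hc, rfl⟩ := htest.1 hE
      have e1 := putSrc_eq h2.ranks hb hc hs false
      have r1 := h2.ranks.setArr (a := 1) (by omega) (by omega)
        (unitNumber (radix i.1) (edgeRank i) ((b, c), false))
        (vertexRank i (pointCode (radix i.1) (bundleSrc (b, false))))
      have e2 := putSrc_eq r1 hb hc hs true
      have r2 := r1.setArr (a := 1) (by omega) (by omega)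
        (unitNumber (radix i.1) (edgeRank i) ((b, c), true))
        (vertexRank i (pointCode (radix i.1) (bundleSrc (b, true))))
      have e3 := putNext_eq r2 hb hc hs false
      have r3 := r2.setArr (a := 2) (by omega) (by omega)
        (unitNumber (radix i.1) (edgeRank i) ((b, c), false))
        (unitNumber (radix i.1) (edgeRank i) (unitNext i.1 (charFun i.2) ((b, c), false)))
      have e4 := putNext_eq r3 hb hc hs true
      simp only [Bool.toNat_false, Bool.toNat_true] at e1 e2 e3 e4
      rw [e1, e2, e3, e4]
      have r4 := r3.setArr (a := 2) (by omega) (by omega)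
        (unitNumber (radix i.1) (edgeRank i) ((b, c), true))
        (unitNumber (radix i.1) (edgeRank i) (unitNext i.1 (charFun i.2) ((b, c), true)))
      have hne : unitNumber (radix i.1) (edgeRank i) ((b, c), false) ≠
          unitNumber (radix i.1) (edgeRank i) ((b, c), true) := by
        simp [unitNumber]
      refine ⟨h1, r4, ?_, ?_⟩
      · intro b' c' x hb' hc' hlt
        rcases Nat.lt_or_ge (unitCode (radix i.1) (b', c')) (unitCode (radix i.1) (b, c)) with h | h
        · have n1 := unitNumber_ne hb' hc' h x false
          have n2 := unitNumber_ne hb' hc' h x true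
          simp [State.setArr, n1, n2, h2.src b' c' x hb' hc' h]
        · obtain ⟨rfl, rfl⟩ := unitCode_inj hζ hb' hc' hb hc (by omega)
          cases x <;> simp [State.setArr, hne]
      · intro b' c' x hb' hc' hlt
        rcases Nat.lt_or_ge (unitCode (radix i.1) (b', c')) (unitCode (radix i.1) (b, c)) with h | h
        · have n1 := unitNumber_ne hb' hc' h x false
          have n2 := unitNumber_ne hb' hc' h x true
          simp [State.setArr, n1, n2, h2.next b' c' x hb' hc' h]
        · obtain ⟨rfl, rfl⟩ := unitCode_inj hζ hb' hc' hb hc (by omega)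
          cases x <;> simp [State.setArr, hne]
    · rw [putDarts, if_neg hE]
      have hlt : ∀ b c, b.Valid i.1 → c < mult i.1 (charFun i.2) b →
          unitCode (radix i.1) (b, c) < j + 1 → unitCode (radix i.1) (b, c) < j := by
        intro b c hb hc h
        refine lt_of_le_of_ne (by omega) fun h' => hE (htest.2 ⟨b, c, hb, hc, h'⟩)
      exact ⟨h1, h2.ranks, fun b c x hb hc h => h2.src b c x hb hc (hlt b c hb hc h),
        fun b c x hb hc h => h2.next b c x hb hc (hlt b c hb hc h)⟩

end VCG

namespace VCG

open VCG.Bundle RotationSystem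

/-! ### The distinguished vertices -/

/-- The vertex `z i`. -/
def zPoint (k i : ℕ) : Point := .p (k - 1 - i + 1) (2 ^ (k - 1 - i)) (2 ^ (k - 1 - i))

theorem zPoint_valid {k i : ℕ} (h : i < k) : (zPoint k i).Valid k := by
  have h1 : 2 ^ (k - 1 - i + 1) = 2 * 2 ^ (k - 1 - i) := by rw [pow_succ]; ring
  have h2 : 1 ≤ 2 ^ (k - 1 - i) := Nat.one_le_two_pow
  exact ⟨h2, le_rfl, by omega, (lt_or_eq_of_le (by omega)).imp_right fun h => ⟨h, rfl⟩⟩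

theorem pointCode_lt_codeBound {k : ℕ} {v : Point} (h : v.Valid k) :
    pointCode (radix k) v < codeBound k := by
  refine (pointCode_radix_lt h).trans_le ?_
  have hR := (radix_bounds k).1
  rw [codeBound_eq, one_mul, mul_assoc (_ * _ * _) (radix k) (radix k)]
  exact Nat.le_mul_of_pos_right _ (Nat.mul_pos (by omega) (by omega))

theorem unitCode_lt_codeBound {k : ℕ} {ζ : ℕ → ℕ} (hζ : ∀ u, ζ u ≤ 1) {b : Bundle} {c : ℕ}
    (hb : b.Valid k) (hc : c < mult k ζ b) : unitCode (radix k) (b, c) < codeBound k := by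
  rw [codeBound_eq]
  exact unitCode_lt hζ hb hc

/-- The state describes all darts, and the vertices `z i` for `i < j`. -/
structure TargetsUpTo (i : Instance) (j : ℕ) (s : State) : Prop where
  darts : DartsUpTo i (codeBound i.1) s
  z : ∀ x < j, s.arr 3 x = vertexRank i (pointCode (radix i.1) (zPoint i.1 x))

/-- Write the vertex `z i` with the index in register `6`. -/
def putTarget (σ : State) : State :=
  σ.setArr 3 (σ.reg 6) (σ.arr 9 (σ.arr 7 (σ.arr 7 (σ.reg 0 - 1 - σ.reg 6 + 1) +
    σ.arr 4 (σ.reg 0 - 1 - σ.reg 6)) + σ.arr 4 (σ.reg 0 - 1 - σ.reg 6)))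

theorem code_putTarget : Code putTarget := by
  have h6 : Comp fun σ => σ.reg 6 := .reg (by omega)
  have hr : Comp fun σ => σ.reg 0 - 1 - σ.reg 6 := .sub (.sub (.reg (by omega)) (.lit 1)) h6
  exact .put 3 h6 (.get 9 (.add (.get 7 (.add (.get 7 (.add hr (.lit 1))) (.get 4 hr)))
    (.get 4 hr)))

theorem putTarget_eq {i : Instance} {s : State} {j : ℕ} (h : Ranks i (codeBound i.1) s)
    (hj : j < i.1) (hs : s.reg 6 = j) :
    putTarget s = s.setArr 3 j (vertexRank i (pointCode (radix i.1) (zPoint i.1 j))) := by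
  obtain ⟨h1, h2, h3⟩ := radix_bounds i.1
  have hp := pow_le_of_le (show i.1 - 1 - j ≤ i.1 by omega)
  have e1 : i.1 - 1 - j + 1 < radix i.1 := by omega
  have e2 := mul_add_lt e1 (show 2 ^ (i.1 - 1 - j) < radix i.1 by omega)
  have hle : radix i.1 * radix i.1 ≤ radix i.1 * radix i.1 * radix i.1 * radix i.1 := by
    rw [mul_assoc (radix i.1 * radix i.1)]
    exact Nat.le_mul_of_pos_right _ (Nat.mul_pos (by omega) (by omega))
  have hle' : radix i.1 ≤ radix i.1 * radix i.1 := Nat.le_mul_of_pos_right _ (by omega)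
  rw [putTarget, hs, h.k, h.mul' (i.1 - 1 - j + 1) (by omega), h.pow _ (by omega),
    h.mul' _ (by omega),
    ← h.vertex _ (pointCode_lt_codeBound (zPoint_valid hj)).le]
  simp [zPoint, pointCode, pack]

theorem task_targets_init : Task timeBound
    (fun i => Bounded (fun i => codeBound i.1) DartsUpTo i (codeBound i.1))
    (fun i => Bounded (fun i => i.1) TargetsUpTo i 0) := by
  refine Task.of_code (Code.set (r := 7) (.reg (r := 0) (by omega))) one_le_timeBound
    (fun i s s' hs h => ?_) ?_
  · exact ⟨by rw [← hs.1 7 (by omega), h.1],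
      h.2.darts.congr (hs.1 0 (by omega)).symm fun a _ => by rw [hs.2], fun x hx => by omega⟩
  · rintro i s ⟨-, h2⟩
    refine ⟨?_, h2.congr rfl fun a _ => rfl, fun x hx => by omega⟩
    simp [State.setReg, h2.ranks.k]

theorem task_targets : Task timeBound (fun i => Bounded (fun i => i.1) TargetsUpTo i 0)
    (fun i => Bounded (fun i => i.1) TargetsUpTo i i.1) := by
  refine Task.loop code_putTarget (fun s => rfl) (Bounded (fun i => i.1) TargetsUpTo)
    (fun i => i.1) ?_ ?_ (fun i j s h => h.1) ?_
  · intro i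
    have := Nat.lt_two_pow_self (n := 5 * i.1 + 10)
    rw [timeBound, codeBound]
    omega
  · rintro i j s s' hr ha ⟨h1, h2⟩
    exact ⟨by rw [← hr 7 (by omega) (by omega), h1],
      h2.darts.congr (hr 0 (by omega) (by omega)).symm fun a _ => by rw [ha], by
        rw [← ha]; exact h2.z⟩
  · rintro i j s hj hs ⟨h1, h2⟩
    rw [putTarget_eq h2.darts.ranks hj hs]
    refine ⟨h1, h2.darts.congr rfl fun a ha => ?_, fun x hx => ?_⟩
    · simp [State.setArr, ha]
    · rcases Nat.lt_or_ge x j with h | h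
      · simp [State.setArr, h.ne, h2.z x h]
      · obtain rfl : x = j := by omega
        simp [State.setArr]

/-- The state describes the gadget. -/
structure Finished (i : Instance) (s : State) : Prop where
  vertices : s.reg 1 = vertexRank i (codeBound i.1)
  edges : s.reg 2 = edgeRank i (codeBound i.1)
  w : s.reg 3 = vertexRank i 0 ∧ s.reg 4 = vertexRank i 1
  outer : s.reg 5 = 0
  targets : TargetsUpTo i i.1 s

theorem task_finish : Task timeBound (fun i => Bounded (fun i => i.1) TargetsUpTo i i.1)
    Finished := by
  have hN := Comp.get 4 comp_bound
  refine Task.of_code ((((Code.set (r := 1) (.get 9 hN)).seq (Code.set (r := 2) (.get 8 hN))).seq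
    ((Code.set (r := 3) (.get 9 (.lit 0))).seq (Code.set (r := 4) (.get 9 (.lit 1))))).seq
    (Code.set (r := 5) (.lit 0))) one_le_timeBound (fun i s s' hs h => ?_) ?_
  · obtain ⟨h1, h2, h3, h4, h5, h6⟩ := h
    rw [hs.1 1 (by omega)] at h1
    rw [hs.1 2 (by omega)] at h2
    rw [hs.1 3 (by omega), hs.1 4 (by omega)] at h3
    rw [hs.1 5 (by omega)] at h4
    exact ⟨h1, h2, h3, h4, h5.congr (hs.1 0 (by omega)).symm fun a _ => by rw [hs.2],
      by rw [← hs.2]; exact h6⟩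
  · rintro i s ⟨-, h⟩
    have hr := h.darts.ranks
    have h1 : 1 ≤ codeBound i.1 := Nat.one_le_two_pow
    have hb : s.arr 4 (s.reg 0 + s.reg 0 + s.reg 0 + s.reg 0 + s.reg 0 + 10) = codeBound i.1 := by
      rw [hr.k, hr.pow _ (by omega), codeBound]
      congr 1
      omega
    refine ⟨?_, ?_, ⟨?_, ?_⟩, ?_, h.darts.congr ?_ fun a _ => rfl, h.z⟩
    · simp [State.setReg, hb, hr.vertex]
    · simp [State.setReg, hb, hr.edge]
    · simp [State.setReg, hr.vertex]
    · simp [State.setReg, hr.vertex 1 h1]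
    · simp [State.setReg]
    · simp [State.setReg]

theorem task_construct : Task timeBound (fun i s => s = inputState i.1 i.2) Finished :=
  task_powers_init.seq <| task_powers.seq <| task_tables_init.seq <|
    (task_tables.imp fun _ _ h => h.ranks).seq <|
    -- No code is below 0, so the invariant for the darts holds vacuously at the beginning.
    (task_ranks.imp fun _ _ h => (⟨h.1, h.2, fun _ _ _ _ _ h => absurd h (Nat.not_lt_zero _),
      fun _ _ _ _ _ h => absurd h (Nat.not_lt_zero _)⟩ :
        Bounded (fun i => codeBound i.1) DartsUpTo _ 0 _)).seq <|
    task_darts.seq <| task_targets_init.seq <| task_targets.seq task_finish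

/-! ### The numbered gadget -/

theorem exists_vertexNumbering (i : Instance) :
    ∃ e : VertexOf i.1 ≃ Fin (vertexRank i (codeBound i.1)),
      ∀ v, (e v : ℕ) = vertexRank i (pointCode (radix i.1) v.1) :=
  exists_rankEquiv (key := fun v : VertexOf i.1 => pointCode (radix i.1) v.1)
    (fun v v' h => Subtype.ext (pointCode_radix_inj v.2 v'.2 h))
    (fun v => pointCode_lt_codeBound v.2)
    fun _ => ⟨fun ⟨v, hv, h⟩ => ⟨⟨v, hv⟩, h⟩, fun ⟨v, h⟩ => ⟨v.1, v.2, h⟩⟩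

theorem exists_edgeNumbering (i : Instance) :
    ∃ e : GadgetEdge i.1 (charFun i.2) ≃ Fin (edgeRank i (codeBound i.1)),
      ∀ x, (e x : ℕ) = edgeRank i (unitCode (radix i.1) (unitEdge x)) := by
  have hζ := charFun_le_one i.2
  refine exists_rankEquiv
    (key := fun x : GadgetEdge i.1 (charFun i.2) => unitCode (radix i.1) (unitEdge x)) ?_
    (fun x => unitCode_lt_codeBound hζ x.1.2 x.2.2)
    fun _ => ⟨fun ⟨b, c, hb, hc, h⟩ => ⟨⟨⟨b, hb⟩, ⟨c, hc⟩⟩, h⟩,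
      fun ⟨x, h⟩ => ⟨x.1.1, x.2.1, x.1.2, x.2.2, h⟩⟩
  rintro ⟨⟨b, hb⟩, c, hc⟩ ⟨⟨b', hb'⟩, c', hc'⟩ h
  obtain ⟨rfl, rfl⟩ := unitCode_inj hζ hb hc hb' hc' h
  rfl

theorem Finished.describes {i : Instance} {s : State} (h : Finished i s)
    {eV : VertexOf i.1 ≃ Fin (vertexRank i (codeBound i.1))}
    (hV : ∀ v, (eV v : ℕ) = vertexRank i (pointCode (radix i.1) v.1))
    {eE : GadgetEdge i.1 (charFun i.2) ≃ Fin (edgeRank i (codeBound i.1))}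
    (hE : ∀ x, (eE x : ℕ) = edgeRank i (unitCode (radix i.1) (unitEdge x))) :
    Describes s (gadget eV eE) (fun j : Fin i.1 => eV ⟨zPoint i.1 j, zPoint_valid j.2⟩)
      (fun c => eV ⟨.w c, trivial⟩) := by
  have hcode : ∀ d, dartCode (dartEquiv eE d) = unitNumber (radix i.1) (edgeRank i) (unit d) :=
    fun d => congrArg (fun x => 2 * x + d.2.toNat) (hE d.1)
  refine ⟨h.vertices, h.edges, ?_, ?_, ?_, fun d => ?_, fun d => ?_, fun j => ?_⟩
  · rw [h.w.1, hV]
    simp [pointCode, pack]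
  · rw [h.w.2, hV]
    simp [pointCode, pack]
  · change _ = dartCode (dartEquiv eE (gadgetOuter i.1 (charFun i.2)))
    rw [h.outer, hcode]
    change 0 = 2 * edgeRank i (unitCode (radix i.1) (D 0 0, 0)) + 0
    -- The outer dart belongs to the edge with code 0, which is the first in the numbering.
    have : unitCode (radix i.1) (D 0 0, 0) = 0 := by simp [unitCode, bundleCode, pack]
    rw [this, edgeRank, rankOf_zero]
  · obtain ⟨d, rfl⟩ := (dartEquiv eE).surjective d
    have h1 := (gadgetRotation i.1 (charFun i.2)).renamed_src eV eE d
    change (gadget eV eE).src (dartEquiv eE d) = _ at h1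
    rw [h1, hV, hcode]
    exact h.targets.darts.src _ _ _ d.1.1.2 d.1.2.2
      (unitCode_lt_codeBound (charFun_le_one i.2) d.1.1.2 d.1.2.2)
  · obtain ⟨d, rfl⟩ := (dartEquiv eE).surjective d
    have h1 := (gadgetRotation i.1 (charFun i.2)).renamed_next eV eE d
    change (gadget eV eE).next (dartEquiv eE d) = _ at h1
    rw [h1, hcode, hcode, unit_next]
    exact h.targets.darts.next _ _ _ d.1.1.2 d.1.2.2
      (unitCode_lt_codeBound (charFun_le_one i.2) d.1.1.2 d.1.2.2)
  · rw [h.targets.z j j.2, hV]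

end VCG

/-! ### Conclusion: the gadget, its size and the running time -/

theorem mainTheorem12 :
    ∃ (p : VCG.Prog) (C : ℕ), ∀ (k : ℕ) (Z : Finset (VCG.BitVector k)),
      ∃ (n m : ℕ) (G : VCG.PlaneMultigraph (Fin n) (Fin m))
        (z : Fin k → Fin n) (w : Bool → Fin n),
        VCG.IsVectorContainmentGadget k (VCG.gammaHat k) Z G z w ∧
        n + m ≤ C * 2 ^ (C * k) ∧
        ∃ (s : VCG.State) (t : ℕ), VCG.Exec p (VCG.inputState k Z) s t ∧
          t ≤ C * 2 ^ (C * k) ∧ VCG.Describes s G z w := by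
  obtain ⟨p, C, hp⟩ := VCG.task_construct
  -- As a factor, 2048 * (C + 1) absorbs 2 * (C + 1) times the 2^10 in `codeBound`; as an exponent,
  -- it exceeds 5.
  have hbound : ∀ k a, a ≤ 2 * (C + 1) →
      a * VCG.codeBound k ≤ (2048 * (C + 1)) * 2 ^ (2048 * (C + 1) * k) := by
    intro k a ha
    have h1 : VCG.codeBound k = 1024 * 2 ^ (5 * k) := by
      rw [VCG.codeBound, pow_add]
      ring
    have h2 : 2 ^ (5 * k) ≤ 2 ^ (2048 * (C + 1) * k) :=
      Nat.pow_le_pow_right two_pos (Nat.mul_le_mul_right k (by omega))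
    calc a * VCG.codeBound k = a * 1024 * 2 ^ (5 * k) := by rw [h1]; ring
      _ ≤ _ := Nat.mul_le_mul (by omega) h2
  refine ⟨p, 2048 * (C + 1), fun k Z => ?_⟩
  let i : VCG.Instance := ⟨k, Z⟩
  obtain ⟨eV, hV⟩ := VCG.exists_vertexNumbering i
  obtain ⟨eE, hE⟩ := VCG.exists_edgeNumbering i
  obtain ⟨s, t, h1, h2, h3⟩ := hp i _ rfl
  refine ⟨_, _, VCG.gadget eV eE, _, _, ?_, ?_, s, t, h1, ?_, h3.describes hV hE⟩
  · exact (VCG.gadgetCoord eV eE).isVectorContainmentGadget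
      (fun j => by simp [VCG.gadgetCoord]; rfl) fun c => by simp [VCG.gadgetCoord]
  · have h4 : VCG.vertexRank i (VCG.codeBound k) ≤ VCG.codeBound k := VCG.rankOf_le _ _
    have h5 : VCG.edgeRank i (VCG.codeBound k) ≤ VCG.codeBound k := VCG.rankOf_le _ _
    have := hbound k 2 (by omega)
    exact (Nat.add_le_add h4 h5).trans (by omega)
  · have h4 : 1 ≤ VCG.codeBound k := Nat.one_le_two_pow
    -- The time bound `codeBound k + 1` is at most twice `codeBound k`.
    refine h2.trans (le_trans ?_ (hbound k (2 * C) (by omega)))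
    rw [mul_comm 2 C, mul_assoc]
    exact Nat.mul_le_mul_left C (by change VCG.codeBound k + 1 ≤ _; omega)
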